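/- **Formal systems.** Let $T^X$ be the set of finite types generated from the ground types $0$ (natural numbers) and $X$ by $(\sigma,\tau)\mapsto\tau(\sigma)$ (functionals from $\sigma$ to $\tau$); write $1=0(0)$. $\mathcal A^\omega$ is classical many-sorted arithmetic in all types of $T^X$: typed terms built by application from variables and constants $0$, $S$, the combinators $\Pi,\Sigma$ and simultaneous primitive recursors in all finite types; the only primitive relation is $=_0$, with equality axioms; $S$-axioms, full induction, defining axioms of $\Pi,\Sigma$ and of the recursors; equality at a type $\tau_n(\cdots)(\tau_1)$ abbreviates pointwise equality down to the ground type; extensionality is present only as the quantifier-free rule (from $A_0\to s=_\sigma t$ infer $A_0\to r[s]=_\tau r[t]$, $A_0$ quantifier-free); further the quantifier-free axiom of choice and the axiom of dependent choice, each for tuples of variables of arbitrary types. Real numbers are represented by type-$1$ objects $f$, read as Cauchy sequences of coded rationals with rate $2^{-n}$ via the usual operation $f\mapsto\hat f$; $=_{\mathbb R},\le_{\mathbb R}$ are $\Pi^0_1$- and $<_{\mathbb R}$ is a $\Sigma^0_1$-formula, and the operations on reals are closed terms. The term $(\gamma)^{-1}_l$ represents $1/\gamma$ whenever $|\gamma|>_{\mathbb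 R}2^{-l}$. Throughout, an expression containing $\gamma^{-1}$ stands for the one with $(\gamma)^{-1}_l$, where $l^0$ is an additional universally quantified variable, under the additional premise $|\gamma|>_{\mathbb R}2^{-l}$. $\mathcal A^\omega[X,\langle\cdot,\cdot\rangle]$ adds to $\mathcal A^\omega$ constants $0_X,1_X,+_X,-_X,\cdot_X,\|\cdot\|_X$ with the axioms of a real linear space, the usual axioms for the norm (which make the operations and the norm extensional for $=_X$, with $\|1_X\|_X=_{\mathbb R}1$), where $x=_Xy:\equiv\|x-_Xy\|_X=_{\mathbb R}0$, and the parallelogram law; one puts $\langle x,y\rangle_X:=\frac14(\|x+_Xy\|_X^2-\|x-_Xy\|_X^2)$. $\mathcal U^\omega$ adds to $\mathcal A^\omega[X,\langle\cdot,\cdot\rangle]$ constants $\chi_A$ of type $0(X)(X)$, $J^{\chi_A}$ of type $X(X)(1)$, $\tilde\rho,\tilde\gamma$ of type $1$, $m_{\tilde\gamma},n_{\tilde\gamma}$ of type $0$, $c_X$ of type $X$; with $y\in Ax:\equiv\chi_Axy=_00$ and $J^A_\gamma x:=J^{\chi_A}\gamma x$, the new axioms are * (I) $\forall x^X,y^X(\chi_Axy\le_01)$;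 * (II) $\forall\gamma^1,x^X\,(\gamma>_{\mathbb R}0\to\gamma^{-1}(x-_XJ^A_\gamma x)\in A(J^A_\gamma x))$; * (III) $\forall x^X,y^X,u^X,v^X\,(u\in Ax\wedge v\in Ay\to\langle x-_Xy,u-_Xv\rangle_X\ge_{\mathbb R}\tilde\rho\|u-_Xv\|_X^2)$; * (IV) $\tilde\gamma\ge_{\mathbb R}2^{-m_{\tilde\gamma}}$; * (V) $\tilde\rho\ge_{\mathbb R}-\tilde\gamma+2^{-n_{\tilde\gamma}}$. **Proposition.** $\mathcal A^\omega[X,\langle\cdot,\cdot\rangle]$ proves: 1. for all $\alpha^1\in(0,1]$ and $x^X,y^X$: $\ \alpha^2(\|x\|^2-\|(1-\alpha^{-1})x+\alpha^{-1}y\|^2)=_{\mathbb R}\alpha(\|x\|^2-\alpha^{-1}(1-\alpha)\|x-y\|^2-\|y\|^2)$; 2. for all $\alpha^1$ and $x^X,y^X$: $\ \alpha^2\|x\|^2-\|(\alpha-1)x+y\|^2=_{\mathbb R}2\alpha\langle x-y,y\rangle-(1-2\alpha)\|x-y\|^2$. Further, $\mathcal U^\omega$ proves, where in (5), (6), (8),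 (9) $\alpha=\frac1{2(\tilde\rho/\gamma+1)}$: 3. $J^A_\gamma$ is single-valued if $\tilde\rho>-\gamma$: $\ \forall p^X,x^X,\gamma^1\,(\gamma>_{\mathbb R}0\wedge\tilde\rho>_{\mathbb R}-\gamma\wedge\gamma^{-1}(x-p)\in Ap\to p=_XJ^A_\gamma x)$; 4. $J^{\chi_A}$ is extensional in both arguments if $\tilde\rho>-\gamma$: $\ \forall\gamma^1,\gamma'^1,x^X,x'^X\,(\gamma>_{\mathbb R}0\wedge\gamma'>_{\mathbb R}0\wedge\tilde\rho>_{\mathbb R}-\gamma\wedge x=_Xx'\wedge\gamma=_{\mathbb R}\gamma'\to J^A_\gamma x=_XJ^A_{\gamma'}x')$; 5. for all $\gamma^1,x^X,y^X$ with $\gamma>_{\mathbb R}0$ and $\tilde\rho>_{\mathbb R}-\gamma$, putting $d=(x-J^A_\gamma x)-(y-J^A_\gamma y)$: $\ 2\alpha\langle J^A_\gamma x-J^A_\gamma y,d\rangle\ge_{\mathbb R}(1-2\alpha)\|d\|^2$; 6. if $\gamma>_{\mathbb R}0$ and $\tilde\rho>_{\mathbb R}-\gamma$, then $J^A_\gamma$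 is $\alpha$-conically nonexpansive: $2(\tilde\rho/\gamma+1)>_{\mathbb R}0$ (so that $\alpha$ is defined), $\alpha\in(0,\infty)$, and $(1-\alpha^{-1})\mathrm{Id}+\alpha^{-1}J^A_\gamma$ is nonexpansive; 7. $\forall\gamma^1,x^X,y^X\,(\gamma>_{\mathbb R}0\wedge\tilde\rho\ge_{\mathbb R}-\gamma/2\to\|J^A_\gamma x-J^A_\gamma y\|\le_{\mathbb R}\|x-y\|)$; 8. for all $\gamma^1,x^X,y^X$ with $\gamma>_{\mathbb R}0$ and $\tilde\rho\ge_{\mathbb R}-\gamma/2$: $\ (1-\alpha)\|(x-J^A_\gamma x)-(y-J^A_\gamma y)\|^2\le_{\mathbb R}\alpha(\|x-y\|^2-\|J^A_\gamma x-J^A_\gamma y\|^2)$; 9. if $\gamma>_{\mathbb R}0$ and $\tilde\rho>_{\mathbb R}-\gamma/2$, then $J^A_\gamma$ is $\alpha$-averaged: $2(\tilde\rho/\gamma+1)>_{\mathbb R}0$ (so that $\alpha$ is defined), $\alpha\in(0,1)$, and $(1-\alpha^{-1})\mathrm{Id}+\alpha^{-1}J^A_\gamma$ is nonexpansive. -/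

import Mathlib

namespace ProofMining

/-! ## Finite types over the ground types `0` (naturals) and `X` (abstract space) -/

/-- The set `T^X` of finite types.  `arr σ τ` is the type of functionals from `σ` to `τ`,
written `τ(σ)` in the literature. -/
inductive Ty : Type
  | nat : Ty
  | X : Ty
  | arr : Ty → Ty → Ty

infixr:60 " ➝ " => Ty.arr

/-- Type `1 = 0(0)`, whose objects represent real numbers. -/
abbrev Ty.real : Ty := Ty.nat ➝ Ty.nat

/-- Typing contexts; the head of the list is the most recently bound variable. -/
abbrev Ctx : Type := List Ty

/-- Typed de Bruijn variables. -/
inductive Var : Ctx → Ty → Type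
  | z {Γ : Ctx} {σ : Ty} : Var (σ :: Γ) σ
  | s {Γ : Ctx} {σ τ : Ty} : Var Γ τ → Var (σ :: Γ) τ

/-- There is no variable in the empty context. -/
def Var.elim {τ : Ty} {C : Type} (x : Var [] τ) : C := nomatch x

/-- `arrsF f [ρ₁, …, ρₖ] τ` is the type `f ρ₁ ➝ ⋯ ➝ f ρₖ ➝ τ`. -/
def arrsF (f : Ty → Ty) : List Ty → Ty → Ty
  | [], τ => τ
  | ρ :: ρs, τ => f ρ ➝ arrsF f ρs τ

/-- `arrs [ρ₁, …, ρₖ] τ` is the type `ρ₁ ➝ ⋯ ➝ ρₖ ➝ τ`. -/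
abbrev arrs : List Ty → Ty → Ty := arrsF (fun ρ => ρ)

/-- Type of the constant `R_i` for simultaneous primitive recursion in the types `ρs`,
where `ρ` is the type with index `i`. -/
abbrev recTy (ρs : List Ty) (ρ : Ty) : Ty :=
  Ty.nat ➝ arrs ρs (arrsF (fun σ => arrs ρs (Ty.nat ➝ σ)) ρs ρ)

/-! ## Terms -/

/-- The constants: zero, successor, the combinators `Π` and `Σ`, the simultaneous recursors,
the constants of normed linear spaces, and additional constants from a family `E`. -/
inductive Const (E : Ty → Type) : Ty → Type
  | zero : Const E Ty.nat
  | succ : Const E (Ty.nat ➝ Ty.nat)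
  | combK (σ τ : Ty) : Const E (σ ➝ τ ➝ σ)
  | combS (ρ σ τ : Ty) : Const E ((ρ ➝ σ ➝ τ) ➝ (ρ ➝ σ) ➝ ρ ➝ τ)
  | recur (ρs : List Ty) (ρ : Ty) (i : Var ρs ρ) : Const E (recTy ρs ρ)
  | zeroX : Const E Ty.X
  | oneX : Const E Ty.X
  | addX : Const E (Ty.X ➝ Ty.X ➝ Ty.X)
  | negX : Const E (Ty.X ➝ Ty.X)
  | smulX : Const E (Ty.real ➝ Ty.X ➝ Ty.X)
  | normX : Const E (Ty.X ➝ Ty.real)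
  | extra {τ : Ty} (c : E τ) : Const E τ

/-- Terms over a context: variables, constants and application. -/
inductive Tm (E : Ty → Type) (Γ : Ctx) : Ty → Type
  | var {τ : Ty} (x : Var Γ τ) : Tm E Γ τ
  | const {τ : Ty} (c : Const E τ) : Tm E Γ τ
  | app {σ τ : Ty} (t : Tm E Γ (σ ➝ τ)) (u : Tm E Γ σ) : Tm E Γ τ

infixl:100 " ⬝ " => Tm.app

/-- Renamings of variables. -/
abbrev Ren (Γ Δ : Ctx) : Type := ∀ τ : Ty, Var Γ τ → Var Δ τ

/-- Simultaneous substitutions. -/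
abbrev Subst (E : Ty → Type) (Γ Δ : Ctx) : Type := ∀ τ : Ty, Var Γ τ → Tm E Δ τ

section Terms

variable {E : Ty → Type} {Γ Δ : Ctx} {ρ σ τ : Ty}

def Tm.ren (θ : Ren Γ Δ) : {τ : Ty} → Tm E Γ τ → Tm E Δ τ
  | _, .var x => .var (θ _ x)
  | _, .const c => .const c
  | _, .app t u => .app (t.ren θ) (u.ren θ)

def Tm.subst (θ : Subst E Γ Δ) : {τ : Ty} → Tm E Γ τ → Tm E Δ τ
  | _, .var x => θ _ x
  | _, .const c => .const c
  | _, .app t u => .app (t.subst θ) (u.subst θ)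

/-- Weakening by one variable. -/
def Tm.wk (t : Tm E Γ τ) : Tm E (σ :: Γ) τ := t.ren (fun _ x => Var.s x)

/-- A closed term viewed in an arbitrary context. -/
def Tm.cl (t : Tm E [] τ) : Tm E Γ τ := t.ren (fun _ x => x.elim)

/-- Extension of a substitution under a binder. -/
def Subst.lift (θ : Subst E Γ Δ) : Subst E (σ :: Γ) (σ :: Δ)
  | _, Var.z => .var Var.z
  | _, Var.s x => (θ _ x).wk

/-- The substitution of `t` for the most recently bound variable. -/
def Subst.single (t : Tm E Γ σ) : Subst E (σ :: Γ) Γ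
  | _, Var.z => t
  | _, Var.s x => .var x

/-- The substitution of `S v0` for `v0`. -/
def Subst.succ : Subst E (Ty.nat :: Γ) (Ty.nat :: Γ)
  | _, Var.z => .const .succ ⬝ .var Var.z
  | _, Var.s x => .var (Var.s x)

abbrev v0 : Tm E (σ :: Γ) σ := .var Var.z
abbrev v1 {a : Ty} : Tm E (a :: σ :: Γ) σ := .var (Var.s Var.z)
abbrev v2 {a b : Ty} : Tm E (a :: b :: σ :: Γ) σ := .var (Var.s (Var.s Var.z))
abbrev v3 {a b c : Ty} : Tm E (a :: b :: c :: σ :: Γ) σ := .var (Var.s (Var.s (Var.s Var.z)))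
abbrev v4 {a b c d : Ty} : Tm E (a :: b :: c :: d :: σ :: Γ) σ :=
  .var (Var.s (Var.s (Var.s (Var.s Var.z))))
abbrev v5 {a b c d e : Ty} : Tm E (a :: b :: c :: d :: e :: σ :: Γ) σ :=
  .var (Var.s (Var.s (Var.s (Var.s (Var.s Var.z)))))

/-- Application of a term to a tuple of arguments. -/
def appF (f : Ty → Ty) : (ρs : List Ty) → Tm E Γ (arrsF f ρs τ) →
    (∀ ρ, Var ρs ρ → Tm E Γ (f ρ)) → Tm E Γ τ
  | [], t, _ => t
  | _ :: ρs, t, u => appF f ρs (t ⬝ u _ Var.z) (fun _ x => u _ (Var.s x))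

/-- The term `(R_i) x y₁ … yₖ z₁ … zₖ`. -/
def recApp (ρs : List Ty) (i : Var ρs ρ) (x : Tm E Γ Ty.nat) (y : ∀ σ, Var ρs σ → Tm E Γ σ)
    (z : ∀ σ, Var ρs σ → Tm E Γ (arrs ρs (Ty.nat ➝ σ))) : Tm E Γ ρ :=
  appF (fun σ => arrs ρs (Ty.nat ➝ σ)) ρs
    (appF (fun σ => σ) ρs (.const (.recur ρs ρ i) ⬝ x) y) z

/-- `λ`-abstraction, defined from the combinators by bracket abstraction. -/
def Tm.lam : {τ : Ty} → Tm E (σ :: Γ) τ → Tm E Γ (σ ➝ τ)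
  | _, .var Var.z =>
      .const (.combS σ (σ ➝ σ) σ) ⬝ .const (.combK σ (σ ➝ σ)) ⬝ .const (.combK σ σ)
  | _, .var (Var.s x) => .const (.combK _ σ) ⬝ .var x
  | _, .const c => .const (.combK _ σ) ⬝ .const c
  | _, .app t u => .const (.combS σ _ _) ⬝ t.lam ⬝ u.lam

/-! ## Closed terms for primitive recursive arithmetic -/

abbrev tZero : Tm E Γ Ty.nat := .const .zero
abbrev tSucc (t : Tm E Γ Ty.nat) : Tm E Γ Ty.nat := .const .succ ⬝ t

/-- The numeral of `n`. -/
def numeral : ℕ → Tm E Γ Ty.nat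
  | 0 => tZero
  | n + 1 => tSucc (numeral n)

/-- Primitive recursion for numbers: base value `b`, step `s`; in `s` the variable `v0` is the
current argument and `v1` is the previous value. -/
def natRec (n b : Tm E Γ Ty.nat) (s : Tm E (Ty.nat :: Ty.nat :: Γ) Ty.nat) : Tm E Γ Ty.nat :=
  recApp [Ty.nat] Var.z n (fun | _, Var.z => b) (fun | _, Var.z => s.lam.lam)

def cAdd : Tm E [] (Ty.nat ➝ Ty.nat ➝ Ty.nat) := (natRec v0 v1 (tSucc v1)).lam.lam
def nAdd (s t : Tm E Γ Ty.nat) : Tm E Γ Ty.nat := cAdd.cl ⬝ s ⬝ t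

def cMul : Tm E [] (Ty.nat ➝ Ty.nat ➝ Ty.nat) := (natRec v0 tZero (nAdd v1 v3)).lam.lam
def nMul (s t : Tm E Γ Ty.nat) : Tm E Γ Ty.nat := cMul.cl ⬝ s ⬝ t

def cPred : Tm E [] (Ty.nat ➝ Ty.nat) := (natRec v0 tZero v0).lam
def nPred (t : Tm E Γ Ty.nat) : Tm E Γ Ty.nat := cPred.cl ⬝ t

/-- Truncated subtraction. -/
def cSub : Tm E [] (Ty.nat ➝ Ty.nat ➝ Ty.nat) := (natRec v0 v1 (nPred v1)).lam.lam
def nSub (s t : Tm E Γ Ty.nat) : Tm E Γ Ty.nat := cSub.cl ⬝ s ⬝ t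

/-- `|s - t|`. -/
def nDist (s t : Tm E Γ Ty.nat) : Tm E Γ Ty.nat := nAdd (nSub s t) (nSub t s)

/-- Case distinction: `nCond c a b` is `a` if `c = 0`, and `b` otherwise. -/
def cCond : Tm E [] (Ty.nat ➝ Ty.nat ➝ Ty.nat ➝ Ty.nat) := (natRec v2 v1 v2).lam.lam.lam
def nCond (c a b : Tm E Γ Ty.nat) : Tm E Γ Ty.nat := cCond.cl ⬝ c ⬝ a ⬝ b

/-- `2 ^ n`. -/
def cPow2 : Tm E [] (Ty.nat ➝ Ty.nat) := (natRec v0 (numeral 1) (nAdd v1 v1)).lam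
def nPow2 (t : Tm E Γ Ty.nat) : Tm E Γ Ty.nat := cPow2.cl ⬝ t

/-- `n mod 2`. -/
def cOdd : Tm E [] (Ty.nat ➝ Ty.nat) := (natRec v0 tZero (nSub (numeral 1) v1)).lam
def nOdd (t : Tm E Γ Ty.nat) : Tm E Γ Ty.nat := cOdd.cl ⬝ t

/-- `⌊n / 2⌋`. -/
def cHalf : Tm E [] (Ty.nat ➝ Ty.nat) := (natRec v0 tZero (nAdd v1 (nOdd v0))).lam
def nHalf (t : Tm E Γ Ty.nat) : Tm E Γ Ty.nat := cHalf.cl ⬝ t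

/-- Bounded search: `cMin f n` is the least `u ≤ n` with `f u = 0` if there is one, and `0`
otherwise. -/
def cMin : Tm E [] (Ty.real ➝ Ty.nat ➝ Ty.nat) :=
  (natRec v0 tZero
    (nCond (v3 ⬝ v1) v1 (nCond (v3 ⬝ tSucc v0) (tSucc v0) tZero))).lam.lam
def nMin (f : Tm E (Ty.nat :: Γ) Ty.nat) (n : Tm E Γ Ty.nat) : Tm E Γ Ty.nat :=
  cMin.cl ⬝ f.lam ⬝ n

/-- The pairing function `j n m = min u ≤ (n + m)² + 3n + m [2u = (n + m)² + 3n + m]`. -/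
def cPair : Tm E [] (Ty.nat ➝ Ty.nat ➝ Ty.nat) :=
  let w : Tm E [Ty.nat, Ty.nat] Ty.nat :=
    nAdd (nAdd (nMul (nAdd v1 v0) (nAdd v1 v0)) (nMul (numeral 3) v1)) v0
  (nMin (nDist (nMul (numeral 2) v0) w.wk) w).lam.lam
def nPair (s t : Tm E Γ Ty.nat) : Tm E Γ Ty.nat := cPair.cl ⬝ s ⬝ t

/-- First projection: the least `x ≤ n` such that `j x y = n` for some `y ≤ n`. -/
def cFst : Tm E [] (Ty.nat ➝ Ty.nat) :=
  (nMin (nDist (nPair v0 (nMin (nDist (nPair v1 v0) v2) v1)) v1) v0).lam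
def nFst (t : Tm E Γ Ty.nat) : Tm E Γ Ty.nat := cFst.cl ⬝ t

/-- Second projection: the least `y ≤ n` such that `j x y = n` for some `x ≤ n`. -/
def cSnd : Tm E [] (Ty.nat ➝ Ty.nat) :=
  (nMin (nDist (nPair (nMin (nDist (nPair v0 v1) v2) v1) v0) v1) v0).lam
def nSnd (t : Tm E Γ Ty.nat) : Tm E Γ Ty.nat := cSnd.cl ⬝ t

/-! ## Rational numbers

The code `j n m` stands for `(n / 2) / (m + 1)` if `n` is even and for `-((n + 1) / 2) / (m + 1)`
if `n` is odd. -/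

/-- Positive part of the numerator. -/
def cPos : Tm E [] (Ty.nat ➝ Ty.nat) :=
  (nCond (nOdd (nFst v0)) (nHalf (nFst v0)) tZero).lam
def qPos (q : Tm E Γ Ty.nat) : Tm E Γ Ty.nat := cPos.cl ⬝ q

/-- Negative part of the numerator. -/
def cNeg : Tm E [] (Ty.nat ➝ Ty.nat) :=
  (nCond (nOdd (nFst v0)) tZero (nHalf (tSucc (nFst v0)))).lam
def qNegPart (q : Tm E Γ Ty.nat) : Tm E Γ Ty.nat := cNeg.cl ⬝ q

/-- Denominator. -/
def qDen (q : Tm E Γ Ty.nat) : Tm E Γ Ty.nat := tSucc (nSnd q)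

/-- A code of the rational number `(a - b) / d`, for `d > 0`. -/
def cMk : Tm E [] (Ty.nat ➝ Ty.nat ➝ Ty.nat ➝ Ty.nat) :=
  (nPair (nCond (nSub v1 v2) (nMul (numeral 2) (nSub v2 v1))
    (nPred (nMul (numeral 2) (nSub v1 v2)))) (nPred v0)).lam.lam.lam
def qMk (a b d : Tm E Γ Ty.nat) : Tm E Γ Ty.nat := cMk.cl ⬝ a ⬝ b ⬝ d

def cQAdd : Tm E [] (Ty.nat ➝ Ty.nat ➝ Ty.nat) :=
  (qMk (nAdd (nMul (qPos v1) (qDen v0)) (nMul (qPos v0) (qDen v1)))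
    (nAdd (nMul (qNegPart v1) (qDen v0)) (nMul (qNegPart v0) (qDen v1)))
    (nMul (qDen v1) (qDen v0))).lam.lam
def qAdd (p q : Tm E Γ Ty.nat) : Tm E Γ Ty.nat := cQAdd.cl ⬝ p ⬝ q

def cQNeg : Tm E [] (Ty.nat ➝ Ty.nat) := (qMk (qNegPart v0) (qPos v0) (qDen v0)).lam
def qNeg (q : Tm E Γ Ty.nat) : Tm E Γ Ty.nat := cQNeg.cl ⬝ q

def qSub (p q : Tm E Γ Ty.nat) : Tm E Γ Ty.nat := qAdd p (qNeg q)

def cQMul : Tm E [] (Ty.nat ➝ Ty.nat ➝ Ty.nat) :=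
  (qMk (nAdd (nMul (qPos v1) (qPos v0)) (nMul (qNegPart v1) (qNegPart v0)))
    (nAdd (nMul (qPos v1) (qNegPart v0)) (nMul (qNegPart v1) (qPos v0)))
    (nMul (qDen v1) (qDen v0))).lam.lam
def qMul (p q : Tm E Γ Ty.nat) : Tm E Γ Ty.nat := cQMul.cl ⬝ p ⬝ q

def cQAbs : Tm E [] (Ty.nat ➝ Ty.nat) :=
  (qMk (nAdd (qPos v0) (qNegPart v0)) tZero (qDen v0)).lam
def qAbs (q : Tm E Γ Ty.nat) : Tm E Γ Ty.nat := cQAbs.cl ⬝ q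

/-- Reciprocal of a nonzero rational number. -/
def cQInv : Tm E [] (Ty.nat ➝ Ty.nat) :=
  (qMk (nCond (qPos v0) tZero (qDen v0)) (nCond (qNegPart v0) tZero (qDen v0))
    (nAdd (qPos v0) (qNegPart v0))).lam
def qInv (q : Tm E Γ Ty.nat) : Tm E Γ Ty.nat := cQInv.cl ⬝ q

/-- `qLe p q = 0` if and only if `p ≤ q`. -/
def cQLe : Tm E [] (Ty.nat ➝ Ty.nat ➝ Ty.nat) :=
  (nSub (nAdd (nMul (qPos v1) (qDen v0)) (nMul (qNegPart v0) (qDen v1)))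
    (nAdd (nMul (qPos v0) (qDen v1)) (nMul (qNegPart v1) (qDen v0)))).lam.lam
def qLe (p q : Tm E Γ Ty.nat) : Tm E Γ Ty.nat := cQLe.cl ⬝ p ⬝ q

/-- `qLt p q = 0` if and only if `p < q`. -/
def cQLt : Tm E [] (Ty.nat ➝ Ty.nat ➝ Ty.nat) :=
  (nSub (tSucc (nAdd (nMul (qPos v1) (qDen v0)) (nMul (qNegPart v0) (qDen v1))))
    (nAdd (nMul (qPos v0) (qDen v1)) (nMul (qNegPart v1) (qDen v0)))).lam.lam
def qLt (p q : Tm E Γ Ty.nat) : Tm E Γ Ty.nat := cQLt.cl ⬝ p ⬝ q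

/-- The code of the rational number `a / (m + 1)`. -/
def rat (a m : ℕ) : Tm E Γ Ty.nat := nPair (numeral (2 * a)) (numeral m)

/-- The rational number `2 ^ (-n)`. -/
def cQPow : Tm E [] (Ty.nat ➝ Ty.nat) := (nPair (numeral 2) (nPred (nPow2 v0))).lam
def qPow (n : Tm E Γ Ty.nat) : Tm E Γ Ty.nat := cQPow.cl ⬝ n

/-! ## Real numbers

A functional `f` of type `1` represents the limit of the sequence of rational numbers `hat f`.
Here `hat f n` is `f n` if `|f k - f (k + 1)| < 2 ^ (-k - 1)` for all `k < n`; otherwise it is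
`f k` for the least `k < n` violating this.  So every `f` represents a real number, and
`hat f n` approximates it up to `2 ^ (-n)`. -/

/-- The index used by `hat f n`: `n` itself, or the least violating `k < n`. -/
def cHatIdx : Tm E [] (Ty.real ➝ Ty.nat ➝ Ty.nat) :=
  (natRec v0 tZero
    (nCond (nAdd (nDist v1 v0)
        (qLt (qAbs (qSub (v3 ⬝ v0) (v3 ⬝ tSucc v0))) (qPow (tSucc v0))))
      (tSucc v0) v1)).lam.lam

def cHat : Tm E [] (Ty.real ➝ Ty.nat ➝ Ty.nat) := (v1 ⬝ (cHatIdx.cl ⬝ v1 ⬝ v0)).lam.lam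
def hat (f : Tm E Γ Ty.real) (n : Tm E Γ Ty.nat) : Tm E Γ Ty.nat := cHat.cl ⬝ f ⬝ n

/-- A rational number as a real number: the constant sequence. -/
def cOfRat : Tm E [] (Ty.nat ➝ Ty.real) := (v1 : Tm E [Ty.nat, Ty.nat] Ty.nat).lam.lam
def ofRat (q : Tm E Γ Ty.nat) : Tm E Γ Ty.real := cOfRat.cl ⬝ q

/-- The real number `a / (m + 1)`. -/
def rconst (a m : ℕ) : Tm E Γ Ty.real := ofRat (rat a m)

/-- The real number `2 ^ (-l)`. -/
def rpow (l : Tm E Γ Ty.nat) : Tm E Γ Ty.real := ofRat (qPow l)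

def cRAdd : Tm E [] (Ty.real ➝ Ty.real ➝ Ty.real) :=
  (qAdd (hat v2 (tSucc v0)) (hat v1 (tSucc v0))).lam.lam.lam

def cRNeg : Tm E [] (Ty.real ➝ Ty.real) := (qNeg (hat v1 v0)).lam.lam

def cRAbs : Tm E [] (Ty.real ➝ Ty.real) := (qAbs (hat v1 v0)).lam.lam

/-- Multiplication: `n ↦ hat f (n + k + 1) * hat g (n + k + 1)`, where `k` is the sum of the
absolute values of the numerators of `f 0` and `g 0`, so that all values of `hat f` and `hat g`
are bounded by `2 ^ k`. -/
def cRMul : Tm E [] (Ty.real ➝ Ty.real ➝ Ty.real) :=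
  let k : Tm E [Ty.nat, Ty.real, Ty.real] Ty.nat :=
    nAdd (nAdd (qPos (v2 ⬝ tZero)) (qNegPart (v2 ⬝ tZero)))
      (nAdd (qPos (v1 ⬝ tZero)) (qNegPart (v1 ⬝ tZero)))
  (qMul (hat v2 (tSucc (nAdd v0 k))) (hat v1 (tSucc (nAdd v0 k)))).lam.lam.lam

/-- The term `l, f ↦ (f)⁻¹_l`, which represents `f⁻¹` whenever `|f| > 2 ^ (-l)`: with
`q = hat f (n + 2l)`, the `n`-th approximation is the reciprocal of `max q (2 ^ (-l))` if
`0 < q`, and of `min q (-2 ^ (-l))` otherwise. -/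
def cRInv : Tm E [] (Ty.nat ➝ Ty.real ➝ Ty.real) :=
  let q : Tm E [Ty.nat, Ty.real, Ty.nat] Ty.nat := hat v1 (nAdd v0 (nMul (numeral 2) v2))
  let e : Tm E [Ty.nat, Ty.real, Ty.nat] Ty.nat := qPow v2
  (qInv (nCond (qLt (rat 0 0) q) (nCond (qLe e q) q e)
    (nCond (qLe q (qNeg e)) q (qNeg e)))).lam.lam.lam

instance : Add (Tm E Γ Ty.real) := ⟨fun s t => cRAdd.cl ⬝ s ⬝ t⟩
instance : Neg (Tm E Γ Ty.real) := ⟨fun t => cRNeg.cl ⬝ t⟩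
instance : Sub (Tm E Γ Ty.real) := ⟨fun s t => s + -t⟩
instance : Mul (Tm E Γ Ty.real) := ⟨fun s t => cRMul.cl ⬝ s ⬝ t⟩
instance : Zero (Tm E Γ Ty.real) := ⟨rconst 0 0⟩
instance : One (Tm E Γ Ty.real) := ⟨rconst 1 0⟩

def rabs (t : Tm E Γ Ty.real) : Tm E Γ Ty.real := cRAbs.cl ⬝ t

/-- `(t)⁻¹_l`. -/
def rinv (l : Tm E Γ Ty.nat) (t : Tm E Γ Ty.real) : Tm E Γ Ty.real := cRInv.cl ⬝ l ⬝ t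

def rsq (t : Tm E Γ Ty.real) : Tm E Γ Ty.real := t * t

/-! ## Terms of type `X` -/

instance : Zero (Tm E Γ Ty.X) := ⟨.const .zeroX⟩
instance : Add (Tm E Γ Ty.X) := ⟨fun x y => .const .addX ⬝ x ⬝ y⟩
instance : Neg (Tm E Γ Ty.X) := ⟨fun x => .const .negX ⬝ x⟩
instance : Sub (Tm E Γ Ty.X) := ⟨fun x y => x + -y⟩
instance : SMul (Tm E Γ Ty.real) (Tm E Γ Ty.X) := ⟨fun a x => .const .smulX ⬝ a ⬝ x⟩

def nrm (x : Tm E Γ Ty.X) : Tm E Γ Ty.real := .const .normX ⬝ x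

/-- The inner product, defined from the norm by polarization. -/
def ip (x y : Tm E Γ Ty.X) : Tm E Γ Ty.real :=
  rconst 1 3 * (rsq (nrm (x + y)) - rsq (nrm (x - y)))

end Terms

/-! ## Formulas -/

/-- Formulas; equality of natural numbers is the only primitive relation. -/
inductive Fm (E : Ty → Type) : Ctx → Type
  | eqN {Γ : Ctx} (s t : Tm E Γ Ty.nat) : Fm E Γ
  | and {Γ : Ctx} (A B : Fm E Γ) : Fm E Γ
  | or {Γ : Ctx} (A B : Fm E Γ) : Fm E Γ
  | imp {Γ : Ctx} (A B : Fm E Γ) : Fm E Γ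
  | all {Γ : Ctx} (σ : Ty) (A : Fm E (σ :: Γ)) : Fm E Γ
  | ex {Γ : Ctx} (σ : Ty) (A : Fm E (σ :: Γ)) : Fm E Γ

infixr:35 " ⋏ " => Fm.and
infixr:30 " ⋎ " => Fm.or
infixr:25 " ⇨' " => Fm.imp
infix:50 " =ₙ " => Fm.eqN

section Formulas

variable {E : Ty → Type}

def Fm.subst : {Γ Δ : Ctx} → Subst E Γ Δ → Fm E Γ → Fm E Δ
  | _, _, θ, .eqN s t => .eqN (s.subst θ) (t.subst θ)
  | _, _, θ, .and A B => .and (A.subst θ) (B.subst θ)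
  | _, _, θ, .or A B => .or (A.subst θ) (B.subst θ)
  | _, _, θ, .imp A B => .imp (A.subst θ) (B.subst θ)
  | _, _, θ, .all σ A => .all σ (A.subst θ.lift)
  | _, _, θ, .ex σ A => .ex σ (A.subst θ.lift)

variable {Γ : Ctx} {σ τ : Ty}

/-- Weakening by one variable. -/
def Fm.wk (A : Fm E Γ) : Fm E (σ :: Γ) := A.subst (fun _ x => .var (Var.s x))

/-- A closed formula viewed in an arbitrary context. -/
def Fm.cl (A : Fm E []) : Fm E Γ := A.subst (fun _ x => x.elim)

/-- Instantiation of the most recently bound variable. -/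
def Fm.inst (A : Fm E (σ :: Γ)) (t : Tm E Γ σ) : Fm E Γ := A.subst (Subst.single t)

/-- Falsity is the equation `0 = 1`. -/
def Fm.falsum : Fm E Γ := tZero =ₙ tSucc tZero

def Fm.neg (A : Fm E Γ) : Fm E Γ := A ⇨' Fm.falsum

def Fm.QF : {Γ : Ctx} → Fm E Γ → Prop
  | _, .eqN _ _ => True
  | _, .and A B => A.QF ∧ B.QF
  | _, .or A B => A.QF ∧ B.QF
  | _, .imp A B => A.QF ∧ B.QF
  | _, .all _ _ => False
  | _, .ex _ _ => False

/-- Quantification over a tuple of variables. -/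
def allL : (Δ : List Ty) → Fm E (Δ ++ Γ) → Fm E Γ
  | [], A => A
  | σ :: Δ, A => allL Δ (.all σ A)

def exL : (Δ : List Ty) → Fm E (Δ ++ Γ) → Fm E Γ
  | [], A => A
  | σ :: Δ, A => exL Δ (.ex σ A)

/-! Sentences `∀ x₁ … xₙ A(x₁, …, xₙ)`; the types of the variables are given first. -/

def all₁ (a : Ty) (A : Tm E [a] a → Fm E [a]) : Fm E [] := .all a (A v0)

def all₂ (a b : Ty) (A : Tm E [b, a] a → Tm E [b, a] b → Fm E [b, a]) : Fm E [] :=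
  .all a (.all b (A v1 v0))

def all₃ (a b c : Ty)
    (A : Tm E [c, b, a] a → Tm E [c, b, a] b → Tm E [c, b, a] c → Fm E [c, b, a]) : Fm E [] :=
  .all a (.all b (.all c (A v2 v1 v0)))

def all₄ (a b c d : Ty)
    (A : Tm E [d, c, b, a] a → Tm E [d, c, b, a] b → Tm E [d, c, b, a] c → Tm E [d, c, b, a] d →
      Fm E [d, c, b, a]) : Fm E [] :=
  .all a (.all b (.all c (.all d (A v3 v2 v1 v0))))

def all₅ (a b c d e : Ty)
    (A : Tm E [e, d, c, b, a] a → Tm E [e, d, c, b, a] b → Tm E [e, d, c, b, a] c →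
      Tm E [e, d, c, b, a] d → Tm E [e, d, c, b, a] e → Fm E [e, d, c, b, a]) : Fm E [] :=
  .all a (.all b (.all c (.all d (.all e (A v4 v3 v2 v1 v0)))))

def all₆ (a b c d e f : Ty)
    (A : Tm E [f, e, d, c, b, a] a → Tm E [f, e, d, c, b, a] b → Tm E [f, e, d, c, b, a] c →
      Tm E [f, e, d, c, b, a] d → Tm E [f, e, d, c, b, a] e → Tm E [f, e, d, c, b, a] f →
      Fm E [f, e, d, c, b, a]) : Fm E [] :=
  .all a (.all b (.all c (.all d (.all e (.all f (A v5 v4 v3 v2 v1 v0))))))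

/-! Equality and order of real numbers, equality in `X`, and equality at higher types. -/

/-- `∀ n (|hat s (n + 1) - hat t (n + 1)| < 2 ^ (-n))` -/
def eqR (s t : Tm E Γ Ty.real) : Fm E Γ :=
  .all Ty.nat (qLt (qAbs (qSub (hat s.wk (tSucc v0)) (hat t.wk (tSucc v0)))) (qPow v0) =ₙ tZero)

/-- `∃ n (hat t (n + 1) - hat s (n + 1) ≥ 2 ^ (-n))` -/
def ltR (s t : Tm E Γ Ty.real) : Fm E Γ :=
  .ex Ty.nat (qLe (qPow v0) (qSub (hat t.wk (tSucc v0)) (hat s.wk (tSucc v0))) =ₙ tZero)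

def leR (s t : Tm E Γ Ty.real) : Fm E Γ := (ltR t s).neg

infix:50 " =ᵣ " => eqR
infix:50 " <ᵣ " => ltR
infix:50 " ≤ᵣ " => leR

def eqX (x y : Tm E Γ Ty.X) : Fm E Γ := nrm (x - y) =ᵣ 0

infix:50 " =ₓ " => eqX

def eqT : {Γ : Ctx} → (τ : Ty) → Tm E Γ τ → Tm E Γ τ → Fm E Γ
  | _, Ty.nat, s, t => s =ₙ t
  | _, Ty.X, s, t => s =ₓ t
  | _, Ty.arr σ τ, s, t => .all σ (eqT τ (s.wk ⬝ v0) (t.wk ⬝ v0))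

end Formulas

/-! ## Substitutions for the choice principles -/

section Choice

variable {E : Ty → Type}

def Var.inl {Γ : Ctx} {τ : Ty} : {Δ : Ctx} → Var Δ τ → Var (Δ ++ Γ) τ
  | _, Var.z => Var.z
  | _, Var.s x => Var.s x.inl

def Var.inr {Γ : Ctx} {τ : Ty} : (Δ : Ctx) → Var Γ τ → Var (Δ ++ Γ) τ
  | [], x => x
  | _ :: Δ, x => Var.s (x.inr Δ)

def Var.map (f : Ty → Ty) {τ : Ty} : {Δ : List Ty} → Var Δ τ → Var (Δ.map f) (f τ)
  | _, Var.z => Var.z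
  | _, Var.s x => Var.s (x.map f)

/-- Combination of two substitutions. -/
def Subst.append {Γ Θ : Ctx} : {Δ : Ctx} → Subst E Δ Θ → Subst E Γ Θ → Subst E (Δ ++ Γ) Θ
  | [], _, θ₂, _, x => θ₂ _ x
  | _ :: _, θ₁, _, _, Var.z => θ₁ _ Var.z
  | _ :: _, θ₁, θ₂, _, Var.s x => Subst.append (fun _ y => θ₁ _ (Var.s y)) θ₂ _ x

/-- The substitution `y ↦ Y x` (and `x ↦ x`) in the conclusion of the axiom of choice. -/
def acSubst (Γ : Ctx) (xs ys : List Ty) :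
    Subst E (ys ++ (xs ++ Γ)) (xs ++ (ys.map (arrs xs) ++ Γ)) :=
  Subst.append
    (fun _ y => appF (fun ρ => ρ) xs (.var (((y.map (arrs xs)).inl).inr xs))
      (fun _ x => .var x.inl))
    (Subst.append (fun _ x => .var x.inl)
      (fun _ w => .var ((w.inr (ys.map (arrs xs))).inr xs)))

/-- The substitution `z ↦ f (S x)`, `y ↦ f x` in the conclusion of dependent choice. -/
def dcSubst (Γ : Ctx) (ys : List Ty) :
    Subst E (ys ++ (ys ++ (Ty.nat :: Γ))) (Ty.nat :: (ys.map (Ty.arr Ty.nat) ++ Γ)) :=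
  Subst.append (fun _ y => .var (Var.s ((y.map (Ty.arr Ty.nat)).inl)) ⬝ tSucc v0)
    (Subst.append (fun _ y => .var (Var.s ((y.map (Ty.arr Ty.nat)).inl)) ⬝ v0)
      (Subst.lift (fun _ w => .var (w.inr (ys.map (Ty.arr Ty.nat))))))

end Choice

/-! ## Derivability -/

/-- Derivability (by natural deduction) in the extension of `𝒜^ω = WE-PA^ω + QF-AC + DC`, over
all finite types from `T^X`, by the constants `E` and the axioms `Ax`.  `Der Ax H A` says that `A`
is derivable from the open assumptions `H`, where the free variables are those of the context.
Extensionality is only available as the rule `qfER`, whose premise must not depend on open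
assumptions. -/
inductive Der {E : Ty → Type} (Ax : Set (Fm E [])) : {Γ : Ctx} → List (Fm E Γ) → Fm E Γ → Prop
  -- classical many-sorted predicate logic
  | hyp {Γ : Ctx} {H : List (Fm E Γ)} {A : Fm E Γ} : A ∈ H → Der Ax H A
  | andI {Γ : Ctx} {H : List (Fm E Γ)} {A B : Fm E Γ} : Der Ax H A → Der Ax H B → Der Ax H (A ⋏ B)
  | andE₁ {Γ : Ctx} {H : List (Fm E Γ)} {A B : Fm E Γ} : Der Ax H (A ⋏ B) → Der Ax H A
  | andE₂ {Γ : Ctx} {H : List (Fm E Γ)} {A B : Fm E Γ} : Der Ax H (A ⋏ B) → Der Ax H B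
  | orI₁ {Γ : Ctx} {H : List (Fm E Γ)} {A B : Fm E Γ} : Der Ax H A → Der Ax H (A ⋎ B)
  | orI₂ {Γ : Ctx} {H : List (Fm E Γ)} {A B : Fm E Γ} : Der Ax H B → Der Ax H (A ⋎ B)
  | orE {Γ : Ctx} {H : List (Fm E Γ)} {A B C : Fm E Γ} :
      Der Ax H (A ⋎ B) → Der Ax (A :: H) C → Der Ax (B :: H) C → Der Ax H C
  | impI {Γ : Ctx} {H : List (Fm E Γ)} {A B : Fm E Γ} : Der Ax (A :: H) B → Der Ax H (A ⇨' B)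
  | impE {Γ : Ctx} {H : List (Fm E Γ)} {A B : Fm E Γ} :
      Der Ax H (A ⇨' B) → Der Ax H A → Der Ax H B
  | allI {Γ : Ctx} {H : List (Fm E Γ)} {σ : Ty} {A : Fm E (σ :: Γ)} :
      Der Ax (H.map Fm.wk) A → Der Ax H (.all σ A)
  | allE {Γ : Ctx} {H : List (Fm E Γ)} {σ : Ty} {A : Fm E (σ :: Γ)} (t : Tm E Γ σ) :
      Der Ax H (.all σ A) → Der Ax H (A.inst t)
  | exI {Γ : Ctx} {H : List (Fm E Γ)} {σ : Ty} {A : Fm E (σ :: Γ)} (t : Tm E Γ σ) :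
      Der Ax H (A.inst t) → Der Ax H (.ex σ A)
  | exE {Γ : Ctx} {H : List (Fm E Γ)} {σ : Ty} {A : Fm E (σ :: Γ)} {C : Fm E Γ} :
      Der Ax H (.ex σ A) → Der Ax (A :: H.map Fm.wk) C.wk → Der Ax H C
  | exFalso {Γ : Ctx} {H : List (Fm E Γ)} {A : Fm E Γ} : Der Ax H Fm.falsum → Der Ax H A
  | em {Γ : Ctx} {H : List (Fm E Γ)} (A : Fm E Γ) : Der Ax H (A ⋎ A.neg)
  -- equality of natural numbers, successor and induction
  | eqRefl {Γ : Ctx} {H : List (Fm E Γ)} (s : Tm E Γ Ty.nat) : Der Ax H (s =ₙ s)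
  | eqSymm {Γ : Ctx} {H : List (Fm E Γ)} {s t : Tm E Γ Ty.nat} :
      Der Ax H (s =ₙ t) → Der Ax H (t =ₙ s)
  | eqTrans {Γ : Ctx} {H : List (Fm E Γ)} {s t u : Tm E Γ Ty.nat} :
      Der Ax H (s =ₙ t) → Der Ax H (t =ₙ u) → Der Ax H (s =ₙ u)
  | succNeZero {Γ : Ctx} {H : List (Fm E Γ)} (s : Tm E Γ Ty.nat) :
      Der Ax H (tSucc s =ₙ tZero).neg
  | succInj {Γ : Ctx} {H : List (Fm E Γ)} (s t : Tm E Γ Ty.nat) :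
      Der Ax H (tSucc s =ₙ tSucc t ⇨' s =ₙ t)
  | ind {Γ : Ctx} {H : List (Fm E Γ)} (A : Fm E (Ty.nat :: Γ)) :
      Der Ax H (A.inst tZero ⋏
        .all Ty.nat (A ⇨' A.subst Subst.succ) ⇨' .all Ty.nat A)
  -- combinators and recursors
  | combK {Γ : Ctx} {H : List (Fm E Γ)} {σ τ : Ty} (s : Tm E Γ σ) (t : Tm E Γ τ) :
      Der Ax H (eqT σ (.const (.combK σ τ) ⬝ s ⬝ t) s)
  | combS {Γ : Ctx} {H : List (Fm E Γ)} {ρ σ τ : Ty} (s : Tm E Γ (ρ ➝ σ ➝ τ))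
      (t : Tm E Γ (ρ ➝ σ)) (u : Tm E Γ ρ) :
      Der Ax H (eqT τ (.const (.combS ρ σ τ) ⬝ s ⬝ t ⬝ u) (s ⬝ u ⬝ (t ⬝ u)))
  | recZero {Γ : Ctx} {H : List (Fm E Γ)} (ρs : List Ty) {ρ : Ty} (i : Var ρs ρ)
      (y : ∀ σ, Var ρs σ → Tm E Γ σ) (z : ∀ σ, Var ρs σ → Tm E Γ (arrs ρs (Ty.nat ➝ σ))) :
      Der Ax H (eqT ρ (recApp ρs i tZero y z) (y ρ i))
  | recSucc {Γ : Ctx} {H : List (Fm E Γ)} (ρs : List Ty) {ρ : Ty} (i : Var ρs ρ)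
      (x : Tm E Γ Ty.nat) (y : ∀ σ, Var ρs σ → Tm E Γ σ)
      (z : ∀ σ, Var ρs σ → Tm E Γ (arrs ρs (Ty.nat ➝ σ))) :
      Der Ax H (eqT ρ (recApp ρs i (tSucc x) y z)
        (appF (fun σ => σ) ρs (z ρ i) (fun _ j => recApp ρs j x y z) ⬝ x))
  -- quantifier-free rule of extensionality
  | qfER {Γ : Ctx} {H : List (Fm E Γ)} {σ τ : Ty} {A : Fm E Γ} (hA : A.QF) {s t : Tm E Γ σ}
      (r : Tm E (σ :: Γ) τ) :
      Der Ax [] (A ⇨' eqT σ s t) →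
      Der Ax H (A ⇨' eqT τ (r.subst (Subst.single s)) (r.subst (Subst.single t)))
  -- quantifier-free axiom of choice and dependent choice
  | qfAC {Γ : Ctx} {H : List (Fm E Γ)} (xs ys : List Ty) (A : Fm E (ys ++ (xs ++ Γ)))
      (hA : A.QF) :
      Der Ax H (allL xs (exL ys A) ⇨'
        exL (ys.map (arrs xs)) (allL xs (A.subst (acSubst Γ xs ys))))
  | dc {Γ : Ctx} {H : List (Fm E Γ)} (ys : List Ty) (A : Fm E (ys ++ (ys ++ (Ty.nat :: Γ)))) :
      Der Ax H (.all Ty.nat (allL ys (exL ys A)) ⇨'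
        exL (ys.map (Ty.arr Ty.nat)) (.all Ty.nat (A.subst (dcSubst Γ ys))))
  -- the additional axioms
  | ax {Γ : Ctx} {H : List (Fm E Γ)} {A : Fm E []} : A ∈ Ax → Der Ax H A.cl

/-- The theory with additional axioms `Ax` proves the sentence `A`. -/
def Proves {E : Ty → Type} (Ax : Set (Fm E [])) (A : Fm E []) : Prop := Der Ax [] A

/-! ## The theory of real inner product spaces -/

section Axioms

variable {E : Ty → Type}

open Ty (nat X real)

/-- The axioms of real linear spaces, formulated with the defined equality of `X`. -/
def vectorSpaceAxioms : Set (Fm E []) :=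
  { all₃ X X X fun x y z => (x + y) + z =ₓ x + (y + z),
    all₂ X X fun x y => x + y =ₓ y + x,
    all₁ X fun x => x + 0 =ₓ x,
    all₁ X fun x => x + -x =ₓ 0,
    all₁ X fun x => (1 : Tm E [X] real) • x =ₓ x,
    all₃ real real X fun α β x => (α * β) • x =ₓ α • (β • x),
    all₃ real real X fun α β x => (α + β) • x =ₓ α • x + β • x,
    all₃ real X X fun α x y => α • (x + y) =ₓ α • x + α • y }

/-- The axioms for the norm, including those making the operations extensional. -/
def normAxioms : Set (Fm E []) :=
  { all₁ X fun x => nrm (x - x) =ᵣ 0,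
    all₂ X X fun x y => nrm (x - y) =ᵣ nrm (y - x),
    all₃ X X X fun x y z => nrm (x - z) ≤ᵣ nrm (x - y) + nrm (y - z),
    all₃ real X X fun α x y => nrm (α • x - α • y) =ᵣ rabs α * nrm (x - y),
    all₃ real real X fun α β x => nrm (α • x - β • x) =ᵣ rabs (α - β) * nrm x,
    all₄ X X X X fun x y u v => nrm ((x + y) - (u + v)) ≤ᵣ nrm (x - u) + nrm (y - v),
    all₂ X X fun x y => nrm (-x - -y) =ᵣ nrm (x - y),
    all₂ X X fun x y => rabs (nrm x - nrm y) ≤ᵣ nrm (x - y),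
    nrm (.const .oneX) =ᵣ 1 }

/-- The parallelogram law. -/
def parallelogramLaw : Fm E [] :=
  all₂ X X fun x y =>
    rsq (nrm (x + y)) + rsq (nrm (x - y)) =ᵣ rconst 2 0 * (rsq (nrm x) + rsq (nrm y))

/-- The axioms of `𝒜^ω[X, ⟨·,·⟩]`, on top of those of `𝒜^ω`. -/
def innerAxioms : Set (Fm E []) := vectorSpaceAxioms ∪ normAxioms ∪ {parallelogramLaw}

end Axioms

/-- No additional constants. -/
def NoConst (_ : Ty) : Type := Empty

/-! ## The theory `𝒰^ω = 𝒜^ω[X, ⟨·,·⟩, A, J^A, ρ̃]` of maximally `ρ`-comonotone operators -/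

/-- The additional constants: the characteristic function `χ_A` of the operator, the resolvent
`J^{χ_A}`, and `ρ̃`, `γ̃`, `m_γ̃`, `n_γ̃`, `c_X`. -/
inductive OpConst : Ty → Type
  | chi : OpConst (Ty.X ➝ Ty.X ➝ Ty.nat)
  | res : OpConst (Ty.real ➝ Ty.X ➝ Ty.X)
  | rho : OpConst Ty.real
  | gam : OpConst Ty.real
  | mGam : OpConst Ty.nat
  | nGam : OpConst Ty.nat
  | cX : OpConst Ty.X

section Operator

open Ty (nat X real)

variable {Γ : Ctx}

/-- `χ_A x y`. -/
def chi (x y : Tm OpConst Γ X) : Tm OpConst Γ nat := .const (.extra .chi) ⬝ x ⬝ y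

/-- `y ∈ A x`, that is `χ_A x y = 0`. -/
def memA (y x : Tm OpConst Γ X) : Fm OpConst Γ := chi x y =ₙ tZero

/-- `J^A_γ x`. -/
def res (γ : Tm OpConst Γ real) (x : Tm OpConst Γ X) : Tm OpConst Γ X :=
  .const (.extra .res) ⬝ γ ⬝ x

abbrev rho : Tm OpConst Γ real := .const (.extra .rho)
abbrev gam : Tm OpConst Γ real := .const (.extra .gam)

/-- The axioms for `A`, `J^A` and the other constants: `χ_A` is a characteristic function; the
resolvent axiom `γ⁻¹(x - J^A_γ x) ∈ A(J^A_γ x)` for `γ > 0`, where, as always, `γ⁻¹` stands for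
`(γ)⁻¹_l` with an additional number parameter `l` and the assumption `γ > 2 ^ (-l)`;
`ρ̃`-comonotonicity; `γ̃ ≥ 2 ^ (-m_γ̃)`; and `ρ̃ ≥ -γ̃ + 2 ^ (-n_γ̃)`. -/
def operatorAxioms : Set (Fm OpConst []) :=
  { all₂ X X fun x y => nSub (chi x y) (numeral 1) =ₙ tZero,
    all₃ real X nat fun γ x l =>
      rpow l <ᵣ γ ⇨' memA (rinv l γ • (x - res γ x)) (res γ x),
    all₄ X X X X fun x y u v =>
      memA u x ⋏ memA v y ⇨' rho * rsq (nrm (u - v)) ≤ᵣ ip (x - y) (u - v),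
    rpow (.const (.extra .mGam)) ≤ᵣ gam,
    -gam + rpow (.const (.extra .nGam)) ≤ᵣ rho }

/-- The axioms of `𝒰^ω`, on top of those of `𝒜^ω`. -/
def uAxioms : Set (Fm OpConst []) := innerAxioms ∪ operatorAxioms

end Operator

/-! ## The sentences proved -/

section Sentences

open Ty (nat X real)

/-- The assumption `|t| > 2 ^ (-l)` under which `(t)⁻¹_l` stands for the reciprocal of `t`. -/
def invertible {E : Ty → Type} {Γ : Ctx} (l : Tm E Γ nat) (t : Tm E Γ real) : Fm E Γ :=
  rpow l <ᵣ rabs t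

/-- For `α ∈ (0, 1]`:
`α²(‖x‖² - ‖(1 - α⁻¹)x + α⁻¹y‖²) = α(‖x‖² - α⁻¹(1 - α)‖x - y‖² - ‖y‖²)`. -/
def sentenceAveragedIdentity : Fm NoConst [] :=
  all₄ real X X nat fun α x y l =>
    0 <ᵣ α ⋏ α ≤ᵣ 1 ⋏ invertible l α ⇨'
      rsq α * (rsq (nrm x) - rsq (nrm ((1 - rinv l α) • x + rinv l α • y))) =ᵣ
        α * (rsq (nrm x) - rinv l α * (1 - α) * rsq (nrm (x - y)) - rsq (nrm y))

/-- `α²‖x‖² - ‖(α - 1)x + y‖² = 2α⟨x - y, y⟩ - (1 - 2α)‖x - y‖²`. -/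
def sentenceConicalIdentity : Fm NoConst [] :=
  all₃ real X X fun α x y =>
    rsq α * rsq (nrm x) - rsq (nrm ((α - 1) • x + y)) =ᵣ
      rconst 2 0 * α * ip (x - y) y - (1 - rconst 2 0 * α) * rsq (nrm (x - y))

/-- `J^A_γ` is single-valued if `ρ̃ > -γ`. -/
def sentenceSingleValued : Fm OpConst [] :=
  all₄ X X real nat fun p x γ l =>
    0 <ᵣ γ ⋏ -γ <ᵣ rho ⋏ invertible l γ ⋏ memA (rinv l γ • (x - p)) p ⇨' p =ₓ res γ x

/-- `J^{χ_A}` is extensional in both arguments if `ρ̃ > -γ`. -/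
def sentenceExtensional : Fm OpConst [] :=
  all₄ real real X X fun γ γ' x x' =>
    0 <ᵣ γ ⋏ 0 <ᵣ γ' ⋏ -γ <ᵣ rho ⋏ x =ₓ x' ⋏ γ =ᵣ γ' ⇨' res γ x =ₓ res γ' x'

section Terms

variable {Γ : Ctx}

/-- `2(ρ̃/γ + 1)`, with `γ⁻¹` taken as `(γ)⁻¹_l`. -/
def alphaDenom (l : Tm OpConst Γ nat) (γ : Tm OpConst Γ real) : Tm OpConst Γ real :=
  rconst 2 0 * (rho * rinv l γ + 1)

/-- `α = 1 / (2(ρ̃/γ + 1))`, with the outer reciprocal taken with parameter `m`. -/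
def alpha (l m : Tm OpConst Γ nat) (γ : Tm OpConst Γ real) : Tm OpConst Γ real :=
  rinv m (alphaDenom l γ)

/-- `-γ/2` -/
def negHalf (γ : Tm OpConst Γ real) : Tm OpConst Γ real := -(rconst 1 1 * γ)

/-- `(x - J^A_γ x) - (y - J^A_γ y)` -/
def resDiff (γ : Tm OpConst Γ real) (x y : Tm OpConst Γ X) : Tm OpConst Γ X :=
  (x - res γ x) - (y - res γ y)

/-- `(1 - α⁻¹)x + α⁻¹ J^A_γ x`, with `α⁻¹` taken as `(α)⁻¹_k`. -/
def relaxed (k : Tm OpConst Γ nat) (α γ : Tm OpConst Γ real) (x : Tm OpConst Γ X) :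
    Tm OpConst Γ X :=
  (1 - rinv k α) • x + rinv k α • res γ x

end Terms

/-- If `ρ̃ > -γ`, then, with `d = (x - J^A_γ x) - (y - J^A_γ y)`,
`2α⟨J^A_γ x - J^A_γ y, d⟩ ≥ (1 - 2α)‖d‖²`. -/
def sentenceConicalAlt : Fm OpConst [] :=
  all₅ real X X nat nat fun γ x y l m =>
    0 <ᵣ γ ⋏ -γ <ᵣ rho ⋏ invertible l γ ⋏ invertible m (alphaDenom l γ) ⇨'
      (1 - rconst 2 0 * alpha l m γ) * rsq (nrm (resDiff γ x y)) ≤ᵣ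
        rconst 2 0 * alpha l m γ * ip (res γ x - res γ y) (resDiff γ x y)

/-- If `ρ̃ > -γ`, then `2(ρ̃/γ + 1) > 0`, so that `α` is defined, `α ∈ (0, ∞)`, and
`(1 - α⁻¹) Id + α⁻¹ J^A_γ` is nonexpansive. -/
def sentenceConical : Fm OpConst [] :=
  all₆ real X X nat nat nat fun γ x y l m k =>
    0 <ᵣ γ ⋏ -γ <ᵣ rho ⋏ invertible l γ ⇨'
      0 <ᵣ alphaDenom l γ ⋏
      (invertible m (alphaDenom l γ) ⇨'
        0 <ᵣ alpha l m γ ⋏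
        (invertible k (alpha l m γ) ⇨'
          nrm (relaxed k (alpha l m γ) γ x - relaxed k (alpha l m γ) γ y) ≤ᵣ nrm (x - y)))

/-- If `ρ̃ ≥ -γ/2`, then `‖J^A_γ x - J^A_γ y‖ ≤ ‖x - y‖`. -/
def sentenceNonexpansive : Fm OpConst [] :=
  all₃ real X X fun γ x y =>
    0 <ᵣ γ ⋏ negHalf γ ≤ᵣ rho ⇨' nrm (res γ x - res γ y) ≤ᵣ nrm (x - y)

/-- If `ρ̃ ≥ -γ/2`, then
`(1 - α)‖(x - J^A_γ x) - (y - J^A_γ y)‖² ≤ α(‖x - y‖² - ‖J^A_γ x - J^A_γ y‖²)`. -/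
def sentenceAveragedAlt : Fm OpConst [] :=
  all₅ real X X nat nat fun γ x y l m =>
    0 <ᵣ γ ⋏ negHalf γ ≤ᵣ rho ⋏ invertible l γ ⋏ invertible m (alphaDenom l γ) ⇨'
      (1 - alpha l m γ) * rsq (nrm (resDiff γ x y)) ≤ᵣ
        alpha l m γ * (rsq (nrm (x - y)) - rsq (nrm (res γ x - res γ y)))

/-- If `ρ̃ > -γ/2`, then `2(ρ̃/γ + 1) > 0`, so that `α` is defined, `α ∈ (0, 1)`, and
`(1 - α⁻¹) Id + α⁻¹ J^A_γ` is nonexpansive. -/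
def sentenceAveraged : Fm OpConst [] :=
  all₆ real X X nat nat nat fun γ x y l m k =>
    0 <ᵣ γ ⋏ negHalf γ <ᵣ rho ⋏ invertible l γ ⇨'
      0 <ᵣ alphaDenom l γ ⋏
      (invertible m (alphaDenom l γ) ⇨'
        (0 <ᵣ alpha l m γ ⋏ alpha l m γ <ᵣ 1) ⋏
        (invertible k (alpha l m γ) ⇨'
          nrm (relaxed k (alpha l m γ) γ x - relaxed k (alpha l m γ) γ y) ≤ᵣ nrm (x - y)))

end Sentences

end ProofMining

open ProofMining

/-! The claim is formal derivability, but no derivation is written out. A completeness theorem,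
`proves_of_models`, reduces it to truth in all models, and there the nine sentences become ordinary
Hilbert space computations.

Completeness is Henkin's argument. If S is not derivable, then ¬S is consistent. At each of
countably many stages one fresh variable is added and one existential formula is either witnessed by
that variable or refuted; countability of the language ensures that every formula gets its turn.
Objects of the term model are eventually coherent sequences of terms over the stages. Two of them
are identified when their equality follows, from no open assumption, from a quantifier-free formula
that is derivable at the stage. This shape is dictated by the extensionality rule, whose premise
must not depend on assumptions, and it makes application well defined. At type 0 the identification
is just provable equality, because the equation can serve as its own quantifier-free premise.

Of the term model only a few properties are kept (`ArithModel`): the combinator equations, recursion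
at type 0, the successor axioms, and induction for predicates given by formulas with parameters.
Such a model may be nonstandard, so neither ℕ nor ℝ is available in it. Its numbers form a
cancellative semiring without zero divisors, with an ordered field K of fractions in which the
internal powers 2^(-n) get below every positive element. Representatives of reals give internal
Cauchy sequences in K. Their limits are taken in the ordered field of finite elements of an
ultrapower of K modulo infinitesimals, both notions being relative to K. The value map `rv` into
this field turns =_ℝ, <_ℝ and the operations on representatives into equality, order and field
operations.

Objects of type X at distance zero are identified. The quotient is a normed abelian group on which
representatives of reals act; it is not claimed to be a vector space over the whole limit field.
Homogeneity of the polarized form follows as in Jordan–von Neumann: internal natural numbers by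
internal induction, then rationals, then all represented scalars by approximation and
Cauchy–Schwarz.

For the operator write p = J_γ x, q = J_γ y, e = p - q, d = (x - p) - (y - q), D = ρ̃/γ. The
resolvent and comonotonicity axioms give D‖d‖² ≤ ⟨e, d⟩ (`resolvent_comonotone`), and x - y = d + e.
Uniqueness and extensionality are the case x = y, where d = -e and D > -1 force e = 0. The remaining
operator claims are rearrangements of the same inequality with 2α = 1/(D + 1), for instance ‖x - y‖²
- ‖(1 - α⁻¹)(x - y) + α⁻¹e‖² = 4(D + 1)(⟨e, d⟩ - D‖d‖²). -/

namespace ProofMining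

/-! ## Substitution calculus -/

section SubstCalculus

variable {E : Ty → Type} {Γ Δ Θ : Ctx} {ρ σ τ : Ty}

/-- Extension of a substitution by a term for the head variable. -/
def Subst.cons (t : Tm E Δ σ) (θ : Subst E Γ Δ) : Subst E (σ :: Γ) Δ
  | _, Var.z => t
  | _, Var.s x => θ _ x

theorem Tm.subst_subst (t : Tm E Γ τ) (θ : Subst E Γ Δ) (η : Subst E Δ Θ) :
    (t.subst θ).subst η = t.subst (fun _ x => (θ _ x).subst η) := by
  induction t with
  | var x => rfl
  | const c => rfl
  | app t u iht ihu => simp only [Tm.subst, iht, ihu]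

theorem Tm.ren_eq_subst (t : Tm E Γ τ) (θ : Ren Γ Δ) :
    t.ren θ = t.subst (fun _ x => .var (θ _ x)) := by
  induction t with
  | var x => rfl
  | const c => rfl
  | app t u iht ihu => simp only [Tm.subst, Tm.ren, iht, ihu]

theorem Tm.subst_var (t : Tm E Γ τ) : t.subst (fun _ x => .var x) = t := by
  induction t with
  | var x => rfl
  | const c => rfl
  | app t u iht ihu => simp only [Tm.subst, iht, ihu]

theorem Tm.wk_eq_subst (t : Tm E Γ τ) :
    (t.wk : Tm E (σ :: Γ) τ) = t.subst (fun _ x => .var (Var.s x)) :=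
  t.ren_eq_subst _

theorem Tm.wk_subst (t : Tm E Γ τ) (θ : Subst E (σ :: Γ) Δ) :
    t.wk.subst θ = t.subst (fun _ x => θ _ (Var.s x)) := by
  rw [Tm.wk_eq_subst, Tm.subst_subst]; rfl

theorem Tm.subst_wk (t : Tm E Γ τ) (θ : Subst E Γ Δ) :
    ((t.subst θ).wk : Tm E (σ :: Δ) τ) = t.subst (fun _ x => (θ _ x).wk) := by
  simp only [Tm.wk_eq_subst, Tm.subst_subst]

theorem Tm.wk_subst_single (t : Tm E Γ τ) (u : Tm E Γ σ) :
    t.wk.subst (Subst.single u) = t := by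
  rw [Tm.wk_subst]; exact t.subst_var

theorem Subst.lift_eq_cons (θ : Subst E Γ Δ) :
    (θ.lift : Subst E (σ :: Γ) (σ :: Δ)) = Subst.cons (.var Var.z) (fun _ x => (θ _ x).wk) := by
  funext τ x; cases x <;> rfl

theorem Subst.lift_comp_lift (θ : Subst E Γ Δ) (η : Subst E Δ Θ) :
    (fun τ x => ((θ.lift : Subst E (σ :: Γ) _) τ x).subst η.lift) =
      Subst.lift (fun τ x => (θ τ x).subst η) := by
  funext τ x
  cases x with
  | z => rfl
  | s x => simp only [Subst.lift, Tm.wk_subst, Tm.subst_wk]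

theorem Fm.subst_subst (A : Fm E Γ) (θ : Subst E Γ Δ) (η : Subst E Δ Θ) :
    (A.subst θ).subst η = A.subst (fun _ x => (θ _ x).subst η) := by
  induction A generalizing Δ Θ with
  | eqN s t => simp only [Fm.subst, Tm.subst_subst]
  | and A B ihA ihB => simp only [Fm.subst, ihA, ihB]
  | or A B ihA ihB => simp only [Fm.subst, ihA, ihB]
  | imp A B ihA ihB => simp only [Fm.subst, ihA, ihB]
  | all σ A ih => simp only [Fm.subst, ih, Subst.lift_comp_lift]
  | ex σ A ih => simp only [Fm.subst, ih, Subst.lift_comp_lift]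

theorem Subst.lift_var : (Subst.lift fun _ x => .var x) =
    fun τ (x : Var (σ :: Γ) τ) => (.var x : Tm E (σ :: Γ) τ) := by
  funext τ x; cases x <;> rfl

theorem Fm.subst_var (A : Fm E Γ) : A.subst (fun _ x => .var x) = A := by
  induction A with
  | eqN s t => simp only [Fm.subst, Tm.subst_var]
  | and A B ihA ihB => simp only [Fm.subst, ihA, ihB]
  | or A B ihA ihB => simp only [Fm.subst, ihA, ihB]
  | imp A B ihA ihB => simp only [Fm.subst, ihA, ihB]
  | all σ A ih => simp only [Fm.subst, Subst.lift_var, ih]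
  | ex σ A ih => simp only [Fm.subst, Subst.lift_var, ih]

theorem Fm.subst_lift_inst (A : Fm E (σ :: Γ)) (θ : Subst E Γ Δ) (t : Tm E Δ σ) :
    (A.subst θ.lift).inst t = A.subst (Subst.cons t θ) := by
  rw [Fm.inst, Fm.subst_subst]
  congr 1
  funext τ x
  cases x with
  | z => rfl
  | s x => exact Tm.wk_subst_single _ _

theorem Fm.inst_subst (A : Fm E (σ :: Γ)) (θ : Subst E Γ Δ) (t : Tm E Γ σ) :
    (A.inst t).subst θ = (A.subst θ.lift).inst (t.subst θ) := by
  rw [Fm.subst_lift_inst, Fm.inst, Fm.subst_subst]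
  congr 1
  funext τ x
  cases x <;> rfl

theorem Fm.subst_succ_subst_lift (A : Fm E (Ty.nat :: Γ)) (θ : Subst E Γ Δ) :
    (A.subst Subst.succ).subst θ.lift = (A.subst θ.lift).subst Subst.succ := by
  rw [Fm.subst_subst, Fm.subst_subst]
  congr 1
  funext τ x
  cases x with
  | z => rfl
  | s x =>
    simp only [Subst.succ, Tm.subst, Subst.lift, Tm.wk_subst]
    exact Tm.wk_eq_subst _

end SubstCalculus

/-! ## Countability of the language -/

section Countability

/-- Syntax is stratified by height: each stratum is built from the previous one by countable unions
and images, so no explicit encoding of terms or formulas is needed. -/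
theorem countable_of_height {α : Type*} (h : α → ℕ) (H : ∀ n, {a | h a ≤ n}.Countable) :
    Countable α := by
  rw [← Set.countable_univ_iff]
  refine (Set.countable_iUnion H).mono fun a _ => ?_
  exact Set.mem_iUnion.2 ⟨h a, le_refl (h a)⟩

def Ty.height : Ty → ℕ
  | .nat => 0
  | .X => 0
  | .arr σ τ => max σ.height τ.height + 1

instance : Countable Ty := by
  refine countable_of_height Ty.height fun n => ?_
  induction n with
  | zero =>
    refine (Set.toFinite {Ty.nat, Ty.X}).countable.mono fun a ha => ?_
    cases a <;> simp_all [Ty.height]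
  | succ n ih =>
    refine ((Set.toFinite {Ty.nat, Ty.X}).countable.union (ih.image2 ih Ty.arr)).mono
      fun a ha => ?_
    cases a with
    | nat => simp
    | X => simp
    | arr σ τ =>
      have : max σ.height τ.height ≤ n := Nat.le_of_succ_le_succ ha
      exact Or.inr ⟨σ, (le_max_left _ _).trans this, τ, (le_max_right _ _).trans this, rfl⟩

def Var.index : {Γ : Ctx} → {τ : Ty} → Var Γ τ → ℕ
  | _, _, Var.z => 0
  | _, _, Var.s x => x.index + 1

theorem Var.index_injective {Γ : Ctx} {τ : Ty} : Function.Injective (Var.index (Γ := Γ) (τ := τ)) := by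
  intro x
  induction x with
  | z => intro y h; cases y with
    | z => rfl
    | s y => simp [Var.index] at h
  | s x ih => intro y h; cases y with
    | z => simp [Var.index] at h
    | s y => rw [ih (Nat.succ.inj h)]

instance {Γ : Ctx} {τ : Ty} : Countable (Var Γ τ) := Var.index_injective.countable

variable {E : Ty → Type} [∀ τ, Countable (E τ)]

instance countable_const (τ : Ty) : Countable (Const E τ) := by
  -- The index τ of `Const E τ` varies with the constructor, so the sum over all types is enumerated
  -- and a single fibre is embedded in it afterwards.
  let C := Fin 8 ⊕ (Ty × Ty) ⊕ (Ty × Ty × Ty) ⊕ (Σ (ρs : List Ty) (ρ : Ty), Var ρs ρ) ⊕ (Σ τ, E τ)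
  let f : C → Σ τ, Const E τ
    | .inl 0 => ⟨_, .zero⟩
    | .inl 1 => ⟨_, .succ⟩
    | .inl 2 => ⟨_, .zeroX⟩
    | .inl 3 => ⟨_, .oneX⟩
    | .inl 4 => ⟨_, .addX⟩
    | .inl 5 => ⟨_, .negX⟩
    | .inl 6 => ⟨_, .smulX⟩
    | .inl 7 => ⟨_, .normX⟩
    | .inr (.inl (σ, τ)) => ⟨_, .combK σ τ⟩
    | .inr (.inr (.inl (ρ, σ, τ))) => ⟨_, .combS ρ σ τ⟩
    | .inr (.inr (.inr (.inl ⟨ρs, ρ, i⟩))) => ⟨_, .recur ρs ρ i⟩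
    | .inr (.inr (.inr (.inr ⟨_, c⟩))) => ⟨_, .extra c⟩
  have hf : Function.Surjective f := by
    rintro ⟨τ, c⟩
    cases c with
    | zero => exact ⟨.inl 0, rfl⟩
    | succ => exact ⟨.inl 1, rfl⟩
    | zeroX => exact ⟨.inl 2, rfl⟩
    | oneX => exact ⟨.inl 3, rfl⟩
    | addX => exact ⟨.inl 4, rfl⟩
    | negX => exact ⟨.inl 5, rfl⟩
    | smulX => exact ⟨.inl 6, rfl⟩
    | normX => exact ⟨.inl 7, rfl⟩
    | combK σ τ => exact ⟨.inr (.inl (σ, τ)), rfl⟩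
    | combS ρ σ τ => exact ⟨.inr (.inr (.inl (ρ, σ, τ))), rfl⟩
    | recur ρs ρ i => exact ⟨.inr (.inr (.inr (.inl ⟨ρs, ρ, i⟩))), rfl⟩
    | extra c => exact ⟨.inr (.inr (.inr (.inr ⟨_, c⟩))), rfl⟩
  have : Countable (Σ τ, Const E τ) := hf.countable
  exact (sigma_mk_injective (i := τ)).countable

def Tm.height {Γ : Ctx} : {τ : Ty} → Tm E Γ τ → ℕ
  | _, .var _ => 0
  | _, .const _ => 0
  | _, .app t u => max t.height u.height + 1

instance countable_tm (Γ : Ctx) (τ : Ty) : Countable (Tm E Γ τ) := by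
  refine countable_of_height Tm.height fun n => ?_
  induction n generalizing τ with
  | zero =>
    refine ((Set.countable_range (Tm.var (E := E) (Γ := Γ) (τ := τ))).union
      (Set.countable_range (Tm.const (E := E) (Γ := Γ) (τ := τ)))).mono fun a ha => ?_
    cases a with
    | var x => exact Or.inl ⟨x, rfl⟩
    | const c => exact Or.inr ⟨c, rfl⟩
    | app t u => simp [Tm.height] at ha
  | succ n ih =>
    refine (((Set.countable_range (Tm.var (E := E) (Γ := Γ) (τ := τ))).union
      (Set.countable_range (Tm.const (E := E) (Γ := Γ) (τ := τ)))).union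
      (Set.countable_iUnion fun σ => (ih (σ ➝ τ)).image2 (ih σ) Tm.app)).mono fun a ha => ?_
    cases a with
    | var x => exact Or.inl (Or.inl ⟨x, rfl⟩)
    | const c => exact Or.inl (Or.inr ⟨c, rfl⟩)
    | app t u =>
      have : max t.height u.height ≤ n := Nat.le_of_succ_le_succ ha
      exact Or.inr (Set.mem_iUnion.2 ⟨_, t, (le_max_left _ _).trans this, u,
        (le_max_right _ _).trans this, rfl⟩)

def Fm.height : {Γ : Ctx} → Fm E Γ → ℕ
  | _, .eqN _ _ => 0
  | _, .and A B => max A.height B.height + 1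
  | _, .or A B => max A.height B.height + 1
  | _, .imp A B => max A.height B.height + 1
  | _, .all _ A => A.height + 1
  | _, .ex _ A => A.height + 1

theorem countable_fm_height_le (n : ℕ) (Γ : Ctx) : {A : Fm E Γ | A.height ≤ n}.Countable := by
  have h0 : (Set.image2 (Fm.eqN (E := E) (Γ := Γ)) Set.univ Set.univ).Countable :=
    Set.countable_univ.image2 Set.countable_univ _
  induction n generalizing Γ with
  | zero =>
    refine h0.mono fun A hA => ?_
    cases A with
    | eqN s t => exact ⟨s, trivial, t, trivial, rfl⟩
    | _ => simp [Fm.height] at hA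
  | succ n ih =>
    have ih' := fun Γ => ih Γ (Set.countable_univ.image2 Set.countable_univ _)
    refine (h0.union (((ih' Γ).image2 (ih' Γ) Fm.and).union (((ih' Γ).image2 (ih' Γ) Fm.or).union
      (((ih' Γ).image2 (ih' Γ) Fm.imp).union
      ((Set.countable_iUnion fun σ => (ih' (σ :: Γ)).image (Fm.all σ)).union
      (Set.countable_iUnion fun σ => (ih' (σ :: Γ)).image (Fm.ex σ))))))).mono fun A hA => ?_
    cases A with
    | eqN s t => exact Or.inl ⟨s, trivial, t, trivial, rfl⟩
    | and A B =>
      have : max A.height B.height ≤ n := Nat.le_of_succ_le_succ hA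
      exact Or.inr (Or.inl ⟨A, (le_max_left _ _).trans this, B, (le_max_right _ _).trans this, rfl⟩)
    | or A B =>
      have : max A.height B.height ≤ n := Nat.le_of_succ_le_succ hA
      exact Or.inr (Or.inr (Or.inl
        ⟨A, (le_max_left _ _).trans this, B, (le_max_right _ _).trans this, rfl⟩))
    | imp A B =>
      have : max A.height B.height ≤ n := Nat.le_of_succ_le_succ hA
      exact Or.inr (Or.inr (Or.inr (Or.inl
        ⟨A, (le_max_left _ _).trans this, B, (le_max_right _ _).trans this, rfl⟩)))
    | all σ A =>
      exact Or.inr (Or.inr (Or.inr (Or.inr (Or.inl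
        (Set.mem_iUnion.2 ⟨σ, A, Nat.le_of_succ_le_succ hA, rfl⟩)))))
    | ex σ A =>
      exact Or.inr (Or.inr (Or.inr (Or.inr (Or.inr
        (Set.mem_iUnion.2 ⟨σ, A, Nat.le_of_succ_le_succ hA, rfl⟩)))))

instance countable_fm (Γ : Ctx) : Countable (Fm E Γ) :=
  countable_of_height Fm.height fun n => countable_fm_height_le n Γ

end Countability

open Filter

/-! ## Models -/

/-- A typed applicative structure interpreting the constants. -/
structure PreModel (E : Ty → Type) where
  Obj : Ty → Type
  app {σ τ : Ty} : Obj (σ ➝ τ) → Obj σ → Obj τ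
  con {τ : Ty} : Const E τ → Obj τ

section Models

variable {E : Ty → Type} (𝓜 : PreModel E) {Γ Δ : Ctx} {σ τ : Ty}

/-- Assignments of objects to the variables of a context. -/
abbrev PreModel.Env (Γ : Ctx) : Type := ∀ τ : Ty, Var Γ τ → 𝓜.Obj τ

def PreModel.nil : 𝓜.Env [] := fun _ x => x.elim

variable {𝓜} in
def PreModel.cons (d : 𝓜.Obj σ) (θ : 𝓜.Env Γ) : 𝓜.Env (σ :: Γ)
  | _, Var.z => d
  | _, Var.s x => θ _ x

def PreModel.eval : {τ : Ty} → Tm E Γ τ → 𝓜.Env Γ → 𝓜.Obj τ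
  | _, .var x, θ => θ _ x
  | _, .const c, _ => 𝓜.con c
  | _, .app t u, θ => 𝓜.app (PreModel.eval t θ) (PreModel.eval u θ)

/-- Tarskian satisfaction. -/
def PreModel.sat : {Γ : Ctx} → Fm E Γ → 𝓜.Env Γ → Prop
  | _, .eqN s t, θ => 𝓜.eval s θ = 𝓜.eval t θ
  | _, .and A B, θ => PreModel.sat A θ ∧ PreModel.sat B θ
  | _, .or A B, θ => PreModel.sat A θ ∨ PreModel.sat B θ
  | _, .imp A B, θ => PreModel.sat A θ → PreModel.sat B θ
  | _, .all σ A, θ => ∀ d : 𝓜.Obj σ, PreModel.sat A (PreModel.cons d θ)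
  | _, .ex σ A, θ => ∃ d : 𝓜.Obj σ, PreModel.sat A (PreModel.cons d θ)

def PreModel.zero : 𝓜.Obj Ty.nat := 𝓜.con .zero

def PreModel.succ (n : 𝓜.Obj Ty.nat) : 𝓜.Obj Ty.nat := 𝓜.app (𝓜.con .succ) n

/-- Models of arithmetic in all finite types, with genuine equality of objects of type `0`. -/
class ArithModel (𝓜 : PreModel E) : Prop where
  combK : ∀ {σ τ : Ty} (s : 𝓜.Obj σ) (t : 𝓜.Obj τ), 𝓜.app (𝓜.app (𝓜.con (.combK σ τ)) s) t = s
  combS : ∀ {ρ σ τ : Ty} (s : 𝓜.Obj (ρ ➝ σ ➝ τ)) (t : 𝓜.Obj (ρ ➝ σ)) (u : 𝓜.Obj ρ),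
    𝓜.app (𝓜.app (𝓜.app (𝓜.con (.combS ρ σ τ)) s) t) u = 𝓜.app (𝓜.app s u) (𝓜.app t u)
  rec_zero : ∀ (b : 𝓜.Obj Ty.nat) (s : 𝓜.Obj (Ty.nat ➝ Ty.nat ➝ Ty.nat)),
    𝓜.app (𝓜.app (𝓜.app (𝓜.con (.recur [Ty.nat] Ty.nat Var.z)) 𝓜.zero) b) s = b
  rec_succ : ∀ (n b : 𝓜.Obj Ty.nat) (s : 𝓜.Obj (Ty.nat ➝ Ty.nat ➝ Ty.nat)),
    𝓜.app (𝓜.app (𝓜.app (𝓜.con (.recur [Ty.nat] Ty.nat Var.z)) (𝓜.succ n)) b) s =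
      𝓜.app (𝓜.app s (𝓜.app (𝓜.app (𝓜.app (𝓜.con (.recur [Ty.nat] Ty.nat Var.z)) n) b) s)) n
  succ_ne_zero : ∀ n, 𝓜.succ n ≠ 𝓜.zero
  succ_inj : ∀ m n, 𝓜.succ m = 𝓜.succ n → m = n
  ind : ∀ {Γ : Ctx} (A : Fm E (Ty.nat :: Γ)) (θ : 𝓜.Env Γ), 𝓜.sat A (PreModel.cons 𝓜.zero θ) →
    (∀ n, 𝓜.sat A (PreModel.cons n θ) → 𝓜.sat A (PreModel.cons (𝓜.succ n) θ)) →
    ∀ n, 𝓜.sat A (PreModel.cons n θ)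

variable {𝓜}

theorem PreModel.eval_subst (t : Tm E Γ τ) (η : Subst E Γ Δ) (θ : 𝓜.Env Δ) :
    𝓜.eval (t.subst η) θ = 𝓜.eval t (fun _ x => 𝓜.eval (η _ x) θ) := by
  induction t with
  | var x => rfl
  | const c => rfl
  | app t u iht ihu => simp only [Tm.subst, PreModel.eval, iht, ihu]

theorem PreModel.eval_wk (t : Tm E Γ τ) (d : 𝓜.Obj σ) (θ : 𝓜.Env Γ) :
    𝓜.eval t.wk (PreModel.cons d θ) = 𝓜.eval t θ := by
  rw [Tm.wk_eq_subst, PreModel.eval_subst]; rfl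

theorem PreModel.eval_cl (t : Tm E [] τ) (θ : 𝓜.Env Γ) :
    𝓜.eval t.cl θ = 𝓜.eval t 𝓜.nil := by
  rw [Tm.cl, Tm.ren_eq_subst, PreModel.eval_subst]
  congr 1
  funext τ x; cases x

theorem PreModel.cons_eval_lift (η : Subst E Γ Δ) (d : 𝓜.Obj σ) (θ : 𝓜.Env Δ) :
    (fun τ x => 𝓜.eval ((η.lift : Subst E (σ :: Γ) _) τ x) (PreModel.cons d θ)) =
      PreModel.cons d (fun τ x => 𝓜.eval (η τ x) θ) := by
  funext τ x
  cases x with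
  | z => rfl
  | s x => exact PreModel.eval_wk _ _ _

theorem PreModel.sat_subst (A : Fm E Γ) (η : Subst E Γ Δ) (θ : 𝓜.Env Δ) :
    𝓜.sat (A.subst η) θ ↔ 𝓜.sat A (fun _ x => 𝓜.eval (η _ x) θ) := by
  induction A generalizing Δ with
  | eqN s t => simp only [Fm.subst, PreModel.sat, PreModel.eval_subst]
  | and A B ihA ihB => simp only [Fm.subst, PreModel.sat, ihA, ihB]
  | or A B ihA ihB => simp only [Fm.subst, PreModel.sat, ihA, ihB]
  | imp A B ihA ihB => simp only [Fm.subst, PreModel.sat, ihA, ihB]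
  | all σ A ih => simp only [Fm.subst, PreModel.sat, ih, PreModel.cons_eval_lift]
  | ex σ A ih => simp only [Fm.subst, PreModel.sat, ih, PreModel.cons_eval_lift]

theorem PreModel.app_eval_lam [ArithModel 𝓜] (t : Tm E (σ :: Γ) τ) (θ : 𝓜.Env Γ) (d : 𝓜.Obj σ) :
    𝓜.app (𝓜.eval t.lam θ) d = 𝓜.eval t (PreModel.cons d θ) := by
  induction t with
  | var x =>
    cases x with
    | z => simp only [Tm.lam, PreModel.eval, ArithModel.combS, ArithModel.combK]; rfl
    | s x => simp only [Tm.lam, PreModel.eval, ArithModel.combK]; rfl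
  | const c => simp only [Tm.lam, PreModel.eval, ArithModel.combK]
  | app t u iht ihu => simp only [Tm.lam, PreModel.eval, ArithModel.combS, iht, ihu]

end Models

/-! ## Henkin construction -/

section Henkin

variable {E : Ty → Type}

instance : Inhabited Ty := ⟨Ty.nat⟩

/-- A closed term of every type. -/
def closedTerm {Γ : Ctx} : (τ : Ty) → Tm E Γ τ
  | .nat => tZero
  | .X => .const .zeroX
  | .arr σ τ => .const (.combK τ σ) ⬝ closedTerm τ

theorem exists_enum (α : Type) [Countable α] [Nonempty α] :
    ∃ f : ℕ → α, Function.Surjective f := exists_surjective_nat α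

noncomputable def tyEnum : ℕ → Ty := (exists_enum Ty).choose

theorem tyEnum_surjective : Function.Surjective tyEnum := (exists_enum Ty).choose_spec

instance {Γ : Ctx} : Nonempty (Fm E Γ) := ⟨Fm.falsum⟩

noncomputable def fmEnum [∀ τ, Countable (E τ)] (Γ : Ctx) : ℕ → Fm E Γ :=
  (exists_enum (Fm E Γ)).choose

theorem fmEnum_surjective [∀ τ, Countable (E τ)] (Γ : Ctx) :
    Function.Surjective (fmEnum (E := E) Γ) :=
  (exists_enum (Fm E Γ)).choose_spec

/-- The type of the variable added at stage `n`. -/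
noncomputable def stageTy (n : ℕ) : Ty := tyEnum n.unpair.1

/-- The context at stage `n`. -/
noncomputable def stage : ℕ → Ctx
  | 0 => []
  | n + 1 => stageTy n :: stage n

/-- The inclusion of stage `n` into stage `n + 1`. -/
noncomputable def stageUp (n : ℕ) : Subst E (stage n) (stage (n + 1)) := fun _ x => .var (Var.s x)

/-- The variable added at stage `n`. -/
noncomputable def stageVar (n : ℕ) : Tm E (stage (n + 1)) (stageTy n) := .var Var.z

/-- The inclusion of stage `i` into stage `n`, with junk values for `n < i`. -/
noncomputable def stageSubst (i : ℕ) : ∀ n, Subst E (stage i) (stage n)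
  | 0 => if h : i = 0 then h ▸ fun _ x => .var x else fun τ _ => closedTerm τ
  | n + 1 => if h : i = n + 1 then h ▸ fun _ x => .var x
    else fun τ x => (stageSubst i n τ x).subst (stageUp n)

theorem stageSubst_self (i : ℕ) : stageSubst (E := E) i i = fun _ x => .var x := by
  cases i <;> simp [stageSubst]

theorem stageSubst_succ {i n : ℕ} (h : i ≤ n) :
    stageSubst (E := E) i (n + 1) = fun τ x => (stageSubst i n τ x).subst (stageUp n) := by
  rw [stageSubst, dif_neg (by omega)]

/-- The index of the stage of the existential formula treated at stage `n`. -/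
def requestStage (n : ℕ) : ℕ := n.unpair.2.unpair.1

/-- The body of the existential formula treated at stage `n`. -/
noncomputable def request [∀ τ, Countable (E τ)] (n : ℕ) :
    Fm E (stageTy n :: stage (requestStage n)) :=
  fmEnum (stageTy n :: stage (requestStage n)) n.unpair.2.unpair.2

/-- A chain of consistent sets of assumptions with witnesses. -/
structure Chain [∀ τ, Countable (E τ)] (Ax : Set (Fm E [])) where
  hyps : ∀ n, List (Fm E (stage n))
  consistent : ∀ n, ¬ Der Ax (hyps n) Fm.falsum
  mono : ∀ n, ∀ B ∈ hyps n, B.subst (stageUp n) ∈ hyps (n + 1)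
  witness : ∀ n, (request n).subst (Subst.cons (stageVar n)
      (fun τ x => (stageSubst (requestStage n) n τ x).subst (stageUp n))) ∈ hyps (n + 1) ∨
    ((Fm.ex (stageTy n) (request n)).neg.subst (stageSubst (requestStage n) n)).subst
      (stageUp n) ∈ hyps (n + 1)

/-- One Henkin step. If `∃ x A` is consistent with H, existential elimination says that adding A for
a fresh variable stays consistent; otherwise excluded middle makes `¬∃ x A` consistent. -/
theorem exists_consistent_extension {Ax : Set (Fm E [])} {Γ : Ctx} {σ : Ty} {H : List (Fm E Γ)}
    (hH : ¬ Der Ax H Fm.falsum) (A : Fm E (σ :: Γ)) :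
    ∃ H' : List (Fm E (σ :: Γ)), ¬ Der Ax H' Fm.falsum ∧ (∀ B ∈ H, B.wk ∈ H') ∧
      (A ∈ H' ∨ (Fm.ex σ A).neg.wk ∈ H') := by
  by_cases h : Der Ax (Fm.ex σ A :: H) Fm.falsum
  · have h0 : ¬ Der Ax ((Fm.ex σ A).neg :: H) Fm.falsum := fun h' =>
      hH (.orE (.em (Fm.ex σ A)) h h')
    refine ⟨(tZero =ₙ tZero) :: ((Fm.ex σ A).neg :: H).map Fm.wk, fun h' => h0 ?_, ?_, ?_⟩
    -- The fresh variable is added in this case too; eliminating the vacuous `∃ x (0 = 0)` removes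
    -- it again, and this uses that every type has a closed term.
    · exact .exE (σ := σ) (A := tZero =ₙ tZero) (.exI (closedTerm σ) (.eqRefl _)) h'
    · intro B hB
      exact List.mem_cons_of_mem _ (List.mem_map_of_mem (List.mem_cons_of_mem _ hB))
    · exact Or.inr (List.mem_cons_of_mem _ (List.mem_map_of_mem List.mem_cons_self))
  · refine ⟨A :: (Fm.ex σ A :: H).map Fm.wk, fun h' => h ?_, ?_, ?_⟩
    · exact .exE (.hyp List.mem_cons_self) h'
    · intro B hB
      exact List.mem_cons_of_mem _ (List.mem_map_of_mem (List.mem_cons_of_mem _ hB))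
    · exact Or.inl List.mem_cons_self

theorem exists_next_stage [∀ τ, Countable (E τ)] {Ax : Set (Fm E [])} (n : ℕ)
    (H : {H : List (Fm E (stage n)) // ¬ Der Ax H Fm.falsum}) :
    ∃ H' : {H : List (Fm E (stage (n + 1))) // ¬ Der Ax H Fm.falsum},
      (∀ B ∈ H.1, B.subst (stageUp n) ∈ H'.1) ∧
      ((request n).subst (Subst.cons (stageVar n)
        (fun τ x => (stageSubst (requestStage n) n τ x).subst (stageUp n))) ∈ H'.1 ∨
      ((Fm.ex (stageTy n) (request n)).neg.subst (stageSubst (requestStage n) n)).subst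
        (stageUp n) ∈ H'.1) := by
  obtain ⟨H', h1, h2, h3⟩ := exists_consistent_extension H.2
    ((request n).subst (stageSubst (requestStage n) n).lift)
  refine ⟨⟨H', h1⟩, h2, ?_⟩
  refine h3.imp (fun h => ?_) id
  rw [Subst.lift_eq_cons] at h
  simp only [Tm.wk_eq_subst] at h
  exact h

theorem exists_chain [∀ τ, Countable (E τ)] {Ax : Set (Fm E [])} {H : List (Fm E [])}
    (hH : ¬ Der Ax H Fm.falsum) : ∃ 𝓒 : Chain Ax, 𝓒.hyps 0 = H := by
  let hs : ∀ n, {H : List (Fm E (stage n)) // ¬ Der Ax H Fm.falsum} := fun n =>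
    Nat.rec (motive := fun n => {H : List (Fm E (stage n)) // ¬ Der Ax H Fm.falsum}) ⟨H, hH⟩
      (fun n H => (exists_next_stage n H).choose) n
  exact ⟨⟨fun n => (hs n).1, fun n => (hs n).2,
    fun n => (exists_next_stage n (hs n)).choose_spec.1,
    fun n => (exists_next_stage n (hs n)).choose_spec.2⟩, rfl⟩

/-- Coherent sequences of terms. -/
def Elem (E : Ty → Type) (τ : Ty) : Type :=
  {t : ∀ n, Tm E (stage n) τ // ∀ᶠ n in atTop, t (n + 1) = (t n).subst (stageUp n)}

def Elem.app {σ τ : Ty} (d : Elem E (σ ➝ τ)) (e : Elem E σ) : Elem E τ :=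
  ⟨fun n => d.1 n ⬝ e.1 n, by
    filter_upwards [d.2, e.2] with n hd he
    rw [hd, he]; rfl⟩

def Elem.const {τ : Ty} (c : Const E τ) : Elem E τ := ⟨fun _ => .const c, .of_forall fun _ => rfl⟩

noncomputable def Elem.ofStage {τ : Ty} (i : ℕ) (t : Tm E (stage i) τ) : Elem E τ :=
  ⟨fun n => t.subst (stageSubst i n), by
    filter_upwards [eventually_ge_atTop i] with n hn
    rw [stageSubst_succ hn, ← Tm.subst_subst]⟩

/-- Assignments of coherent sequences to variables. -/
abbrev EEnv (E : Ty → Type) (Γ : Ctx) : Type := ∀ τ, Var Γ τ → Elem E τ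

def EEnv.cons {Γ : Ctx} {σ : Ty} (d : Elem E σ) (θ : EEnv E Γ) : EEnv E (σ :: Γ)
  | _, Var.z => d
  | _, Var.s x => θ _ x

def EEnv.at {Γ : Ctx} (θ : EEnv E Γ) (n : ℕ) : Subst E Γ (stage n) := fun τ x => (θ τ x).1 n

theorem EEnv.cons_at {Γ : Ctx} {σ : Ty} (d : Elem E σ) (θ : EEnv E Γ) (n : ℕ) :
    (EEnv.cons d θ).at n = Subst.cons (d.1 n) (θ.at n) := by
  funext τ x; cases x <;> rfl

/-- A context is finite, so the thresholds of its variables have a common bound. -/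
theorem EEnv.eventually_coherent {Γ : Ctx} (θ : EEnv E Γ) :
    ∀ᶠ n in atTop, θ.at (n + 1) = fun τ x => (θ.at n τ x).subst (stageUp n) := by
  induction Γ with
  | nil => exact .of_forall fun n => by funext τ x; cases x
  | cons σ Γ ih =>
    filter_upwards [ih (fun τ x => θ τ (Var.s x)), (θ σ Var.z).2] with n h1 h2
    funext τ x
    cases x with
    | z => exact h2
    | s x => exact congrFun (congrFun h1 _) x

theorem Subst.cons_comp {Γ Δ Θ : Ctx} {σ : Ty} (t : Tm E Δ σ) (θ : Subst E Γ Δ)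
    (η : Subst E Δ Θ) : (fun τ x => (Subst.cons t θ τ x).subst η) =
      Subst.cons (t.subst η) (fun τ x => (θ τ x).subst η) := by
  funext τ x; cases x <;> rfl

theorem Subst.lift_comp_cons {Γ Δ Θ : Ctx} {σ : Ty} (θ : Subst E Γ Δ) (t : Tm E Θ σ)
    (η : Subst E Δ Θ) : (fun τ x => ((θ.lift : Subst E (σ :: Γ) _) τ x).subst (Subst.cons t η)) =
      Subst.cons t (fun τ x => (θ τ x).subst η) := by
  funext τ x
  cases x with
  | z => rfl
  | s x => exact Tm.wk_subst _ _

/-! ### Truth along a chain of consistent stages -/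

namespace Chain

variable [∀ τ, Countable (E τ)] {Ax : Set (Fm E [])} (𝓒 : Chain Ax)

/-- Truth of a formula under an assignment of coherent sequences. -/
def Forces {Γ : Ctx} (A : Fm E Γ) (θ : EEnv E Γ) : Prop :=
  ∀ᶠ n in atTop, Der Ax (𝓒.hyps n) (A.subst (θ.at n))

theorem forces_of_mem {Γ : Ctx} {A : Fm E Γ} {θ : EEnv E Γ} {m : ℕ}
    (hθ : ∀ n ≥ m, θ.at (n + 1) = fun τ x => (θ.at n τ x).subst (stageUp n))
    (h : A.subst (θ.at m) ∈ 𝓒.hyps m) : 𝓒.Forces A θ := by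
  filter_upwards [eventually_ge_atTop m] with n hn
  refine .hyp ?_
  induction n, hn using Nat.le_induction with
  | base => exact h
  | succ n hn ih =>
    have := 𝓒.mono n _ ih
    rwa [Fm.subst_subst, ← hθ n hn] at this

/-- The Henkin property. From some stage N on the assignment is coherent, so A under the assignment
is a formula over stage N; it is requested at some later stage and settled there. -/
theorem exists_witness_or {Γ : Ctx} {σ : Ty} (A : Fm E (σ :: Γ)) (θ : EEnv E Γ) :
    (∃ d, 𝓒.Forces A (EEnv.cons d θ)) ∨ 𝓒.Forces (Fm.ex σ A).neg θ := by
  obtain ⟨N, hN⟩ := eventually_atTop.1 θ.eventually_coherent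
  obtain ⟨a, ha⟩ := tyEnum_surjective σ
  obtain ⟨k, hk⟩ := fmEnum_surjective (E := E) _ (A.subst (θ.at N).lift)
  -- The stage number codes type, stage and formula. The components of a pair are at most the pair,
  -- so stage N already exists when the request is treated.
  obtain ⟨n, h1, h2, h3⟩ : ∃ n : ℕ, stageTy n = σ ∧ requestStage n = N ∧
      n.unpair.2.unpair.2 = k :=
    ⟨Nat.pair a (Nat.pair N k), by simp [requestStage, stageTy, ha]⟩
  have hNn : N ≤ n := by
    rw [← h2]; exact (Nat.unpair_left_le _).trans (Nat.unpair_right_le _)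
  subst h1 h2 h3
  have hat : ∀ m, requestStage n ≤ m →
      θ.at m = fun τ x => (θ.at (requestStage n) τ x).subst (stageSubst _ m) := by
    intro m hm
    induction m, hm using Nat.le_induction with
    | base => rw [stageSubst_self]; funext τ x; exact (Tm.subst_var _).symm
    | succ m hm ih =>
      rw [hN m hm, ih, stageSubst_succ hm]
      simp only [Tm.subst_subst]
  have hreq : request n = A.subst (θ.at (requestStage n)).lift := hk
  have hw := 𝓒.witness n
  rw [hreq] at hw
  rcases hw with h | h
  · left
    refine ⟨Elem.ofStage (n + 1) (stageVar n), 𝓒.forces_of_mem (m := n + 1) (fun m hm => ?_) ?_⟩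
    · rw [EEnv.cons_at, EEnv.cons_at, hN m (by omega), Subst.cons_comp]
      have h0 : (Elem.ofStage (n + 1) (stageVar (E := E) n)).1 (m + 1) =
          ((Elem.ofStage (n + 1) (stageVar n)).1 m).subst (stageUp m) := by
        simp only [Elem.ofStage, stageSubst_succ hm, Tm.subst_subst]
      rw [h0]
    · rw [Fm.subst_subst, Subst.lift_comp_cons, ← stageSubst_succ hNn, ← hat _ (by omega)] at h
      rw [EEnv.cons_at]
      simp only [Elem.ofStage, stageSubst_self, Tm.subst_var]
      exact h
  · right
    refine 𝓒.forces_of_mem (m := n + 1) (fun m hm => hN m (by omega)) ?_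
    have h' : (((Fm.ex (stageTy n) A).neg.subst (θ.at (requestStage n))).subst
        (stageSubst (requestStage n) n)).subst (stageUp n) ∈ 𝓒.hyps (n + 1) := h
    rw [Fm.subst_subst, Fm.subst_subst] at h'
    rw [hat _ (by omega), stageSubst_succ hNn]
    exact h'

theorem not_forces_falsum {Γ : Ctx} (θ : EEnv E Γ) : ¬ 𝓒.Forces Fm.falsum θ := fun h =>
  let ⟨n, hn⟩ := h.exists
  𝓒.consistent n hn

/-- Completeness of the limit theory comes for free from the Henkin step: apply it to A with a dummy
variable, for which having a witness and being true are the same. -/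
theorem forces_or_forces_neg {Γ : Ctx} (A : Fm E Γ) (θ : EEnv E Γ) :
    𝓒.Forces A θ ∨ 𝓒.Forces A.neg θ := by
  rcases 𝓒.exists_witness_or (σ := Ty.nat) A.wk θ with ⟨d, hd⟩ | h
  · left
    filter_upwards [hd] with n hn
    rwa [EEnv.cons_at, Fm.wk, Fm.subst_subst] at hn
  · right
    filter_upwards [h] with n hn
    -- A cut against an implication brings a derived formula into the assumption list, which avoids
    -- proving weakening.
    refine .impE (.impI (.impI (.impE (.hyp (List.mem_cons_of_mem _ List.mem_cons_self)) ?_))) hn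
    refine .exI tZero ?_
    have : ((A.wk (σ := Ty.nat)).subst (θ.at n).lift).inst tZero = A.subst (θ.at n) := by
      rw [Fm.subst_lift_inst, Fm.wk, Fm.subst_subst]; rfl
    exact this ▸ .hyp List.mem_cons_self

end Chain

end Henkin
open Filter

/-! ## The term model and completeness -/

section TermModel

variable {E : Ty → Type} {Ax : Set (Fm E [])}

/-- Closing a theorem about a quantifier-free assumption under `r`, in any set of assumptions. -/
theorem Der.subst_congr {Γ : Ctx} {σ τ : Ty} {H : List (Fm E Γ)} {A : Fm E Γ} (hA : A.QF)
    {s t : Tm E Γ σ} (r : Tm E (σ :: Γ) τ) {s' t' : Tm E Γ τ}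
    (hs : r.subst (Subst.single s) = s') (ht : r.subst (Subst.single t) = t')
    (h : Der Ax [] (A ⇨' eqT σ s t)) : Der Ax H (A ⇨' eqT τ s' t') :=
  hs ▸ ht ▸ .qfER hA r h

variable [∀ τ, Countable (E τ)]

namespace Chain

variable (𝓒 : Chain Ax)

/-- Indiscernibility, modulo a true quantifier-free assumption. -/
def Rel {τ : Ty} (d e : Elem E τ) : Prop :=
  ∀ᶠ n in atTop, ∃ A : Fm E (stage n), A.QF ∧ Der Ax (𝓒.hyps n) A ∧
    Der Ax [] (A ⇨' eqT τ (d.1 n) (e.1 n))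

theorem rel_of_forall {τ : Ty} {d e : Elem E τ}
    (h : ∀ n, Der Ax [tZero =ₙ tZero] (eqT τ (d.1 n) (e.1 n))) : 𝓒.Rel d e :=
  .of_forall fun n => ⟨tZero =ₙ tZero, trivial, .eqRefl _, .impI (h n)⟩

/-- The term model. -/
def model : PreModel E where
  Obj τ := Quot (𝓒.Rel (τ := τ))
  app := Quot.map₂ Elem.app
    (fun f d e h => by
      filter_upwards [h] with n hn
      obtain ⟨A, hA, h1, h2⟩ := hn
      exact ⟨A, hA, h1, h2.subst_congr hA ((f.1 n).wk ⬝ v0)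
        (congrArg (· ⬝ d.1 n) (Tm.wk_subst_single _ _))
        (congrArg (· ⬝ e.1 n) (Tm.wk_subst_single _ _))⟩)
    (fun f g d h => by
      filter_upwards [h] with n hn
      obtain ⟨A, hA, h1, h2⟩ := hn
      exact ⟨A, hA, h1, h2.subst_congr hA (v0 ⬝ (d.1 n).wk)
        (congrArg (f.1 n ⬝ ·) (Tm.wk_subst_single _ _))
        (congrArg (g.1 n ⬝ ·) (Tm.wk_subst_single _ _))⟩)
  con c := Quot.mk _ (Elem.const c)

/-- The element of the term model denoted by a coherent sequence. -/
def toObj {τ : Ty} (d : Elem E τ) : 𝓒.model.Obj τ := Quot.mk _ d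

theorem exists_toObj {τ : Ty} (a : 𝓒.model.Obj τ) : ∃ d, 𝓒.toObj d = a := Quot.exists_rep a

/-- The relation need not be an equivalence at higher types, so the quotient is by the equivalence
it generates. At type 0 provable equality is an equivalence containing it, hence classes can be read
off. -/
theorem toObj_eq_toObj_iff (d e : Elem E Ty.nat) :
    𝓒.toObj d = 𝓒.toObj e ↔ ∀ᶠ n in atTop, Der Ax (𝓒.hyps n) (d.1 n =ₙ e.1 n) := by
  constructor
  · intro h
    have h' := Quot.eqvGen_exact h
    clear h
    induction h' with
    | rel d e h =>
      filter_upwards [h] with n hn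
      obtain ⟨A, hA, h1, h2⟩ := hn
      exact .impE (h2.subst_congr hA v0 rfl rfl) h1
    | refl d => exact .of_forall fun n => .eqRefl _
    | symm d e _ ih => filter_upwards [ih] with n hn using .eqSymm hn
    | trans d e f _ _ ih1 ih2 =>
      filter_upwards [ih1, ih2] with n h1 h2 using .eqTrans h1 h2
  · intro h
    refine Quot.sound ?_
    filter_upwards [h] with n hn
    -- The equation is its own quantifier-free premise: it is derivable at stage n, and the required
    -- implication is a tautology.
    exact ⟨d.1 n =ₙ e.1 n, trivial, hn, .impI (.hyp List.mem_cons_self)⟩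

/-- The assignment in the term model given by coherent sequences. -/
def env {Γ : Ctx} (θ : EEnv E Γ) : 𝓒.model.Env Γ := fun _ x => 𝓒.toObj (θ _ x)

theorem env_cons {Γ : Ctx} {σ : Ty} (d : Elem E σ) (θ : EEnv E Γ) :
    𝓒.env (EEnv.cons d θ) = PreModel.cons (𝓒.toObj d) (𝓒.env θ) := by
  funext τ x; cases x <;> rfl

theorem exists_env {Γ : Ctx} (θ : 𝓒.model.Env Γ) : ∃ η, 𝓒.env η = θ := by
  choose f hf using fun (a : Σ τ, Var Γ τ) => 𝓒.exists_toObj (θ a.1 a.2)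
  exact ⟨fun τ x => f ⟨τ, x⟩, by funext τ x; exact hf ⟨τ, x⟩⟩

/-- The coherent sequence of the instances of a term. -/
noncomputable def termElem {Γ : Ctx} {τ : Ty} (t : Tm E Γ τ) (θ : EEnv E Γ) : Elem E τ :=
  ⟨fun n => t.subst (θ.at n), by
    filter_upwards [θ.eventually_coherent] with n hn
    rw [hn, Tm.subst_subst]⟩

theorem eval_env {Γ : Ctx} {τ : Ty} (t : Tm E Γ τ) (θ : EEnv E Γ) :
    𝓒.model.eval t (𝓒.env θ) = 𝓒.toObj (termElem t θ) := by
  induction t with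
  | var x => rfl
  | const c => rfl
  | app t u iht ihu => rw [PreModel.eval, iht, ihu]; rfl

theorem forces_and {Γ : Ctx} {A B : Fm E Γ} {θ : EEnv E Γ} :
    𝓒.Forces (A ⋏ B) θ ↔ 𝓒.Forces A θ ∧ 𝓒.Forces B θ := by
  refine ⟨fun h => ⟨?_, ?_⟩, fun h => ?_⟩
  · filter_upwards [h] with n hn using .andE₁ hn
  · filter_upwards [h] with n hn using .andE₂ hn
  · filter_upwards [h.1, h.2] with n h1 h2 using .andI h1 h2

theorem not_forces_neg_iff {Γ : Ctx} {A : Fm E Γ} {θ : EEnv E Γ} :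
    ¬ 𝓒.Forces A.neg θ ↔ 𝓒.Forces A θ := by
  refine ⟨fun h => (𝓒.forces_or_forces_neg A θ).resolve_right h, fun h h' => ?_⟩
  refine 𝓒.not_forces_falsum θ ?_
  filter_upwards [h, h'] with n h1 h2 using .impE h2 h1

theorem forces_or {Γ : Ctx} {A B : Fm E Γ} {θ : EEnv E Γ} :
    𝓒.Forces (A ⋎ B) θ ↔ 𝓒.Forces A θ ∨ 𝓒.Forces B θ := by
  refine ⟨fun h => ?_, fun h => ?_⟩
  · by_contra! hAB
    have hA := (𝓒.forces_or_forces_neg A θ).resolve_left hAB.1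
    have hB := (𝓒.forces_or_forces_neg B θ).resolve_left hAB.2
    refine 𝓒.not_forces_falsum θ ?_
    filter_upwards [h, hA, hB] with n h0 h1 h2
    refine .impE (.impE (.impE (.impI (.impI (.impI ?_))) h0) h1) h2
    refine .orE (A := A.subst (θ.at n)) (B := B.subst (θ.at n))
      (.hyp (by simp [Fm.subst])) ?_ ?_
    · exact .impE (A := A.subst (θ.at n)) (.hyp (by simp [Fm.neg, Fm.subst, Fm.falsum, Tm.subst]))
        (.hyp (by simp))
    · exact .impE (A := B.subst (θ.at n)) (.hyp (by simp [Fm.neg, Fm.subst, Fm.falsum, Tm.subst]))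
        (.hyp (by simp))
  · rcases h with h | h
    · filter_upwards [h] with n hn using .orI₁ hn
    · filter_upwards [h] with n hn using .orI₂ hn

theorem forces_imp {Γ : Ctx} {A B : Fm E Γ} {θ : EEnv E Γ} :
    𝓒.Forces (A ⇨' B) θ ↔ (𝓒.Forces A θ → 𝓒.Forces B θ) := by
  refine ⟨fun h hA => ?_, fun h => ?_⟩
  · filter_upwards [h, hA] with n h1 h2 using .impE h1 h2
  · rcases 𝓒.forces_or_forces_neg A θ with hA | hA
    · filter_upwards [h hA] with n hn
      exact .impE (.impI (.impI (.hyp (by simp)))) hn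
    · filter_upwards [hA] with n hn
      refine .impE (.impI (.impI (.exFalso (.impE (A := A.subst (θ.at n)) (.hyp ?_) (.hyp ?_))))) hn
      · simp [Fm.neg, Fm.subst, Fm.falsum, Tm.subst]
      · simp

theorem forces_ex {Γ : Ctx} {σ : Ty} {A : Fm E (σ :: Γ)} {θ : EEnv E Γ} :
    𝓒.Forces (.ex σ A) θ ↔ ∃ d, 𝓒.Forces A (EEnv.cons d θ) := by
  refine ⟨fun h => ?_, fun ⟨d, h⟩ => ?_⟩
  · exact (𝓒.exists_witness_or A θ).resolve_right (𝓒.not_forces_neg_iff.2 h)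
  · filter_upwards [h] with n hn
    refine .exI (d.1 n) ?_
    rwa [Fm.subst_lift_inst, ← EEnv.cons_at]

theorem forces_all {Γ : Ctx} {σ : Ty} {A : Fm E (σ :: Γ)} {θ : EEnv E Γ} :
    𝓒.Forces (.all σ A) θ ↔ ∀ d, 𝓒.Forces A (EEnv.cons d θ) := by
  refine ⟨fun h d => ?_, fun h => ?_⟩
  · filter_upwards [h] with n hn
    have := Der.allE (d.1 n) hn
    rwa [Fm.subst_lift_inst, ← EEnv.cons_at] at this
  · rcases 𝓒.exists_witness_or A.neg θ with ⟨d, hd⟩ | h'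
    -- A witness for the negation would be a counterexample to `h`; without one `¬∃ x ¬A` is
    -- derivable, and excluded middle turns it into `∀ x A`.
    · exact absurd hd (𝓒.not_forces_neg_iff.2 (h d))
    · filter_upwards [h'] with n hn
      set B := A.subst (θ.at n).lift with hB
      have hn' : Der Ax (𝓒.hyps n) (Fm.ex σ B.neg).neg := hn
      refine .impE (.impI (.allI ?_)) hn'
      refine .orE (.em B) (.hyp List.mem_cons_self) (.exFalso ?_)
      have hw : ((Fm.ex σ B.neg).neg.wk : Fm E (σ :: stage n)) ∈
          B.neg :: ((Fm.ex σ B.neg).neg :: 𝓒.hyps n).map Fm.wk := by simp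
      refine .impE (.hyp hw) (.exI v0 ?_)
      have : (B.neg.subst (Subst.lift fun _ x => .var (Var.s x))).inst (v0 : Tm E (σ :: stage n) σ)
          = B.neg := by
        rw [Fm.subst_lift_inst]
        have h0 : (Subst.cons (v0 : Tm E (σ :: stage n) σ) fun _ x => .var (Var.s x)) =
            fun _ x => .var x := by funext τ x; cases x <;> rfl
        rw [h0, Fm.subst_var]
      exact Eq.mpr (congrArg _ this) (.hyp List.mem_cons_self)

/-- The truth lemma. -/
theorem sat_env {Γ : Ctx} (A : Fm E Γ) (θ : EEnv E Γ) :
    𝓒.model.sat A (𝓒.env θ) ↔ 𝓒.Forces A θ := by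
  induction A with
  | eqN s t => rw [PreModel.sat, eval_env, eval_env, toObj_eq_toObj_iff]; rfl
  | and A B ihA ihB => rw [PreModel.sat, forces_and, ihA, ihB]
  | or A B ihA ihB => rw [PreModel.sat, forces_or, ihA, ihB]
  | imp A B ihA ihB => rw [PreModel.sat, forces_imp, ihA, ihB]
  | all σ A ih =>
    rw [PreModel.sat, forces_all]
    refine ⟨fun h d => ?_, fun h a => ?_⟩
    · rw [← ih, env_cons]; exact h _
    · obtain ⟨d, rfl⟩ := 𝓒.exists_toObj a
      rw [← env_cons, ih]; exact h d
  | ex σ A ih =>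
    rw [PreModel.sat, forces_ex]
    constructor
    · rintro ⟨a, h⟩
      obtain ⟨d, rfl⟩ := 𝓒.exists_toObj a
      rw [← env_cons, ih] at h; exact ⟨d, h⟩
    · rintro ⟨d, h⟩
      rw [← ih, env_cons] at h; exact ⟨_, h⟩

theorem sat_of_der {Γ : Ctx} (A : Fm E Γ)
    (h : ∀ n (θ : Subst E Γ (stage n)), Der Ax (𝓒.hyps n) (A.subst θ)) (θ : 𝓒.model.Env Γ) :
    𝓒.model.sat A θ := by
  obtain ⟨η, rfl⟩ := 𝓒.exists_env θ
  rw [sat_env]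
  exact .of_forall fun n => h n _

/-- The equational clauses hold because the corresponding axioms are derivable without assumptions,
so the trivial premise 0 = 0 suffices for identification. The other clauses pass through the truth
lemma; induction with parameters follows because parameters are denoted by terms. -/
instance : ArithModel 𝓒.model where
  combK s t := by
    obtain ⟨s, rfl⟩ := 𝓒.exists_toObj s
    obtain ⟨t, rfl⟩ := 𝓒.exists_toObj t
    exact Quot.sound (𝓒.rel_of_forall (d := ((Elem.const _).app s).app t) fun n => .combK _ _)
  combS s t u := by
    obtain ⟨s, rfl⟩ := 𝓒.exists_toObj s
    obtain ⟨t, rfl⟩ := 𝓒.exists_toObj t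
    obtain ⟨u, rfl⟩ := 𝓒.exists_toObj u
    exact Quot.sound (𝓒.rel_of_forall (d := (((Elem.const _).app s).app t).app u)
      (e := (s.app u).app (t.app u)) fun n => .combS _ _ _)
  rec_zero b s := by
    obtain ⟨b, rfl⟩ := 𝓒.exists_toObj b
    obtain ⟨s, rfl⟩ := 𝓒.exists_toObj s
    exact Quot.sound (𝓒.rel_of_forall (d := (((Elem.const _).app (Elem.const _)).app b).app s)
      fun n => .recZero [Ty.nat] Var.z (fun | _, Var.z => b.1 n) (fun | _, Var.z => s.1 n))
  rec_succ m b s := by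
    obtain ⟨m, rfl⟩ := 𝓒.exists_toObj m
    obtain ⟨b, rfl⟩ := 𝓒.exists_toObj b
    obtain ⟨s, rfl⟩ := 𝓒.exists_toObj s
    exact Quot.sound (𝓒.rel_of_forall
      (d := (((Elem.const _).app ((Elem.const _).app m)).app b).app s)
      (e := (s.app ((((Elem.const _).app m).app b).app s)).app m)
      fun n => .recSucc [Ty.nat] Var.z (m.1 n) (fun | _, Var.z => b.1 n)
        (fun | _, Var.z => s.1 n))
  succ_ne_zero n h :=
    𝓒.not_forces_falsum (fun _ (x : Var [] _) => x.elim) ((𝓒.sat_env _ _).1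
      (𝓒.sat_of_der (Γ := [Ty.nat]) (tSucc v0 =ₙ tZero).neg (fun n θ => .succNeZero _)
        (PreModel.cons n (PreModel.nil _)) h))
  succ_inj m n :=
    𝓒.sat_of_der (Γ := [Ty.nat, Ty.nat]) (tSucc v0 =ₙ tSucc v1 ⇨' v0 =ₙ v1)
      (fun n θ => .succInj _ _) (PreModel.cons m (PreModel.cons n (PreModel.nil _)))
  ind A θ h0 h1 := by
    have h := 𝓒.sat_of_der (A.inst tZero ⋏ .all Ty.nat (A ⇨' A.subst Subst.succ) ⇨' .all Ty.nat A)
      (fun n θ => by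
        have := Der.ind (Ax := Ax) (H := 𝓒.hyps n) (A.subst θ.lift)
        simp only [Fm.subst, Fm.inst_subst, Fm.subst_succ_subst_lift, Tm.subst]
        exact this) θ
    refine h ⟨?_, fun n hn => ?_⟩
    · rw [Fm.inst, PreModel.sat_subst]
      convert h0 using 1
      funext τ x; cases x <;> rfl
    · rw [PreModel.sat_subst]
      convert h1 n hn using 1
      funext τ x; cases x <;> rfl

end Chain

/-- Completeness: a sentence that holds in all models of arithmetic in all finite types which
satisfy the axioms is provable. -/
theorem proves_of_models {S : Fm E []} (h : ∀ 𝓜 : PreModel E, ArithModel 𝓜 →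
    (∀ A ∈ Ax, 𝓜.sat A 𝓜.nil) → 𝓜.sat S 𝓜.nil) : Proves Ax S := by
  by_contra hS
  have hS' : ¬ Der Ax [S.neg] Fm.falsum := fun h' =>
    hS (.orE (.em S) (.hyp List.mem_cons_self) (.exFalso h'))
  obtain ⟨𝓒, h𝓒⟩ := exists_chain hS'
  have hnil : 𝓒.env (fun _ x => x.elim) = 𝓒.model.nil := by funext τ x; cases x
  have hs := h 𝓒.model inferInstance fun A hA => 𝓒.sat_of_der A (fun n θ => by
    have : θ = fun _ x => x.elim := by funext τ x; cases x
    exact this ▸ .ax hA) _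
  rw [← hnil, 𝓒.sat_env] at hs
  refine 𝓒.not_forces_neg_iff.2 hs (𝓒.forces_of_mem (m := 0) (fun n _ => ?_) ?_)
  · funext τ x; cases x
  · have : (EEnv.at (E := E) (fun _ x => x.elim) 0) = fun _ (x : Var [] _) => .var x := by
      funext τ x; cases x
    have h0 : S.neg.subst (EEnv.at (E := E) (fun _ x => x.elim) 0) = S.neg :=
      (congrArg (fun θ => Fm.subst θ S.neg) this).trans S.neg.subst_var
    rw [h𝓒, h0]
    exact List.mem_cons_self

end TermModel
/-! ## Arithmetic in a model -/

section Arithmetic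

variable {E : Ty → Type} {𝓜 : PreModel E} {Γ : Ctx} {σ τ : Ty}

namespace PreModel

@[simp] theorem eval_var_z (d : 𝓜.Obj σ) (θ : 𝓜.Env Γ) :
    𝓜.eval (.var Var.z) (cons d θ) = d := rfl

@[simp] theorem eval_var_s (x : Var Γ τ) (d : 𝓜.Obj σ) (θ : 𝓜.Env Γ) :
    𝓜.eval (.var (Var.s x)) (cons d θ) = 𝓜.eval (.var x) θ := rfl

-- Low priority lets the evaluation lemmas of the named closed functions fire before their
-- applications are taken apart.
@[simp low] theorem eval_app (t : Tm E Γ (σ ➝ τ)) (u : Tm E Γ σ) (θ : 𝓜.Env Γ) :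
    𝓜.eval (t ⬝ u) θ = 𝓜.app (𝓜.eval t θ) (𝓜.eval u θ) := rfl

attribute [simp] eval_wk eval_cl app_eval_lam

@[simp] theorem sat_eqN (s t : Tm E Γ Ty.nat) (θ : 𝓜.Env Γ) :
    𝓜.sat (s =ₙ t) θ ↔ 𝓜.eval s θ = 𝓜.eval t θ := Iff.rfl

@[simp] theorem sat_and (A B : Fm E Γ) (θ : 𝓜.Env Γ) :
    𝓜.sat (A ⋏ B) θ ↔ 𝓜.sat A θ ∧ 𝓜.sat B θ := Iff.rfl

@[simp] theorem sat_or (A B : Fm E Γ) (θ : 𝓜.Env Γ) :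
    𝓜.sat (A ⋎ B) θ ↔ 𝓜.sat A θ ∨ 𝓜.sat B θ := Iff.rfl

@[simp] theorem sat_imp (A B : Fm E Γ) (θ : 𝓜.Env Γ) :
    𝓜.sat (A ⇨' B) θ ↔ (𝓜.sat A θ → 𝓜.sat B θ) := Iff.rfl

@[simp] theorem sat_all (A : Fm E (σ :: Γ)) (θ : 𝓜.Env Γ) :
    𝓜.sat (.all σ A) θ ↔ ∀ d, 𝓜.sat A (cons d θ) := Iff.rfl

@[simp] theorem sat_ex (A : Fm E (σ :: Γ)) (θ : 𝓜.Env Γ) :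
    𝓜.sat (.ex σ A) θ ↔ ∃ d, 𝓜.sat A (cons d θ) := Iff.rfl

variable (𝓜) in
/-- The natural numbers of a model. -/
abbrev Num : Type := 𝓜.Obj Ty.nat

instance : Zero 𝓜.Num := ⟨𝓜.zero⟩

instance : Add 𝓜.Num := ⟨fun a b => 𝓜.app (𝓜.app (𝓜.eval cAdd 𝓜.nil) a) b⟩

instance : Mul 𝓜.Num := ⟨fun a b => 𝓜.app (𝓜.app (𝓜.eval cMul 𝓜.nil) a) b⟩

instance : One 𝓜.Num := ⟨𝓜.succ 0⟩

@[simp] theorem eval_zero (θ : 𝓜.Env Γ) : 𝓜.eval (.const .zero) θ = (0 : 𝓜.Num) := rfl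

@[simp] theorem eval_nAdd (s t : Tm E Γ Ty.nat) (θ : 𝓜.Env Γ) :
    𝓜.eval (nAdd s t) θ = 𝓜.eval s θ + 𝓜.eval t θ := by
  simp only [nAdd, eval_app, eval_cl]; rfl

@[simp] theorem eval_nMul (s t : Tm E Γ Ty.nat) (θ : 𝓜.Env Γ) :
    𝓜.eval (nMul s t) θ = 𝓜.eval s θ * 𝓜.eval t θ := by
  simp only [nMul, eval_app, eval_cl]; rfl

theorem eval_tSucc (t : Tm E Γ Ty.nat) (θ : 𝓜.Env Γ) :
    𝓜.eval (tSucc t) θ = 𝓜.succ (𝓜.eval t θ) := rfl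

variable [ArithModel 𝓜]

/-- Internal induction for a predicate defined by a formula. -/
@[elab_as_elim]
theorem induction_of_sat {P : 𝓜.Num → Prop} (A : Fm E (Ty.nat :: Γ)) (θ : 𝓜.Env Γ)
    (hA : ∀ n, 𝓜.sat A (cons n θ) ↔ P n) (h0 : P 0) (hs : ∀ n, P n → P (𝓜.succ n)) (n : 𝓜.Num) :
    P n := by
  simp only [← hA] at *
  exact ArithModel.ind A θ h0 hs n

/-- The value of a primitive recursion. -/
def nrec (b : 𝓜.Num) (z : 𝓜.Obj (Ty.nat ➝ Ty.nat ➝ Ty.nat)) (n : 𝓜.Num) : 𝓜.Num :=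
  𝓜.app (𝓜.app (𝓜.app (σ := Ty.nat) (𝓜.con (.recur [Ty.nat] Ty.nat Var.z)) n) b) z

theorem nrec_zero (b : 𝓜.Num) (z : 𝓜.Obj (Ty.nat ➝ Ty.nat ➝ Ty.nat)) : nrec b z 0 = b :=
  ArithModel.rec_zero b z

theorem nrec_succ (b : 𝓜.Num) (z : 𝓜.Obj (Ty.nat ➝ Ty.nat ➝ Ty.nat)) (n : 𝓜.Num) :
    nrec b z (𝓜.succ n) = 𝓜.app (𝓜.app z (nrec b z n)) n :=
  ArithModel.rec_succ n b z

/-- Step functionals that agree pointwise may still be different objects, since the model is not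
extensional; their recursions are compared by internal induction. -/
theorem nrec_congr {b : 𝓜.Num} {z z' : 𝓜.Obj (Ty.nat ➝ Ty.nat ➝ Ty.nat)}
    (h : ∀ p m, 𝓜.app (𝓜.app z p) m = 𝓜.app (𝓜.app z' p) m) (n : 𝓜.Num) :
    nrec b z n = nrec b z' n := by
  refine induction_of_sat (P := fun n => nrec b z n = nrec b z' n)
    (recApp [Ty.nat] Var.z v0 (fun | _, Var.z => v1) (fun | _, Var.z => v2) =ₙ
      recApp [Ty.nat] Var.z v0 (fun | _, Var.z => v1) (fun | _, Var.z => v3))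
    (cons b (cons z (cons z' 𝓜.nil))) (fun n => Iff.rfl) ?_ (fun n ih => ?_) n
  · rw [nrec_zero, nrec_zero]
  · rw [nrec_succ, nrec_succ, ih, h]

omit [ArithModel 𝓜] in
theorem eval_natRec (n b : Tm E Γ Ty.nat) (s : Tm E (Ty.nat :: Ty.nat :: Γ) Ty.nat)
    (θ : 𝓜.Env Γ) :
    𝓜.eval (natRec n b s) θ = nrec (𝓜.eval b θ) (𝓜.eval s.lam.lam θ) (𝓜.eval n θ) := rfl

theorem eval_natRec_zero {n b : Tm E Γ Ty.nat} {s : Tm E (Ty.nat :: Ty.nat :: Γ) Ty.nat}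
    {θ : 𝓜.Env Γ} (hn : 𝓜.eval n θ = 0) : 𝓜.eval (natRec n b s) θ = 𝓜.eval b θ := by
  rw [eval_natRec, hn, nrec_zero]

/-- The step functional is an abstraction evaluated in the environment, which may itself contain the
recursion argument. Passing to the predecessor environment θ' can therefore change it as an object,
and agreement is required only pointwise. -/
theorem eval_natRec_succ {n b : Tm E Γ Ty.nat} {s : Tm E (Ty.nat :: Ty.nat :: Γ) Ty.nat}
    {θ : 𝓜.Env Γ} (θ' : 𝓜.Env Γ) (hn : 𝓜.eval n θ = 𝓜.succ (𝓜.eval n θ'))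
    (hb : 𝓜.eval b θ' = 𝓜.eval b θ)
    (hs : ∀ p m, 𝓜.eval s (cons m (cons p θ')) = 𝓜.eval s (cons m (cons p θ))) :
    𝓜.eval (natRec n b s) θ =
      𝓜.eval s (cons (𝓜.eval n θ') (cons (𝓜.eval (natRec n b s) θ') θ)) := by
  rw [eval_natRec, eval_natRec, hn, nrec_succ, hb, app_eval_lam, app_eval_lam]
  rw [nrec_congr (z := 𝓜.eval s.lam.lam θ') (z' := 𝓜.eval s.lam.lam θ)]
  intro p m
  rw [app_eval_lam, app_eval_lam, app_eval_lam, app_eval_lam, hs]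

/-! ### The semiring of natural numbers -/

theorem add_zero_aux (a : 𝓜.Num) : a + 0 = a := by
  change 𝓜.app (𝓜.app (𝓜.eval cAdd 𝓜.nil) a) 0 = a
  rw [cAdd, app_eval_lam, app_eval_lam, eval_natRec_zero] <;> simp

theorem add_succ (a b : 𝓜.Num) : a + 𝓜.succ b = 𝓜.succ (a + b) := by
  change 𝓜.app (𝓜.app (𝓜.eval cAdd 𝓜.nil) a) (𝓜.succ b) =
    𝓜.succ (𝓜.app (𝓜.app (𝓜.eval cAdd 𝓜.nil) a) b)
  simp only [cAdd, app_eval_lam]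
  exact eval_natRec_succ (cons b (cons a 𝓜.nil)) rfl rfl fun p m => rfl

theorem mul_zero_aux (a : 𝓜.Num) : a * 0 = 0 := by
  change 𝓜.app (𝓜.app (𝓜.eval cMul 𝓜.nil) a) 0 = 0
  rw [cMul, app_eval_lam, app_eval_lam, eval_natRec_zero] <;> simp

theorem mul_succ (a b : 𝓜.Num) : a * 𝓜.succ b = a * b + a := by
  change 𝓜.app (𝓜.app (𝓜.eval cMul 𝓜.nil) a) (𝓜.succ b) =
    𝓜.app (𝓜.app (𝓜.eval cMul 𝓜.nil) a) b + a
  simp only [cMul, app_eval_lam]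
  rw [eval_natRec_succ (θ := cons (𝓜.succ b) (cons a 𝓜.nil)) (cons b (cons a 𝓜.nil)) rfl rfl
    (fun p m => by simp)]
  simp

theorem succ_eq (a : 𝓜.Num) : 𝓜.succ a = a + 1 := by
  change _ = a + 𝓜.succ 0
  rw [add_succ, add_zero_aux]

/-- Internal induction with `n + 1` for the successor. -/
@[elab_as_elim]
theorem num_induction {P : 𝓜.Num → Prop} (A : Fm E (Ty.nat :: Γ)) (θ : 𝓜.Env Γ)
    (hA : ∀ n, 𝓜.sat A (cons n θ) ↔ P n) (h0 : P 0) (hs : ∀ n, P n → P (n + 1)) (n : 𝓜.Num) :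
    P n :=
  induction_of_sat A θ hA h0 (fun n hn => succ_eq n ▸ hs n hn) n

theorem add_assoc_aux (a b c : 𝓜.Num) : a + b + c = a + (b + c) := by
  refine induction_of_sat (nAdd (nAdd v1 v2) v0 =ₙ nAdd v1 (nAdd v2 v0))
    (cons a (cons b 𝓜.nil)) (fun n => by simp) ?_ (fun n ih => ?_) c
  · simp only [add_zero_aux]
  · simp only [add_succ, ih]

theorem zero_add_aux (a : 𝓜.Num) : 0 + a = a := by
  refine induction_of_sat (nAdd tZero v0 =ₙ v0) 𝓜.nil (fun n => by simp) ?_ (fun n ih => ?_) a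
  · rw [add_zero_aux]
  · rw [add_succ, ih]

theorem succ_add (a b : 𝓜.Num) : 𝓜.succ a + b = 𝓜.succ (a + b) := by
  refine induction_of_sat (nAdd (tSucc v1) v0 =ₙ tSucc (nAdd v1 v0))
    (cons a 𝓜.nil) (fun n => by simp [eval_tSucc]) ?_ (fun n ih => ?_) b
  · simp only [add_zero_aux]
  · simp only [add_succ, ih]

theorem add_comm_aux (a b : 𝓜.Num) : a + b = b + a := by
  refine induction_of_sat (nAdd v1 v0 =ₙ nAdd v0 v1)
    (cons a 𝓜.nil) (fun n => by simp) ?_ (fun n ih => ?_) b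
  · simp only [add_zero_aux, zero_add_aux]
  · simp only [add_succ, succ_add, ih]

instance : AddCommMonoid 𝓜.Num where
  add_assoc := add_assoc_aux
  zero_add := zero_add_aux
  add_zero := add_zero_aux
  add_comm := add_comm_aux
  nsmul := nsmulRec

theorem add_right_cancel_aux (a b c : 𝓜.Num) (h : a + c = b + c) : a = b := by
  revert h
  refine induction_of_sat (nAdd v1 v0 =ₙ nAdd v2 v0 ⇨' v1 =ₙ v2)
    (cons a (cons b 𝓜.nil)) (fun n => by simp) ?_ (fun n ih h => ?_) c
  · simp
  · rw [add_succ, add_succ] at h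
    exact ih (ArithModel.succ_inj _ _ h)

instance : IsCancelAdd 𝓜.Num where
  add_left_cancel a b c h := add_right_cancel_aux _ _ a (by rw [add_comm b, add_comm c]; exact h)
  add_right_cancel a b c h := add_right_cancel_aux _ _ a h

theorem mul_add_aux (a b c : 𝓜.Num) : a * (b + c) = a * b + a * c := by
  refine induction_of_sat (nMul v1 (nAdd v2 v0) =ₙ nAdd (nMul v1 v2) (nMul v1 v0))
    (cons a (cons b 𝓜.nil)) (fun n => by simp) ?_ (fun n ih => ?_) c
  · rw [mul_zero_aux, add_zero, add_zero]
  · rw [add_succ, mul_succ, mul_succ, ih, add_assoc]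

theorem zero_mul_aux (a : 𝓜.Num) : 0 * a = 0 := by
  refine induction_of_sat (nMul tZero v0 =ₙ tZero) 𝓜.nil (fun n => by simp) ?_
    (fun n ih => ?_) a
  · rw [mul_zero_aux]
  · rw [mul_succ, ih, add_zero]

theorem succ_mul (a b : 𝓜.Num) : 𝓜.succ a * b = a * b + b := by
  refine induction_of_sat (nMul (tSucc v1) v0 =ₙ nAdd (nMul v1 v0) v0)
    (cons a 𝓜.nil) (fun n => by simp [eval_tSucc]) ?_ (fun n ih => ?_) b
  · simp only [mul_zero_aux, add_zero]
  · rw [mul_succ, mul_succ, ih, succ_eq, succ_eq]; abel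

theorem mul_comm_aux (a b : 𝓜.Num) : a * b = b * a := by
  refine induction_of_sat (nMul v1 v0 =ₙ nMul v0 v1)
    (cons a 𝓜.nil) (fun n => by simp) ?_ (fun n ih => ?_) b
  · rw [mul_zero_aux, zero_mul_aux]
  · rw [mul_succ, succ_mul, ih]

theorem mul_assoc_aux (a b c : 𝓜.Num) : a * b * c = a * (b * c) := by
  refine induction_of_sat (nMul (nMul v1 v2) v0 =ₙ nMul v1 (nMul v2 v0))
    (cons a (cons b 𝓜.nil)) (fun n => by simp) ?_ (fun n ih => ?_) c
  · simp only [mul_zero_aux]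
  · rw [mul_succ, mul_succ, ih, mul_add_aux]

theorem mul_one_aux (a : 𝓜.Num) : a * 1 = a := by
  change a * 𝓜.succ 0 = a
  rw [mul_succ, mul_zero_aux, zero_add]

instance : CommSemiring 𝓜.Num where
  mul_assoc := mul_assoc_aux
  one_mul a := (mul_comm_aux _ _).trans (mul_one_aux a)
  mul_one := mul_one_aux
  left_distrib := mul_add_aux
  right_distrib a b c := by rw [mul_comm_aux, mul_add_aux, mul_comm_aux c, mul_comm_aux c]
  zero_mul := zero_mul_aux
  mul_zero := mul_zero_aux
  mul_comm := mul_comm_aux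

theorem add_one_ne_zero (a : 𝓜.Num) : a + 1 ≠ 0 := succ_eq a ▸ ArithModel.succ_ne_zero a

instance : Nontrivial 𝓜.Num := 
  ⟨1, 0, fun h => add_one_ne_zero (0 : 𝓜.Num) (by rw [zero_add, h])⟩

theorem eq_zero_or_eq_add_one (a : 𝓜.Num) : a = 0 ∨ ∃ b, a = b + 1 := by
  refine num_induction (v0 =ₙ tZero ⋎ .ex Ty.nat (v1 =ₙ tSucc v0)) 𝓜.nil
    (fun n => by simp [eval_tSucc, succ_eq, - eval_app]) (Or.inl rfl)
    (fun n _ => Or.inr ⟨n, rfl⟩) a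

theorem eq_zero_of_add_eq_zero {a b : 𝓜.Num} (h : a + b = 0) : a = 0 := by
  rcases eq_zero_or_eq_add_one b with rfl | ⟨b, rfl⟩
  · simpa using h
  · exact absurd h (add_assoc a b 1 ▸ add_one_ne_zero _)

instance : NoZeroDivisors 𝓜.Num where
  eq_zero_or_eq_zero_of_mul_eq_zero {a b} h := by
    rcases eq_zero_or_eq_add_one b with rfl | ⟨b, rfl⟩
    · exact Or.inr rfl
    · rw [mul_add, mul_one, add_comm] at h
      exact Or.inl (eq_zero_of_add_eq_zero h)

theorem exists_add_eq (a b : 𝓜.Num) : (∃ c, a + c = b) ∨ ∃ c, b + c = a := by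
  refine num_induction (.ex Ty.nat (nAdd v2 v0 =ₙ v1) ⋎ .ex Ty.nat (nAdd v1 v0 =ₙ v2))
    (cons a 𝓜.nil) (fun n => by simp) ?_ (fun n ih => ?_) b
  · exact Or.inr ⟨a, zero_add a⟩
  · rcases ih with ⟨c, rfl⟩ | ⟨c, rfl⟩
    · exact Or.inl ⟨c + 1, by ring⟩
    · rcases eq_zero_or_eq_add_one c with rfl | ⟨c, rfl⟩
      · exact Or.inl ⟨1, by ring⟩
      · exact Or.inr ⟨c, by ring⟩

end PreModel
end Arithmetic
/-! ## The ordered field of fractions of an ordered semiring -/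

/-- Semirings with the algebraic properties of the natural numbers. -/
class NatLike (N : Type) [CommSemiring N] : Prop extends IsCancelAdd N, NoZeroDivisors N,
    Nontrivial N where
  exists_add_eq : ∀ a b : N, (∃ c, a + c = b) ∨ ∃ c, b + c = a
  eq_zero_of_add_eq_zero : ∀ a b : N, a + b = 0 → a = 0
  eq_zero_or_eq_add_one : ∀ a : N, a = 0 ∨ ∃ b, a = b + 1

section Fractions

variable (N : Type) [CommSemiring N] [NatLike N]

/-- Equality of differences. -/
def diffSetoid : Setoid (N × N) where
  r p q := p.1 + q.2 = q.1 + p.2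
  iseqv :=
    { refl := fun _ => rfl
      symm := fun h => h.symm
      trans := fun {p q r} h h' => by
        have : p.1 + r.2 + q.2 = r.1 + p.2 + q.2 := by linear_combination h + h'
        exact add_right_cancel this }

/-- The ring of differences. -/
def Diff : Type := Quotient (diffSetoid N)

variable {N}

/-! ### The ring of differences -/

namespace Diff

def mk (a b : N) : Diff N := Quotient.mk (diffSetoid N) (a, b)

theorem mk_eq_mk {a b c d : N} : mk a b = mk c d ↔ a + d = c + b :=
  Quotient.eq (r := diffSetoid N)

theorem ind {P : Diff N → Prop} (h : ∀ a b, P (mk a b)) (x : Diff N) : P x :=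
  Quotient.inductionOn x fun p => h p.1 p.2

instance : Add (Diff N) := ⟨Quotient.map₂ (fun p q => (p.1 + q.1, p.2 + q.2))
  fun p p' (h : _ = _) q q' (h' : _ = _) => by
    change p.1 + q.1 + (p'.2 + q'.2) = p'.1 + q'.1 + (p.2 + q.2)
    linear_combination h + h'⟩

instance : Mul (Diff N) := ⟨Quotient.map₂
  (fun p q => (p.1 * q.1 + p.2 * q.2, p.1 * q.2 + p.2 * q.1))
  fun p p' (h : _ = _) q q' (h' : _ = _) => by
    change p.1 * q.1 + p.2 * q.2 + (p'.1 * q'.2 + p'.2 * q'.1) =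
      p'.1 * q'.1 + p'.2 * q'.2 + (p.1 * q.2 + p.2 * q.1)
    grind⟩

instance : Neg (Diff N) := ⟨Quotient.map (fun p => (p.2, p.1))
  fun p p' (h : _ = _) => by
    change p.2 + p'.1 = p'.2 + p.1
    linear_combination h.symm⟩

instance : Zero (Diff N) := ⟨mk 0 0⟩
instance : One (Diff N) := ⟨mk 1 0⟩

theorem mk_add (a b c d : N) : mk a b + mk c d = mk (a + c) (b + d) := rfl
theorem mk_mul (a b c d : N) : mk a b * mk c d = mk (a * c + b * d) (a * d + b * c) := rfl
theorem neg_mk (a b : N) : -mk a b = mk b a := rfl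
theorem zero_def : (0 : Diff N) = mk 0 0 := rfl
theorem one_def : (1 : Diff N) = mk 1 0 := rfl

instance : CommRing (Diff N) where
  add_assoc x y z := by
    induction x using ind; induction y using ind; induction z using ind
    simp only [mk_add, mk_eq_mk]; ring
  zero_add x := by induction x using ind; simp only [zero_def, mk_add, mk_eq_mk]; ring
  add_zero x := by induction x using ind; simp only [zero_def, mk_add, mk_eq_mk]; ring
  add_comm x y := by
    induction x using ind; induction y using ind
    simp only [mk_add, mk_eq_mk]; ring
  neg_add_cancel x := by
    induction x using ind; simp only [zero_def, neg_mk, mk_add, mk_eq_mk]; ring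
  mul_assoc x y z := by
    induction x using ind; induction y using ind; induction z using ind
    simp only [mk_mul, mk_eq_mk]; ring
  one_mul x := by induction x using ind; simp only [one_def, mk_mul, mk_eq_mk]; ring
  mul_one x := by induction x using ind; simp only [one_def, mk_mul, mk_eq_mk]; ring
  mul_comm x y := by
    induction x using ind; induction y using ind
    simp only [mk_mul, mk_eq_mk]; ring
  left_distrib x y z := by
    induction x using ind; induction y using ind; induction z using ind
    simp only [mk_mul, mk_add, mk_eq_mk]; ring
  right_distrib x y z := by
    induction x using ind; induction y using ind; induction z using ind
    simp only [mk_mul, mk_add, mk_eq_mk]; ring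
  zero_mul x := by induction x using ind; simp only [zero_def, mk_mul, mk_eq_mk]; ring
  mul_zero x := by induction x using ind; simp only [zero_def, mk_mul, mk_eq_mk]; ring
  nsmul := nsmulRec
  zsmul := zsmulRec

/-- The embedding of the semiring into its ring of differences. -/
def of : N →+* Diff N where
  toFun a := mk a 0
  map_zero' := rfl
  map_one' := rfl
  map_add' a b := by simp only [mk_add, mk_eq_mk]; ring
  map_mul' a b := by simp only [mk_mul, mk_eq_mk]; ring

theorem of_injective : Function.Injective (of (N := N)) := fun a b h => by
  simpa using mk_eq_mk.1 h

/-- Comparability in the semiring gives every difference a sign; absence of zero divisors then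
reduces to the semiring. -/
theorem eq_of_or (x : Diff N) : ∃ a, x = of a ∨ x = -of a := by
  induction x using ind with
  | h a b =>
    rcases NatLike.exists_add_eq a b with ⟨c, rfl⟩ | ⟨c, rfl⟩
    · refine ⟨c, Or.inr (mk_eq_mk.2 ?_)⟩
      ring
    · refine ⟨c, Or.inl (mk_eq_mk.2 ?_)⟩
      ring

instance : Nontrivial (Diff N) := of_injective.nontrivial

instance : NoZeroDivisors (Diff N) where
  eq_zero_or_eq_zero_of_mul_eq_zero {x y} h := by
    obtain ⟨a, ha⟩ := eq_of_or x
    obtain ⟨b, hb⟩ := eq_of_or y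
    have hab : of (a * b) = 0 := by
      rw [map_mul]
      rcases ha with rfl | rfl <;> rcases hb with rfl | rfl <;> simpa using h
    rcases mul_eq_zero.1 (of_injective (hab.trans (map_zero of).symm)) with rfl | rfl
    · left; rcases ha with rfl | rfl <;> simp
    · right; rcases hb with rfl | rfl <;> simp

instance : IsDomain (Diff N) := NoZeroDivisors.to_isDomain _

end Diff

variable (N) in
/-- The field of fractions. -/
abbrev Frac : Type := FractionRing (Diff N)

/-! ### The ordered field of fractions -/

namespace Frac

/-- The embedding of the semiring into its field of fractions. -/
noncomputable def of : N →+* Frac N := (algebraMap (Diff N) (Frac N)).comp Diff.of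

theorem of_injective : Function.Injective (of (N := N)) :=
  (IsFractionRing.injective (Diff N) (Frac N)).comp Diff.of_injective

theorem of_ne_zero {a : N} (h : a ≠ 0) : of a ≠ 0 := fun h' =>
  h (of_injective (h'.trans (map_zero of).symm))

/-- The nonnegative elements of the field of fractions. -/
noncomputable def cone : RingCone (Frac N) where
  carrier := {x | ∃ a b : N, b ≠ 0 ∧ x * of b = of a}
  zero_mem' := ⟨0, 1, one_ne_zero, by simp⟩
  one_mem' := ⟨1, 1, one_ne_zero, by simp⟩
  add_mem' := by
    rintro x y ⟨a, b, hb, h⟩ ⟨c, d, hd, h'⟩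
    refine ⟨a * d + c * b, b * d, mul_ne_zero hb hd, ?_⟩
    simp only [map_mul, map_add]
    linear_combination of d * h + of b * h'
  mul_mem' := by
    rintro x y ⟨a, b, hb, h⟩ ⟨c, d, hd, h'⟩
    refine ⟨a * c, b * d, mul_ne_zero hb hd, ?_⟩
    simp only [map_mul]
    rw [← h, ← h']; ring
  eq_zero_of_mem_of_neg_mem' := by
    rintro x ⟨a, b, hb, h⟩ ⟨c, d, hd, h'⟩
    have h0 : of (a * d + c * b) = 0 := by
      simp only [map_mul, map_add]
      rw [← h, ← h']; ring
    have h1 : a * d + c * b = 0 := of_injective (h0.trans (map_zero of).symm)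
    have h2 := (mul_eq_zero.1 (NatLike.eq_zero_of_add_eq_zero _ _ h1)).resolve_right hd
    rw [h2, map_zero] at h
    exact (mul_eq_zero.1 h).resolve_right (of_ne_zero hb)

instance : HasMemOrNegMem (cone (N := N)) where
  mem_or_neg_mem x := by
    obtain ⟨y, z, hz, rfl⟩ := IsFractionRing.div_surjective (A := Diff N) x
    obtain ⟨a, ha⟩ := Diff.eq_of_or y
    obtain ⟨b, hb⟩ := Diff.eq_of_or z
    have hz0 : algebraMap (Diff N) (Frac N) z ≠ 0 := by
      simpa using nonZeroDivisors.ne_zero hz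
    have hb0 : b ≠ 0 := by
      rintro rfl
      exact nonZeroDivisors.ne_zero hz (by rcases hb with h | h <;> simpa using h)
    set f := algebraMap (Diff N) (Frac N)
    have key : f y / f z * of b = of a ∨ -(f y / f z) * of b = of a := by
      have hofa : of a = f (Diff.of a) := rfl
      have hofb : of b = f (Diff.of b) := rfl
      rw [hofa, hofb]
      rcases ha with rfl | rfl <;> rcases hb with rfl | rfl <;>
        try simp only [map_neg, ne_eq, neg_eq_zero] at hz0 ⊢
      · left; field_simp
      · right; field_simp
      · right; field_simp
      · left; field_simp
    rcases key with h | h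
    · exact Or.inl ⟨a, b, hb0, h⟩
    · exact Or.inr ⟨a, b, hb0, h⟩

open Classical in
variable (N) in
/-- The order of the field of fractions. -/
noncomputable def linearOrder : LinearOrder (Frac N) := .mkOfAddGroupCone cone

noncomputable instance : LinearOrder (Frac N) := linearOrder N

instance : IsOrderedRing (Frac N) := by
  have := IsOrderedRing.mkOfCone (cone (N := N))
  exact this

instance : IsStrictOrderedRing (Frac N) := inferInstance

theorem of_nonneg (a : N) : 0 ≤ of a := by
  have : (of a - 0) ∈ cone (N := N) := ⟨a, 1, one_ne_zero, by simp⟩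
  exact this

theorem of_le_of {a b : N} : of a ≤ of b ↔ ∃ c, a + c = b := by
  constructor
  · intro h
    rcases NatLike.exists_add_eq a b with h' | ⟨c, rfl⟩
    · exact h'
    · rw [map_add] at h
      have h1 : of c = 0 := le_antisymm (by linarith) (of_nonneg c)
      refine ⟨0, ?_⟩
      rw [of_injective (h1.trans (map_zero of).symm)]; simp
  · rintro ⟨c, rfl⟩
    rw [map_add]
    linarith [of_nonneg c]

/-- A nonnegative a/b is at most a, because a nonzero b is at least 1. This is the Archimedean
property relative to internal numbers, which may be nonstandard. -/
theorem exists_lt_of (x : Frac N) : ∃ a : N, x < of a := by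
  rcases lt_or_ge x 0 with h | h
  · exact ⟨0, by simpa using h⟩
  · have hx : x - 0 ∈ cone (N := N) := h
    obtain ⟨a, b, hb, h'⟩ := hx
    refine ⟨a + 1, ?_⟩
    have hb1 : (1 : Frac N) ≤ of b := by
      obtain ⟨c, rfl⟩ := (NatLike.eq_zero_or_eq_add_one b).resolve_left hb
      rw [map_add, map_one]
      linarith [of_nonneg c]
    rw [map_add, map_one, ← h', sub_zero]
    nlinarith

end Frac

end Fractions

instance {E : Ty → Type} {𝓜 : PreModel E} [ArithModel 𝓜] : NatLike 𝓜.Num where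
  exists_add_eq := PreModel.exists_add_eq
  eq_zero_of_add_eq_zero _ _ := PreModel.eq_zero_of_add_eq_zero
  eq_zero_or_eq_add_one := PreModel.eq_zero_or_eq_add_one

/-! ## Primitive recursive functions and rational numbers in a model -/

namespace PreModel

variable {E : Ty → Type} {𝓜 : PreModel E} {Γ : Ctx} {σ τ : Ty}

/-- Application of a closed unary function. -/
def fn₁ (c : Tm E [] (Ty.nat ➝ τ)) (a : 𝓜.Num) : 𝓜.Obj τ := 𝓜.app (𝓜.eval c 𝓜.nil) a

/-- Application of a closed binary function. -/
def fn₂ (c : Tm E [] (Ty.nat ➝ Ty.nat ➝ τ)) (a b : 𝓜.Num) : 𝓜.Obj τ := 𝓜.app (fn₁ c a) b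

/-- Application of a closed ternary function. -/
def fn₃ (c : Tm E [] (Ty.nat ➝ Ty.nat ➝ Ty.nat ➝ τ)) (a b d : 𝓜.Num) : 𝓜.Obj τ :=
  𝓜.app (fn₂ c a b) d

@[simp] theorem eval_nPred (s : Tm E Γ Ty.nat) (θ : 𝓜.Env Γ) :
    𝓜.eval (nPred s) θ = fn₁ cPred (𝓜.eval s θ) := by
  simp only [nPred, eval_app, eval_cl]; rfl

@[simp] theorem eval_nSub (s t : Tm E Γ Ty.nat) (θ : 𝓜.Env Γ) :
    𝓜.eval (nSub s t) θ = fn₂ cSub (𝓜.eval s θ) (𝓜.eval t θ) := by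
  simp only [nSub, eval_app, eval_cl]; rfl

@[simp] theorem eval_nCond (s t u : Tm E Γ Ty.nat) (θ : 𝓜.Env Γ) :
    𝓜.eval (nCond s t u) θ = fn₃ cCond (𝓜.eval s θ) (𝓜.eval t θ) (𝓜.eval u θ) := by
  simp only [nCond, eval_app, eval_cl]; rfl

@[simp] theorem eval_nPow2 (s : Tm E Γ Ty.nat) (θ : 𝓜.Env Γ) :
    𝓜.eval (nPow2 s) θ = fn₁ cPow2 (𝓜.eval s θ) := by
  simp only [nPow2, eval_app, eval_cl]; rfl

@[simp] theorem eval_nOdd (s : Tm E Γ Ty.nat) (θ : 𝓜.Env Γ) :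
    𝓜.eval (nOdd s) θ = fn₁ cOdd (𝓜.eval s θ) := by
  simp only [nOdd, eval_app, eval_cl]; rfl

@[simp] theorem eval_nHalf (s : Tm E Γ Ty.nat) (θ : 𝓜.Env Γ) :
    𝓜.eval (nHalf s) θ = fn₁ cHalf (𝓜.eval s θ) := by
  simp only [nHalf, eval_app, eval_cl]; rfl

@[simp] theorem eval_nPair (s t : Tm E Γ Ty.nat) (θ : 𝓜.Env Γ) :
    𝓜.eval (nPair s t) θ = fn₂ cPair (𝓜.eval s θ) (𝓜.eval t θ) := by
  simp only [nPair, eval_app, eval_cl]; rfl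

@[simp] theorem eval_nFst (s : Tm E Γ Ty.nat) (θ : 𝓜.Env Γ) :
    𝓜.eval (nFst s) θ = fn₁ cFst (𝓜.eval s θ) := by
  simp only [nFst, eval_app, eval_cl]; rfl

@[simp] theorem eval_nSnd (s : Tm E Γ Ty.nat) (θ : 𝓜.Env Γ) :
    𝓜.eval (nSnd s) θ = fn₁ cSnd (𝓜.eval s θ) := by
  simp only [nSnd, eval_app, eval_cl]; rfl

@[simp] theorem eval_qPos (s : Tm E Γ Ty.nat) (θ : 𝓜.Env Γ) :
    𝓜.eval (qPos s) θ = fn₁ cPos (𝓜.eval s θ) := by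
  simp only [qPos, eval_app, eval_cl]; rfl

@[simp] theorem eval_qNegPart (s : Tm E Γ Ty.nat) (θ : 𝓜.Env Γ) :
    𝓜.eval (qNegPart s) θ = fn₁ cNeg (𝓜.eval s θ) := by
  simp only [qNegPart, eval_app, eval_cl]; rfl

@[simp] theorem eval_qMk (s t u : Tm E Γ Ty.nat) (θ : 𝓜.Env Γ) :
    𝓜.eval (qMk s t u) θ = fn₃ cMk (𝓜.eval s θ) (𝓜.eval t θ) (𝓜.eval u θ) := by
  simp only [qMk, eval_app, eval_cl]; rfl

@[simp] theorem eval_qAdd (s t : Tm E Γ Ty.nat) (θ : 𝓜.Env Γ) :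
    𝓜.eval (qAdd s t) θ = fn₂ cQAdd (𝓜.eval s θ) (𝓜.eval t θ) := by
  simp only [qAdd, eval_app, eval_cl]; rfl

@[simp] theorem eval_qNeg (s : Tm E Γ Ty.nat) (θ : 𝓜.Env Γ) :
    𝓜.eval (qNeg s) θ = fn₁ cQNeg (𝓜.eval s θ) := by
  simp only [qNeg, eval_app, eval_cl]; rfl

@[simp] theorem eval_qMul (s t : Tm E Γ Ty.nat) (θ : 𝓜.Env Γ) :
    𝓜.eval (qMul s t) θ = fn₂ cQMul (𝓜.eval s θ) (𝓜.eval t θ) := by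
  simp only [qMul, eval_app, eval_cl]; rfl

@[simp] theorem eval_qAbs (s : Tm E Γ Ty.nat) (θ : 𝓜.Env Γ) :
    𝓜.eval (qAbs s) θ = fn₁ cQAbs (𝓜.eval s θ) := by
  simp only [qAbs, eval_app, eval_cl]; rfl

@[simp] theorem eval_qInv (s : Tm E Γ Ty.nat) (θ : 𝓜.Env Γ) :
    𝓜.eval (qInv s) θ = fn₁ cQInv (𝓜.eval s θ) := by
  simp only [qInv, eval_app, eval_cl]; rfl

@[simp] theorem eval_qLe (s t : Tm E Γ Ty.nat) (θ : 𝓜.Env Γ) :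
    𝓜.eval (qLe s t) θ = fn₂ cQLe (𝓜.eval s θ) (𝓜.eval t θ) := by
  simp only [qLe, eval_app, eval_cl]; rfl

@[simp] theorem eval_qLt (s t : Tm E Γ Ty.nat) (θ : 𝓜.Env Γ) :
    𝓜.eval (qLt s t) θ = fn₂ cQLt (𝓜.eval s θ) (𝓜.eval t θ) := by
  simp only [qLt, eval_app, eval_cl]; rfl

@[simp] theorem eval_qPow (s : Tm E Γ Ty.nat) (θ : 𝓜.Env Γ) :
    𝓜.eval (qPow s) θ = fn₁ cQPow (𝓜.eval s θ) := by
  simp only [qPow, eval_app, eval_cl]; rfl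

@[simp] theorem eval_nDist (s t : Tm E Γ Ty.nat) (θ : 𝓜.Env Γ) : 𝓜.eval (nDist s t) θ =
    fn₂ cSub (𝓜.eval s θ) (𝓜.eval t θ) + fn₂ cSub (𝓜.eval t θ) (𝓜.eval s θ) := by
  simp [nDist]

variable [ArithModel 𝓜]

@[simp] theorem eval_succ_app (t : Tm E Γ Ty.nat) (θ : 𝓜.Env Γ) :
    𝓜.eval (tSucc t) θ = 𝓜.eval t θ + 1 := succ_eq _

@[simp] theorem eval_qDen (s : Tm E Γ Ty.nat) (θ : 𝓜.Env Γ) :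
    𝓜.eval (qDen s) θ = fn₁ cSnd (𝓜.eval s θ) + 1 := by
  simp [qDen]

@[simp] theorem eval_numeral (n : ℕ) (θ : 𝓜.Env Γ) :
    𝓜.eval (numeral n) θ = (n : 𝓜.Num) := by
  induction n with
  | zero => simp [numeral]
  | succ n ih => rw [numeral, eval_succ_app, ih, Nat.cast_succ]

theorem eval_natRec_add_one {n b : Tm E Γ Ty.nat} {s : Tm E (Ty.nat :: Ty.nat :: Γ) Ty.nat}
    {θ : 𝓜.Env Γ} (θ' : 𝓜.Env Γ) (hn : 𝓜.eval n θ = 𝓜.eval n θ' + 1)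
    (hb : 𝓜.eval b θ' = 𝓜.eval b θ)
    (hs : ∀ p m, 𝓜.eval s (cons m (cons p θ')) = 𝓜.eval s (cons m (cons p θ))) :
    𝓜.eval (natRec n b s) θ =
      𝓜.eval s (cons (𝓜.eval n θ') (cons (𝓜.eval (natRec n b s) θ') θ)) :=
  eval_natRec_succ θ' (hn.trans (succ_eq _).symm) hb hs

theorem fn₁_lam (t : Tm E [Ty.nat] τ) (a : 𝓜.Num) :
    fn₁ t.lam a = 𝓜.eval t (cons a 𝓜.nil) := app_eval_lam _ _ _

theorem fn₂_lam (t : Tm E [Ty.nat, Ty.nat] τ) (a b : 𝓜.Num) :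
    fn₂ t.lam.lam a b = 𝓜.eval t (cons b (cons a 𝓜.nil)) := by
  rw [fn₂, fn₁, app_eval_lam, app_eval_lam]

theorem fn₃_lam (t : Tm E [Ty.nat, Ty.nat, Ty.nat] τ) (a b d : 𝓜.Num) :
    fn₃ t.lam.lam.lam a b d = 𝓜.eval t (cons d (cons b (cons a 𝓜.nil))) := by
  rw [fn₃, fn₂, fn₁, app_eval_lam, app_eval_lam, app_eval_lam]

@[simp] theorem pred_zero : fn₁ cPred (0 : 𝓜.Num) = 0 := by
  rw [cPred, fn₁_lam, eval_natRec_zero] <;> simp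

@[simp] theorem pred_add_one (a : 𝓜.Num) : fn₁ cPred (a + 1) = a := by
  rw [cPred, fn₁_lam, eval_natRec_add_one (cons a 𝓜.nil)] <;> simp

@[simp] theorem sub_zero (a : 𝓜.Num) : fn₂ cSub a 0 = a := by
  rw [cSub, fn₂_lam, eval_natRec_zero] <;> simp

theorem sub_add_one (a b : 𝓜.Num) : fn₂ cSub a (b + 1) = fn₁ cPred (fn₂ cSub a b) := by
  rw [cSub, fn₂_lam, fn₂_lam, eval_natRec_add_one (cons b (cons a 𝓜.nil))] <;> simp

theorem add_sub_cancel_left (a b : 𝓜.Num) : fn₂ cSub (b + a) b = a := by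
  revert a
  refine num_induction (.all Ty.nat (nSub (nAdd v1 v0) v1 =ₙ v0)) 𝓜.nil (fun n => by simp) ?_
    (fun n ih a => ?_) b
  · simp
  · rw [sub_add_one, show n + 1 + a = n + (a + 1) by ring, ih, pred_add_one]

theorem sub_add_self (a b : 𝓜.Num) : fn₂ cSub a (a + b) = 0 := by
  refine num_induction (nSub v1 (nAdd v1 v0) =ₙ tZero) (cons a 𝓜.nil) (fun n => by simp) ?_
    (fun n ih => ?_) b
  · simpa using add_sub_cancel_left 0 a
  · rw [← add_assoc, sub_add_one, ih, pred_zero]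

@[simp] theorem cond_zero (a b : 𝓜.Num) : fn₃ cCond 0 a b = a := by
  rw [cCond, fn₃_lam, eval_natRec_zero] <;> simp

@[simp] theorem cond_add_one (n a b : 𝓜.Num) : fn₃ cCond (n + 1) a b = b := by
  rw [cCond, fn₃_lam, eval_natRec_add_one (cons b (cons a (cons n 𝓜.nil)))] <;> simp

theorem cond_of_ne_zero {n : 𝓜.Num} (h : n ≠ 0) (a b : 𝓜.Num) : fn₃ cCond n a b = b := by
  obtain ⟨m, rfl⟩ := (eq_zero_or_eq_add_one n).resolve_left h
  exact cond_add_one _ _ _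

@[simp] theorem pow_zero : fn₁ cPow2 (0 : 𝓜.Num) = 1 := by
  rw [cPow2, fn₁_lam, eval_natRec_zero] <;> simp

theorem pow_add_one (a : 𝓜.Num) : fn₁ cPow2 (a + 1) = fn₁ cPow2 a + fn₁ cPow2 a := by
  rw [cPow2, fn₁_lam, fn₁_lam, eval_natRec_add_one (cons a 𝓜.nil)] <;> simp

@[simp] theorem odd_zero : fn₁ cOdd (0 : 𝓜.Num) = 0 := by
  rw [cOdd, fn₁_lam, eval_natRec_zero] <;> simp

theorem odd_add_one (a : 𝓜.Num) : fn₁ cOdd (a + 1) = fn₂ cSub 1 (fn₁ cOdd a) := by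
  rw [cOdd, fn₁_lam, fn₁_lam, eval_natRec_add_one (cons a 𝓜.nil)] <;> simp

@[simp] theorem half_zero : fn₁ cHalf (0 : 𝓜.Num) = 0 := by
  rw [cHalf, fn₁_lam, eval_natRec_zero] <;> simp

theorem half_add_one (a : 𝓜.Num) : fn₁ cHalf (a + 1) = fn₁ cHalf a + fn₁ cOdd a := by
  rw [cHalf, fn₁_lam, fn₁_lam, eval_natRec_add_one (cons a 𝓜.nil)] <;> simp

@[simp] theorem odd_two_mul (a : 𝓜.Num) : fn₁ cOdd (2 * a) = 0 := by
  refine num_induction (nOdd (nMul (numeral 2) v0) =ₙ tZero) 𝓜.nil (fun n => by simp) ?_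
    (fun n ih => ?_) a
  · simp
  · rw [show 2 * (n + 1) = 2 * n + 1 + 1 by ring, odd_add_one, odd_add_one, ih, sub_zero]
    simpa using add_sub_cancel_left (0 : 𝓜.Num) 1

@[simp] theorem odd_two_mul_add_one (a : 𝓜.Num) : fn₁ cOdd (2 * a + 1) = 1 := by
  rw [odd_add_one, odd_two_mul, sub_zero]

@[simp] theorem half_two_mul (a : 𝓜.Num) : fn₁ cHalf (2 * a) = a := by
  refine num_induction (nHalf (nMul (numeral 2) v0) =ₙ v0) 𝓜.nil (fun n => by simp) ?_
    (fun n ih => ?_) a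
  · simp
  · rw [show 2 * (n + 1) = 2 * n + 1 + 1 by ring, half_add_one, half_add_one, ih,
      odd_two_mul_add_one, odd_two_mul, add_zero]

/-! ### Bounded search and pairing -/

/-- Bounded search. -/
def search (f : 𝓜.Obj Ty.real) (n : 𝓜.Num) : 𝓜.Num := 𝓜.app (𝓜.app (𝓜.eval cMin 𝓜.nil) f) n

omit [ArithModel 𝓜] in
@[simp] theorem eval_nMin (f : Tm E (Ty.nat :: Γ) Ty.nat) (n : Tm E Γ Ty.nat) (θ : 𝓜.Env Γ) :
    𝓜.eval (nMin f n) θ = search (𝓜.eval f.lam θ) (𝓜.eval n θ) := by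
  simp only [nMin, eval_app, eval_cl]; rfl

theorem search_add_one (f : 𝓜.Obj Ty.real) (n : 𝓜.Num) :
    search f (n + 1) = fn₃ cCond (𝓜.app f (search f n)) (search f n)
      (fn₃ cCond (𝓜.app f (n + 1)) (n + 1) 0) := by
  simp only [search, cMin, app_eval_lam]
  rw [eval_natRec_add_one (cons n (cons f 𝓜.nil))] <;> simp

theorem search_zero (f : 𝓜.Obj Ty.real) : search f (0 : 𝓜.Num) = 0 := by
  simp only [search, cMin, app_eval_lam]
  rw [eval_natRec_zero] <;> simp

/-- The search keeps the first zero it meets. Only success is recorded here; minimality plays no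
role in inverting the pairing. -/
theorem app_search {f : 𝓜.Obj Ty.real} {n : 𝓜.Num} :
    (∃ u, 𝓜.app f u = 0 ∧ ∃ v, u + v = n) → 𝓜.app f (search f n) = 0 := by
  refine num_induction (.ex Ty.nat (v2 ⬝ v0 =ₙ tZero ⋏ .ex Ty.nat (nAdd v1 v0 =ₙ v2)) ⇨'
    v1 ⬝ (cMin.cl ⬝ v1 ⬝ v0) =ₙ tZero) (cons f 𝓜.nil) (fun n => ?_) ?_ (fun n ih => ?_) n
  · simp; rfl
  · rintro ⟨u, hu, v, hv⟩
    rw [eq_zero_of_add_eq_zero hv] at hu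
    rw [search_zero, hu]
  · rintro ⟨u, hu, v, hv⟩
    rw [search_add_one]
    by_cases h : 𝓜.app f (search f n) = 0
    · rw [h, cond_zero, h]
    · rw [cond_of_ne_zero h]
      rcases eq_zero_or_eq_add_one v with rfl | ⟨v, rfl⟩
      · rw [add_zero] at hv
        rw [← hv, hu, cond_zero, hu]
      · rw [← add_assoc] at hv
        exact absurd (ih ⟨u, hu, v, add_right_cancel hv⟩) h

/-- Makes the pairing polynomial even: (a + b)² + 3a + b = (a + b)(a + b + 1) + 2a. -/
theorem exists_two_mul (k : 𝓜.Num) : ∃ u, k * (k + 1) = 2 * u := by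
  refine num_induction (.ex Ty.nat (nMul v1 (tSucc v1) =ₙ nMul (numeral 2) v0)) 𝓜.nil
    (fun n => by simp) ⟨0, by simp⟩ (fun n ih => ?_) k
  obtain ⟨u, hu⟩ := ih
  exact ⟨u + (n + 1), by linear_combination hu⟩

theorem eq_of_dist_eq_zero {a b : 𝓜.Num} (h : fn₂ cSub a b + fn₂ cSub b a = 0) : a = b := by
  have h1 := eq_zero_of_add_eq_zero h
  rw [add_comm] at h
  have h2 := eq_zero_of_add_eq_zero h
  rcases exists_add_eq a b with ⟨c, rfl⟩ | ⟨c, rfl⟩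
  · rw [add_sub_cancel_left] at h2
    rw [h2, add_zero]
  · rw [add_sub_cancel_left] at h1
    rw [h1, add_zero]

@[simp] theorem dist_self (a : 𝓜.Num) : fn₂ cSub a a + fn₂ cSub a a = 0 := by
  have := sub_add_self a 0
  rw [add_zero] at this
  rw [this, add_zero]

theorem two_mul_pair (a b : 𝓜.Num) :
    2 * fn₂ cPair a b = (a + b) * (a + b) + 3 * a + b := by
  obtain ⟨u, hu⟩ := exists_two_mul (a + b)
  rw [cPair, fn₂_lam]
  simp only [eval_nMin]
  set f := 𝓜.eval (Tm.lam _) (cons b (cons a 𝓜.nil)) with hf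
  have hfx : ∀ x, 𝓜.app f x = fn₂ cSub (2 * x) ((a + b) * (a + b) + 3 * a + b) +
      fn₂ cSub ((a + b) * (a + b) + 3 * a + b) (2 * x) := fun x => by
    rw [hf, app_eval_lam]; simp
  have h : (a + b) * (a + b) + 3 * a + b = 2 * (u + a) := by linear_combination hu
  have := app_search (f := f) (n := 𝓜.eval (nAdd (nAdd (nMul (nAdd v1 v0) (nAdd v1 v0))
    (nMul (numeral 3) v1)) v0) (cons b (cons a 𝓜.nil)))
    ⟨u + a, by rw [hfx, h, dist_self], u + a, by simp; linear_combination h.symm⟩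
  rw [hfx] at this
  exact eq_of_dist_eq_zero this

/-- With s = a + b the polynomial is s(s + 1) + 2a, where a ≤ s. Its values on the diagonal s stop
at s² + 3s, below the first value s² + 3s + 2 of the next diagonal, so s and then a are determined.
-/
theorem pair_injective {a b c d : 𝓜.Num} (h : fn₂ cPair a b = fn₂ cPair c d) : a = c ∧ b = d := by
  have h2 : (a + b) * (a + b) + 3 * a + b = (c + d) * (c + d) + 3 * c + d := by
    rw [← two_mul_pair, ← two_mul_pair, h]
  have key : ∀ a b c d e : 𝓜.Num, (a + b) * (a + b) + 3 * a + b = (c + d) * (c + d) + 3 * c + d →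
      a + b + e = c + d → e = 0 := by
    intro a b c d e h he
    rcases eq_zero_or_eq_add_one e with rfl | ⟨e, rfl⟩
    · rfl
    · exfalso
      rw [← he] at h
      -- The left side is the excess of the second polynomial over the first when the diagonal grows
      -- by e + 1.
      have : (2 * (a + b) * e + e * e + 3 * e + 2 * b + 2 * c + 1) + 1 = (0 : 𝓜.Num) := by
        refine add_right_cancel (b := (a + b) * (a + b) + 3 * a + b) ?_
        linear_combination he + h.symm
      exact add_one_ne_zero _ this
  have hs : a + b = c + d := by
    rcases exists_add_eq (a + b) (c + d) with ⟨e, he⟩ | ⟨e, he⟩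
    · rw [← he, key _ _ _ _ _ h2 he, add_zero]
    · rw [← he, key _ _ _ _ _ h2.symm he, add_zero]
  rw [hs] at h2
  have h3 : 2 * a = 2 * c := by
    have : (c + d) * (c + d) + (c + d) + 2 * a = (c + d) * (c + d) + (c + d) + 2 * c := by
      linear_combination h2 + hs.symm
    exact add_left_cancel this
  have hac : a = c := by rw [← half_two_mul a, h3, half_two_mul]
  exact ⟨hac, by rw [hac] at hs; exact add_left_cancel hs⟩

/-- Bounds that let the bounded searches defining the projections succeed. -/
theorem exists_add_eq_pair (a b : 𝓜.Num) :
    (∃ c, a + c = fn₂ cPair a b) ∧ ∃ c, b + c = fn₂ cPair a b := by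
  have h := two_mul_pair a b
  constructor
  · rcases exists_add_eq a (fn₂ cPair a b) with h' | ⟨c, hc⟩
    · exact h'
    · have h0 : c + (c + (a + b) * (a + b) + a + b) = 0 := by
        refine add_right_cancel (b := 2 * a) ?_
        linear_combination 2 * hc + h.symm
      rw [eq_zero_of_add_eq_zero h0, add_zero] at hc
      exact ⟨0, (add_zero a).trans hc.symm⟩
  · rcases exists_add_eq b (fn₂ cPair a b) with h' | ⟨c, hc⟩
    · exact h'
    · have hc0 : c = 0 := by
        rcases eq_zero_or_eq_add_one b with rfl | ⟨b, rfl⟩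
        · rw [add_comm] at hc
          exact eq_zero_of_add_eq_zero hc
        · refine eq_zero_of_add_eq_zero (b := c + (a + b) * (a + b) + 5 * a + b) ?_
          refine add_right_cancel (b := 2 * (b + 1)) ?_
          linear_combination 2 * hc + h.symm
      rw [hc0, add_zero] at hc
      exact ⟨0, (add_zero b).trans hc.symm⟩

/-- The inner search succeeds at x = a, so the outer one has a zero. Whatever zero it returns is the
first component of a code of z, and injectivity of pairing makes it a. -/
theorem fst_pair (a b : 𝓜.Num) : fn₁ cFst (fn₂ cPair a b) = a := by
  obtain ⟨⟨u, hu⟩, v, hv⟩ := exists_add_eq_pair a b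
  set z := fn₂ cPair a b with hz
  rw [cFst, fn₁_lam]
  simp only [eval_nMin, eval_var_z]
  set f := 𝓜.eval (Tm.lam _) (cons z 𝓜.nil) with hf
  set g := fun x => 𝓜.eval ((nDist (nPair v1 v0) v2 : Tm E [Ty.nat, Ty.nat, Ty.nat] Ty.nat).lam)
    (cons x (cons z 𝓜.nil)) with hg
  have hfx : ∀ x, 𝓜.app f x = fn₂ cSub (fn₂ cPair x (search (g x) z)) z +
      fn₂ cSub z (fn₂ cPair x (search (g x) z)) := fun x => by
    rw [hf, app_eval_lam]; simp [g]
  have hgx : ∀ x y, 𝓜.app (g x) y = fn₂ cSub (fn₂ cPair x y) z + fn₂ cSub z (fn₂ cPair x y) :=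
    fun x y => by simp [g]
  have h1 : 𝓜.app (g a) (search (g a) z) = 0 :=
    app_search ⟨b, by rw [hgx, ← hz, dist_self], v, hv⟩
  rw [hgx] at h1
  have h2 : 𝓜.app f (search f z) = 0 :=
    app_search ⟨a, by rw [hfx, eq_of_dist_eq_zero h1, dist_self], u, hu⟩
  rw [hfx] at h2
  exact (pair_injective ((eq_of_dist_eq_zero h2).trans hz)).1

theorem snd_pair (a b : 𝓜.Num) : fn₁ cSnd (fn₂ cPair a b) = b := by
  obtain ⟨⟨u, hu⟩, v, hv⟩ := exists_add_eq_pair a b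
  set z := fn₂ cPair a b with hz
  rw [cSnd, fn₁_lam]
  simp only [eval_nMin, eval_var_z]
  set f := 𝓜.eval (Tm.lam _) (cons z 𝓜.nil) with hf
  set g := fun x => 𝓜.eval ((nDist (nPair v0 v1) v2 : Tm E [Ty.nat, Ty.nat, Ty.nat] Ty.nat).lam)
    (cons x (cons z 𝓜.nil)) with hg
  have hfx : ∀ x, 𝓜.app f x = fn₂ cSub (fn₂ cPair (search (g x) z) x) z +
      fn₂ cSub z (fn₂ cPair (search (g x) z) x) := fun x => by
    rw [hf, app_eval_lam]; simp [g]
  have hgx : ∀ x y, 𝓜.app (g x) y = fn₂ cSub (fn₂ cPair y x) z + fn₂ cSub z (fn₂ cPair y x) :=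
    fun x y => by simp [g]
  have h1 : 𝓜.app (g b) (search (g b) z) = 0 :=
    app_search ⟨a, by rw [hgx, ← hz, dist_self], u, hu⟩
  rw [hgx] at h1
  have h2 : 𝓜.app f (search f z) = 0 :=
    app_search ⟨b, by rw [hfx, eq_of_dist_eq_zero h1, dist_self], v, hv⟩
  rw [hfx] at h2
  exact (pair_injective ((eq_of_dist_eq_zero h2).trans hz)).2

end PreModel
/-! ## Values of codes of rational numbers -/

namespace PreModel

variable {E : Ty → Type} {𝓜 : PreModel E} [ArithModel 𝓜] {Γ : Ctx} {σ τ : Ty}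

variable (𝓜) in
/-- The ordered field of rational numbers of a model. -/
abbrev Rtl : Type := Frac 𝓜.Num

/-- A natural number as a rational number. -/
noncomputable abbrev toQ : 𝓜.Num →+* 𝓜.Rtl := Frac.of

theorem toQ_sub (a b : 𝓜.Num) : toQ (fn₂ cSub a b) = max (toQ a - toQ b) 0 := by
  rcases exists_add_eq a b with ⟨c, rfl⟩ | ⟨c, rfl⟩
  · rw [sub_add_self, max_eq_right] <;> simp [Frac.of_nonneg]
  · rw [add_sub_cancel_left, max_eq_left] <;> simp [Frac.of_nonneg]

theorem sub_eq_zero_iff (a b : 𝓜.Num) : fn₂ cSub a b = 0 ↔ toQ a ≤ toQ b := by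
  rw [← Frac.of_injective.eq_iff, ← toQ, toQ_sub, map_zero, max_eq_right_iff, sub_nonpos]

theorem toQ_eq_zero {a : 𝓜.Num} : toQ a = 0 ↔ a = 0 := by
  rw [← map_zero Frac.of]; exact Frac.of_injective.eq_iff

theorem toQ_pos {a : 𝓜.Num} (h : a ≠ 0) : 0 < toQ a :=
  lt_of_le_of_ne (Frac.of_nonneg a) fun h' => h (toQ_eq_zero.1 h'.symm)

theorem toQ_add_one_pos (a : 𝓜.Num) : 0 < toQ (a + 1) := toQ_pos (add_one_ne_zero a)

theorem one_le_toQ {a : 𝓜.Num} (h : a ≠ 0) : 1 ≤ toQ a := by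
  obtain ⟨b, rfl⟩ := (eq_zero_or_eq_add_one a).resolve_left h
  simp [Frac.of_nonneg]

/-- Discreteness of the internal numbers; it translates strict inequalities of codes, which are
written with a successor. -/
theorem toQ_lt_iff {a b : 𝓜.Num} : toQ a < toQ b ↔ toQ a + 1 ≤ toQ b := by
  refine ⟨fun h => ?_, fun h => by linarith⟩
  obtain ⟨c, rfl⟩ := Frac.of_le_of.1 h.le
  have hc : c ≠ 0 := by rintro rfl; simp at h
  have := one_le_toQ hc
  simp only [toQ, map_add] at *
  linarith

/-- The rational number with a given code. -/
noncomputable def val (q : 𝓜.Num) : 𝓜.Rtl :=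
  (toQ (fn₁ cPos q) - toQ (fn₁ cNeg q)) / toQ (fn₁ cSnd q + 1)

theorem pos_eq (q : 𝓜.Num) :
    fn₁ cPos q = fn₃ cCond (fn₁ cOdd (fn₁ cFst q)) (fn₁ cHalf (fn₁ cFst q)) 0 := by
  rw [cPos, fn₁_lam]; simp

theorem neg_eq (q : 𝓜.Num) :
    fn₁ cNeg q = fn₃ cCond (fn₁ cOdd (fn₁ cFst q)) 0 (fn₁ cHalf (fn₁ cFst q + 1)) := by
  rw [cNeg, fn₁_lam]; simp

/-- The parity of the numerator code decides the sign, so the two parts never cancel and their sum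
is the absolute value of the numerator. -/
theorem pos_eq_zero_or_neg_eq_zero (q : 𝓜.Num) : fn₁ cPos q = 0 ∨ fn₁ cNeg q = 0 := by
  rw [pos_eq, neg_eq]
  by_cases h : fn₁ cOdd (fn₁ cFst q) = 0
  · right; rw [h, cond_zero]
  · left; rw [cond_of_ne_zero h]

theorem val_pair_two_mul (a b : 𝓜.Num) : val (fn₂ cPair (2 * a) b) = toQ a / toQ (b + 1) := by
  simp only [val, pos_eq, neg_eq, fst_pair, snd_pair, odd_two_mul, cond_zero, half_two_mul,
    map_zero, _root_.sub_zero]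

theorem val_pair_two_mul_add_one (a b : 𝓜.Num) :
    val (fn₂ cPair (2 * a + 1) b) = -toQ (a + 1) / toQ (b + 1) := by
  have : 2 * a + 1 + 1 = 2 * (a + 1) := by ring
  simp only [val, pos_eq, neg_eq, fst_pair, snd_pair, odd_two_mul_add_one, this,
    half_two_mul, cond_of_ne_zero (one_ne_zero (α := 𝓜.Num)), map_zero, zero_sub]

theorem val_mk (a b : 𝓜.Num) {d : 𝓜.Num} (hd : d ≠ 0) :
    val (fn₃ cMk a b d) = (toQ a - toQ b) / toQ d := by
  obtain ⟨d, rfl⟩ := (eq_zero_or_eq_add_one d).resolve_left hd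
  have h : fn₃ cMk a b (d + 1) = fn₂ cPair (fn₃ cCond (fn₂ cSub b a) (2 * fn₂ cSub a b)
      (fn₁ cPred (2 * fn₂ cSub b a))) d := by
    rw [cMk, fn₃_lam]; simp
  rw [h]
  rcases exists_add_eq b a with ⟨c, rfl⟩ | ⟨c, rfl⟩
  · rw [sub_add_self, add_sub_cancel_left, cond_zero, val_pair_two_mul]
    simp
  · rw [sub_add_self, add_sub_cancel_left]
    rcases eq_zero_or_eq_add_one c with rfl | ⟨c, rfl⟩
    · rw [cond_zero, val_pair_two_mul]; simp
    -- Odd codes are shifted: 2c + 1 stands for -(c + 1), hence the predecessor of 2(c + 1).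
    · rw [cond_add_one, show 2 * (c + 1) = 2 * c + 1 + 1 by ring, pred_add_one,
        val_pair_two_mul_add_one]
      simp

theorem val_add (p q : 𝓜.Num) : val (fn₂ cQAdd p q) = val p + val q := by
  have hp := (toQ_add_one_pos (fn₁ cSnd p)).ne'
  have hq := (toQ_add_one_pos (fn₁ cSnd q)).ne'
  rw [cQAdd, fn₂_lam]
  simp only [eval_qMk, eval_nAdd, eval_nMul, eval_qPos, eval_qDen, eval_qNegPart, eval_var_z,
    eval_var_s]
  rw [val_mk _ _ (mul_ne_zero (add_one_ne_zero _) (add_one_ne_zero _)), val, val]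
  rw [div_add_div _ _ hp hq]
  simp only [toQ, map_add, map_mul, map_one]
  ring

theorem val_neg (q : 𝓜.Num) : val (fn₁ cQNeg q) = -val q := by
  rw [cQNeg, fn₁_lam]
  simp only [eval_qMk, eval_qPos, eval_qDen, eval_qNegPart, eval_var_z]
  rw [val_mk _ _ (add_one_ne_zero _), val]
  ring

theorem val_mul (p q : 𝓜.Num) : val (fn₂ cQMul p q) = val p * val q := by
  rw [cQMul, fn₂_lam]
  simp only [eval_qMk, eval_nAdd, eval_nMul, eval_qPos, eval_qDen, eval_qNegPart, eval_var_z,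
    eval_var_s]
  rw [val_mk _ _ (mul_ne_zero (add_one_ne_zero _) (add_one_ne_zero _)), val, val, div_mul_div_comm]
  simp only [toQ, map_add, map_mul, map_one]
  ring

theorem val_abs (q : 𝓜.Num) : val (fn₁ cQAbs q) = |val q| := by
  rw [cQAbs, fn₁_lam]
  simp only [eval_qMk, eval_qPos, eval_qDen, eval_qNegPart, eval_var_z, eval_nAdd, eval_zero]
  rw [val_mk _ _ (add_one_ne_zero _), val, abs_div, abs_of_pos (toQ_add_one_pos _)]
  congr 1
  rcases pos_eq_zero_or_neg_eq_zero q with h | h <;>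
    simp [h, abs_of_nonneg, Frac.of_nonneg]

theorem val_nonneg_iff (q : 𝓜.Num) : val q = 0 ↔ fn₁ cPos q + fn₁ cNeg q = 0 := by
  have h0 := (toQ_add_one_pos (fn₁ cSnd q)).ne'
  rw [val, div_eq_zero_iff, or_iff_left h0]
  rcases pos_eq_zero_or_neg_eq_zero q with h | h <;> simp [h, toQ_eq_zero]

theorem val_inv (q : 𝓜.Num) : val (fn₁ cQInv q) = (val q)⁻¹ := by
  rw [cQInv, fn₁_lam]
  simp only [eval_qMk, eval_qPos, eval_qDen, eval_qNegPart, eval_var_z, eval_nAdd, eval_zero,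
    eval_nCond]
  by_cases h : fn₁ cPos q + fn₁ cNeg q = 0
  · have h1 := eq_zero_of_add_eq_zero h
    rw [add_comm] at h
    have h2 := eq_zero_of_add_eq_zero h
    rw [(val_nonneg_iff q).2 (by rw [h1, h2, add_zero]), inv_zero, h1, h2, cond_zero, add_zero]
    -- For q = 0 the proposed denominator is 0, but its predecessor is 0 again; the result codes 0,
    -- in agreement with the convention 0⁻¹ = 0.
    have : fn₃ cMk (0 : 𝓜.Num) 0 0 = fn₂ cPair (2 * 0) 0 := by
      rw [cMk, fn₃_lam]; simp
    rw [this, val_pair_two_mul]; simp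
  · rw [val_mk _ _ h, val, inv_div]
    rcases pos_eq_zero_or_neg_eq_zero q with h1 | h1
    · rw [h1, zero_add] at h ⊢
      rw [cond_zero, cond_of_ne_zero h, map_zero, zero_sub, zero_sub, div_neg, neg_div]
    · rw [h1, add_zero] at h ⊢
      rw [cond_zero, cond_of_ne_zero h, map_zero, _root_.sub_zero, _root_.sub_zero]

theorem qLe_eq_zero_iff (p q : 𝓜.Num) : fn₂ cQLe p q = 0 ↔ val p ≤ val q := by
  rw [cQLe, fn₂_lam]
  simp only [eval_nSub, eval_nAdd, eval_nMul, eval_qPos, eval_qDen, eval_qNegPart, eval_var_z,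
    eval_var_s]
  rw [sub_eq_zero_iff, val, val, div_le_div_iff₀ (toQ_add_one_pos _) (toQ_add_one_pos _)]
  simp only [toQ, map_add, map_mul, map_one]
  constructor <;> intro h <;> linarith

theorem qLt_eq_zero_iff (p q : 𝓜.Num) : fn₂ cQLt p q = 0 ↔ val p < val q := by
  rw [cQLt, fn₂_lam]
  simp only [eval_nSub, eval_nAdd, eval_nMul, eval_qPos, eval_qDen, eval_qNegPart, eval_var_z,
    eval_var_s, eval_succ_app]
  rw [sub_eq_zero_iff, val, val, div_lt_div_iff₀ (toQ_add_one_pos _) (toQ_add_one_pos _), toQ,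
    map_add, map_one, ← toQ, ← toQ_lt_iff]
  simp only [toQ, map_add, map_mul, map_one]
  constructor <;> intro h <;> linarith

/-- The rational number `2 ^ (-n)`. -/
noncomputable def eps (n : 𝓜.Num) : 𝓜.Rtl := (toQ (fn₁ cPow2 n))⁻¹

theorem eps_zero : eps (0 : 𝓜.Num) = 1 := by simp [eps]

theorem eps_add_one (n : 𝓜.Num) : eps (n + 1) = eps n / 2 := by
  rw [eps, eps, pow_add_one, map_add, ← two_mul, mul_inv]; ring

theorem pow_ne_zero (n : 𝓜.Num) : fn₁ cPow2 n ≠ 0 := by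
  refine num_induction (nPow2 v0 =ₙ tZero).neg 𝓜.nil (fun n => ?_) ?_ (fun n ih h => ?_) n
  · simp [Fm.neg, Fm.falsum]
  · simp
  · rw [pow_add_one] at h
    exact ih (eq_zero_of_add_eq_zero h)

theorem eps_pos (n : 𝓜.Num) : 0 < eps n := inv_pos.2 (toQ_pos (pow_ne_zero n))

theorem toQ_lt_pow (n : 𝓜.Num) : toQ n < toQ (fn₁ cPow2 n) := by
  refine num_induction (nSub (tSucc v0) (nPow2 v0) =ₙ tZero) 𝓜.nil (fun n => ?_) ?_
    (fun n ih => ?_) n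
  · simp only [sat_eqN, eval_nSub, eval_succ_app, eval_nPow2, eval_var_z, eval_zero]
    rw [sub_eq_zero_iff, toQ, map_add, map_one, ← toQ_lt_iff]
  · simp
  · have := one_le_toQ (pow_ne_zero n)
    rw [pow_add_one, map_add, map_add, map_one]
    linarith

/-- Internal numbers are cofinal in the fraction field and n < 2^n, so internal powers 2^(-n) get
below every positive element, even if the field is not Archimedean. -/
theorem exists_eps_lt {x : 𝓜.Rtl} (hx : 0 < x) : ∃ n : 𝓜.Num, eps n < x := by
  obtain ⟨n, hn⟩ := Frac.exists_lt_of (N := 𝓜.Num) x⁻¹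
  refine ⟨n, ?_⟩
  rw [eps]
  exact inv_lt_of_inv_lt₀ hx (hn.trans (toQ_lt_pow n))

theorem eps_add (m n : 𝓜.Num) : eps (m + n) = eps m * eps n := by
  have : fn₁ cPow2 (m + n) = fn₁ cPow2 m * fn₁ cPow2 n := by
    refine num_induction (nPow2 (nAdd v1 v0) =ₙ nMul (nPow2 v1) (nPow2 v0)) (cons m 𝓜.nil)
      (fun n => by simp) ?_ (fun n ih => ?_) n
    · simp
    · rw [← add_assoc, pow_add_one, pow_add_one, ih]; ring
  rw [eps, eps, eps, this, map_mul, mul_inv]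

theorem eps_le_one (n : 𝓜.Num) : eps n ≤ 1 := inv_le_one_of_one_le₀ (one_le_toQ (pow_ne_zero n))

theorem eps_anti {m n : 𝓜.Num} (h : toQ m ≤ toQ n) : eps n ≤ eps m := by
  obtain ⟨c, rfl⟩ := Frac.of_le_of.1 h
  rw [eps_add]
  exact mul_le_of_le_one_right (eps_pos _).le (eps_le_one _)

theorem val_qPow (n : 𝓜.Num) : val (fn₁ cQPow n) = eps n := by
  have h : fn₁ cQPow n = fn₂ cPair (2 * 1) (fn₁ cPred (fn₁ cPow2 n)) := by
    rw [cQPow, fn₁_lam]; simp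
  have h' : fn₁ cPred (fn₁ cPow2 n) + 1 = fn₁ cPow2 n := by
    obtain ⟨b, hb⟩ := (eq_zero_or_eq_add_one _).resolve_left (pow_ne_zero n)
    rw [hb, pred_add_one]
  rw [h, val_pair_two_mul, h', eps, map_one, one_div]

theorem val_rat (a m : ℕ) (θ : 𝓜.Env Γ) :
    val (𝓜.eval (rat a m) θ) = (a : 𝓜.Rtl) / ((m : 𝓜.Rtl) + 1) := by
  have h : 𝓜.eval (rat a m) θ = fn₂ cPair (2 * (a : 𝓜.Num)) m := by simp [rat]
  rw [h, val_pair_two_mul, map_natCast, map_add, map_natCast, map_one]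

end PreModel
open Filter

/-! ## A field of limits

For an ordered field `K` and an ultrafilter `U`, the finite elements of the ultrapower modulo the
infinitesimal ones (both relative to `K`). -/

section LimitField

variable {K : Type} [Field K] [LinearOrder K] [IsStrictOrderedRing K] {ι : Type}
  (U : Ultrafilter ι)

/-- The ultrapower. -/
abbrev UPow (K : Type) {ι : Type} (U : Ultrafilter ι) : Type := (U : Filter ι).Germ K

variable (K) in
/-- The diagonal embedding. -/
def diag : K →+* UPow K U where
  toFun k := (k : UPow K U)
  map_one' := rfl
  map_mul' _ _ := rfl
  map_zero' := rfl
  map_add' _ _ := rfl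

theorem diag_lt {a b : K} (h : a < b) : diag K U a < diag K U b := Germ.const_lt h

variable (K) in
/-- The elements of the ultrapower which are bounded by elements of `K`. -/
def finiteSubring : Subring (UPow K U) where
  carrier := {x | ∃ k : K, |x| ≤ diag K U k}
  zero_mem' := ⟨0, by simp⟩
  one_mem' := ⟨1, by simp⟩
  add_mem' := by
    rintro x y ⟨k, hk⟩ ⟨l, hl⟩
    exact ⟨k + l, by rw [map_add]; exact (abs_add_le _ _).trans (add_le_add hk hl)⟩
  mul_mem' := by
    rintro x y ⟨k, hk⟩ ⟨l, hl⟩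
    refine ⟨k * l, ?_⟩
    rw [map_mul, abs_mul]
    exact mul_le_mul hk hl (abs_nonneg _) ((abs_nonneg _).trans hk)
  neg_mem' := by
    rintro x ⟨k, hk⟩
    exact ⟨k, by rwa [abs_neg]⟩

variable (K) in
/-- The infinitesimal elements. -/
def infinitesimals : Ideal (finiteSubring K U) where
  carrier := {x | ∀ k : K, 0 < k → |x.1| < diag K U k}
  zero_mem' k hk := by simpa using diag_lt U hk
  add_mem' := by
    intro x y hx hy k hk
    have h1 := hx (k / 2) (by linarith)
    have h2 := hy (k / 2) (by linarith)
    calc |x.1 + y.1| ≤ |x.1| + |y.1| := abs_add_le _ _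
      _ < diag K U (k / 2) + diag K U (k / 2) := add_lt_add h1 h2
      _ = diag K U k := by rw [← map_add]; congr 1; ring
  smul_mem' := by
    rintro ⟨x, l, hl⟩ y hy k hk
    have hl' : |x| < diag K U (|l| + 1) :=
      hl.trans_lt (diag_lt U (by linarith [le_abs_self l]))
    have h1 := hy (k / (|l| + 1)) (by positivity)
    change |x * y.1| < _
    rw [abs_mul]
    calc |x| * |y.1| ≤ diag K U (|l| + 1) * |y.1| :=
          mul_le_mul_of_nonneg_right hl'.le (abs_nonneg _)
      _ < diag K U (|l| + 1) * diag K U (k / (|l| + 1)) :=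
          mul_lt_mul_of_pos_left h1 ((abs_nonneg x).trans_lt hl')
      _ = diag K U k := by
          rw [← map_mul]; congr 1; field_simp

theorem mem_infinitesimals {x : finiteSubring K U} :
    x ∈ infinitesimals K U ↔ ∀ k : K, 0 < k → |x.1| < diag K U k := Iff.rfl

/-- A finite element that is not infinitesimal is bounded away from 0 by a positive element of K;
its inverse is then finite too. -/
instance : (infinitesimals K U).IsMaximal := by
  refine Ideal.isMaximal_iff.2 ⟨fun h => ?_, fun J x _ hx hxJ => ?_⟩
  · have := (mem_infinitesimals U).1 h 1 one_pos
    simp at this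
  · rw [mem_infinitesimals] at hx
    push Not at hx
    obtain ⟨k, hk, hx⟩ := hx
    have hk' : 0 < diag K U k := by simpa using diag_lt U hk
    have hx0 : x.1 ≠ 0 := fun h => by
      rw [h, abs_zero] at hx; exact absurd hx (not_le.2 hk')
    have hinv : x.1⁻¹ ∈ finiteSubring K U := by
      refine ⟨k⁻¹, ?_⟩
      rw [abs_inv, map_inv₀]
      exact inv_anti₀ hk' hx
    have h1 : (⟨x.1⁻¹, hinv⟩ : finiteSubring K U) * x = 1 := Subtype.ext (inv_mul_cancel₀ hx0)
    rw [← h1]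
    exact J.mul_mem_left _ hxJ

variable (K) in
/-- Finite elements modulo infinitesimals. -/
abbrev LimitField : Type := finiteSubring K U ⧸ infinitesimals K U

namespace LimitField

variable {U}

noncomputable instance : Field (LimitField K U) := Ideal.Quotient.field _

/-- The standard part of a finite element. -/
noncomputable def st : finiteSubring K U →+* LimitField K U := Ideal.Quotient.mk _

theorem exists_st (x : LimitField K U) : ∃ y, st y = x := Ideal.Quotient.mk_surjective x

theorem st_eq_zero_iff {x : finiteSubring K U} :
    st x = 0 ↔ ∀ k : K, 0 < k → |x.1| < diag K U k := Ideal.Quotient.eq_zero_iff_mem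

/-- The nonnegative elements. -/
noncomputable def cone : RingCone (LimitField K U) where
  carrier := {q | ∃ x : finiteSubring K U, 0 ≤ x.1 ∧ st x = q}
  zero_mem' := ⟨0, le_rfl, map_zero _⟩
  one_mem' := ⟨1, zero_le_one, map_one _⟩
  add_mem' := by
    rintro _ _ ⟨x, hx, rfl⟩ ⟨y, hy, rfl⟩
    exact ⟨x + y, add_nonneg hx hy, map_add _ _ _⟩
  mul_mem' := by
    rintro _ _ ⟨x, hx, rfl⟩ ⟨y, hy, rfl⟩
    exact ⟨x * y, mul_nonneg hx hy, map_mul _ _ _⟩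
  eq_zero_of_mem_of_neg_mem' := by
    rintro _ ⟨x, hx, rfl⟩ ⟨y, hy, h⟩
    have h0 : st (x + y) = 0 := by rw [map_add, h]; ring
    rw [st_eq_zero_iff] at h0 ⊢
    intro k hk
    refine lt_of_le_of_lt ?_ (h0 k hk)
    change |x.1| ≤ |x.1 + y.1|
    rw [abs_of_nonneg hx, abs_of_nonneg (add_nonneg hx hy)]
    linarith

instance : HasMemOrNegMem (cone (K := K) (U := U)) where
  mem_or_neg_mem q := by
    obtain ⟨x, rfl⟩ := exists_st q
    rcases le_total 0 x.1 with h | h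
    · exact Or.inl ⟨x, h, rfl⟩
    · exact Or.inr ⟨-x, neg_nonneg.2 h, map_neg _ _⟩

open Classical in
variable (K U) in
/-- The order of the field of limits. -/
noncomputable def linearOrder : LinearOrder (LimitField K U) := .mkOfAddGroupCone cone

noncomputable instance : LinearOrder (LimitField K U) := linearOrder K U

instance : IsOrderedRing (LimitField K U) := by
  have := IsOrderedRing.mkOfCone (cone (K := K) (U := U))
  exact this

instance : IsStrictOrderedRing (LimitField K U) := inferInstance

theorem st_mono {x y : finiteSubring K U} (h : x.1 ≤ y.1) : st x ≤ st y := by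
  have : st y - st x ∈ cone (K := K) (U := U) :=
    ⟨y - x, sub_nonneg.2 h, map_sub _ _ _⟩
  exact this

theorem diag_mono {a b : K} (h : a ≤ b) : diag K U a ≤ diag K U b := Germ.const_le h

theorem diag_mem (k : K) : diag K U k ∈ finiteSubring K U := ⟨|k|, by
  rcases le_total 0 k with h | h
  · have h' := diag_mono (U := U) h
    rw [map_zero] at h'
    rw [abs_of_nonneg h, abs_of_nonneg h']
  · have h' := diag_mono (U := U) h
    rw [map_zero] at h'
    rw [abs_of_nonpos h, abs_of_nonpos h', map_neg]⟩

variable (K U) in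
/-- The embedding of `K` into the field of limits. -/
noncomputable def of : K →+* LimitField K U :=
  st.comp ((diag K U).codRestrict (finiteSubring K U) diag_mem)

theorem of_mono {a b : K} (h : a ≤ b) : of K U a ≤ of K U b := st_mono (Germ.const_le h)

theorem of_strictMono : StrictMono (of K U) := fun a b h => by
  refine lt_of_le_of_ne (of_mono h.le) fun h' => ?_
  exact h.ne ((of K U).injective h')

/-- A positive class cannot come from an infinitesimal. So positive elements of K are coinitial
among those of the limit field, and estimates with errors from K suffice to prove equality there. -/
theorem exists_of_lt {x : LimitField K U} (hx : 0 < x) : ∃ k : K, 0 < k ∧ of K U k < x := by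
  obtain ⟨y, rfl⟩ := exists_st x
  by_contra! h
  have hy : st y = 0 := by
    rw [st_eq_zero_iff]
    intro k hk
    have h1 : ¬ (diag K U (k / 2)) < y.1 := fun h2 => by
      have h3 := h (k / 4) (by linarith)
      have h4 : of K U (k / 2) ≤ st y := st_mono h2.le
      have h5 := of_strictMono (U := U) (show k / 4 < k / 2 by linarith)
      linarith
    rw [not_lt] at h1
    have h2 : - diag K U k < y.1 := by
      by_contra! h3
      have h4 : st y ≤ of K U (-k) := st_mono (by
        change y.1 ≤ diag K U (-k)
        rwa [map_neg])
      have h5 := of_strictMono (U := U) (show -k < 0 by linarith)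
      rw [map_zero] at h5
      linarith
    rw [abs_lt]
    exact ⟨h2, h1.trans_lt (diag_lt U (by linarith))⟩
  exact hx.ne' hy

/-- Existence of limits. -/
theorem exists_limit {D : Type} (i₀ : D) (a r : D → K) (h : ι → K)
    (ha : ∀ i, ∀ᶠ n in (U : Filter ι), |a i - h n| ≤ r i) :
    ∃ x : LimitField K U, ∀ i, |x - of K U (a i)| ≤ of K U (r i) := by
  have hle : ∀ i, |diag K U (a i) - (h : UPow K U)| ≤ diag K U (r i) := fun i => by
    rw [abs_le]
    constructor
    · have : ((fun _ => -r i : ι → K) : UPow K U) ≤ ((fun n => a i - h n : ι → K) : UPow K U) :=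
        Germ.coe_le.2 ((ha i).mono fun n hn => (abs_le.1 hn).1)
      exact this
    · have : ((fun n => a i - h n : ι → K) : UPow K U) ≤ ((fun _ => r i : ι → K) : UPow K U) :=
        Germ.coe_le.2 ((ha i).mono fun n hn => (abs_le.1 hn).2)
      exact this
  -- The germ of h stays within a bound from K of the single value at `i₀`, hence is finite; its
  -- class modulo infinitesimals is the limit.
  have hmem : (h : UPow K U) ∈ finiteSubring K U := by
    have h1 : diag K U (a i₀) - (h : UPow K U) ∈ finiteSubring K U := ⟨_, hle i₀⟩
    have := (finiteSubring K U).sub_mem (diag_mem (a i₀)) h1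
    rwa [sub_sub_cancel] at this
  refine ⟨st ⟨_, hmem⟩, fun i => ?_⟩
  have h1 := abs_le.1 (hle i)
  rw [abs_le]
  constructor
  · have : of K U (a i - r i) ≤ st ⟨(h : UPow K U), hmem⟩ := st_mono (by
      change diag K U (a i - r i) ≤ _
      rw [map_sub]; linarith)
    rw [map_sub] at this
    linarith
  · have : st ⟨(h : UPow K U), hmem⟩ ≤ of K U (a i + r i) := st_mono (by
      change _ ≤ diag K U (a i + r i)
      rw [map_add]; linarith)
    rw [map_add] at this
    linarith

end LimitField

end LimitField

open Filter

/-! ## Values of representatives of real numbers -/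

namespace PreModel

variable {E : Ty → Type} {𝓜 : PreModel E} {Γ : Ctx} {σ τ : Ty}

/-- The index used by `hat`. -/
def hatIndex (f : 𝓜.Obj Ty.real) (n : 𝓜.Num) : 𝓜.Num :=
  𝓜.app (𝓜.app (𝓜.eval cHatIdx 𝓜.nil) f) n

/-- The sequence of codes of rational numbers given by a functional. -/
def hatSeq (f : 𝓜.Obj Ty.real) (n : 𝓜.Num) : 𝓜.Num :=
  𝓜.app (𝓜.app (𝓜.eval cHat 𝓜.nil) f) n

@[simp] theorem eval_hat (f : Tm E Γ Ty.real) (n : Tm E Γ Ty.nat) (θ : 𝓜.Env Γ) :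
    𝓜.eval (hat f n) θ = hatSeq (𝓜.eval f θ) (𝓜.eval n θ) := by
  simp only [hat, eval_app, eval_cl]; rfl

@[simp] theorem eval_qSub (s t : Tm E Γ Ty.nat) (θ : 𝓜.Env Γ) :
    𝓜.eval (qSub s t) θ = fn₂ cQAdd (𝓜.eval s θ) (fn₁ cQNeg (𝓜.eval t θ)) := by
  simp [qSub]

variable [ArithModel 𝓜]

@[simp] theorem app_eval_succ (n : 𝓜.Num) (θ : 𝓜.Env Γ) :
    𝓜.app (𝓜.eval (.const .succ) θ) n = n + 1 := succ_eq n

theorem hatSeq_eq (f : 𝓜.Obj Ty.real) (n : 𝓜.Num) : hatSeq f n = 𝓜.app f (hatIndex f n) := by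
  simp only [hatSeq, cHat, app_eval_lam, eval_app, eval_var_s, eval_var_z, eval_cl]; rfl

theorem hatIndex_zero (f : 𝓜.Obj Ty.real) : hatIndex f 0 = 0 := by
  simp only [hatIndex, cHatIdx, app_eval_lam]
  rw [eval_natRec_zero] <;> simp

theorem hatIndex_add_one (f : 𝓜.Obj Ty.real) (n : 𝓜.Num) :
    hatIndex f (n + 1) = fn₃ cCond
      (fn₂ cSub (hatIndex f n) n + fn₂ cSub n (hatIndex f n) +
        fn₂ cQLt (fn₁ cQAbs (fn₂ cQAdd (𝓜.app f n) (fn₁ cQNeg (𝓜.app f (n + 1)))))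
          (fn₁ cQPow (n + 1))) (n + 1) (hatIndex f n) := by
  simp only [hatIndex, cHatIdx, app_eval_lam]
  rw [eval_natRec_add_one (cons n (cons f 𝓜.nil))] <;> simp

/-- The sequence of rational numbers given by a functional. -/
noncomputable def ratSeq (f : 𝓜.Obj Ty.real) (n : 𝓜.Num) : 𝓜.Rtl := val (hatSeq f n)

/-- By construction of `hat` the index advances only if it has not been frozen earlier and the next
step is small enough; otherwise consecutive values coincide. -/
theorem abs_ratSeq_sub_add_one_lt (f : 𝓜.Obj Ty.real) (n : 𝓜.Num) :
    |ratSeq f n - ratSeq f (n + 1)| < eps (n + 1) := by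
  rw [ratSeq, ratSeq, hatSeq_eq, hatSeq_eq, hatIndex_add_one]
  by_cases h : fn₂ cSub (hatIndex f n) n + fn₂ cSub n (hatIndex f n) +
        fn₂ cQLt (fn₁ cQAbs (fn₂ cQAdd (𝓜.app f n) (fn₁ cQNeg (𝓜.app f (n + 1)))))
          (fn₁ cQPow (n + 1)) = 0
  · rw [h, cond_zero, eq_of_dist_eq_zero (eq_zero_of_add_eq_zero h)]
    rw [add_comm] at h
    have := eq_zero_of_add_eq_zero h
    rwa [qLt_eq_zero_iff, val_abs, val_add, val_neg, ← sub_eq_add_neg, val_qPow] at this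
  · rw [cond_of_ne_zero h, sub_self, abs_zero]
    exact eps_pos _

/-- Telescoping. The sharper bound with the subtracted term is what makes the internal induction go
through. -/
theorem abs_ratSeq_sub_add_le (f : 𝓜.Obj Ty.real) (n d : 𝓜.Num) :
    |ratSeq f n - ratSeq f (n + d)| ≤ eps n - eps (n + d) := by
  refine num_induction (qLe (qAbs (qSub (hat v2 v1) (hat v2 (nAdd v1 v0))))
    (qSub (qPow v1) (qPow (nAdd v1 v0))) =ₙ tZero) (cons n (cons f 𝓜.nil)) (fun d => ?_) ?_
    (fun d ih => ?_) d
  · simp only [sat_eqN, eval_qLe, eval_qAbs, eval_qSub, eval_hat, eval_nAdd, eval_qPow,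
      eval_var_z, eval_var_s, eval_zero, qLe_eq_zero_iff, val_abs, val_add, val_neg, val_qPow,
      ← sub_eq_add_neg, ratSeq]
  · simp
  · have h1 := abs_ratSeq_sub_add_one_lt f (n + d)
    have h2 := abs_sub_le (ratSeq f n) (ratSeq f (n + d)) (ratSeq f (n + d + 1))
    rw [← add_assoc]
    rw [eps_add_one] at h1 ⊢
    linarith

theorem abs_ratSeq_sub_le {n m : 𝓜.Num} (f : 𝓜.Obj Ty.real) (h : toQ n ≤ toQ m) :
    |ratSeq f n - ratSeq f m| ≤ eps n := by
  obtain ⟨d, rfl⟩ := Frac.of_le_of.1 h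
  have := abs_ratSeq_sub_add_le f n d
  have := eps_pos (n + d)
  linarith

/-- A sequence with small enough steps is never frozen, so `hat` leaves it unchanged. Hence the
values of an operation can be read from its defining sequence once regularity is checked. -/
theorem hatIndex_of_regular {f : 𝓜.Obj Ty.real}
    (hf : ∀ k, |val (𝓜.app f k) - val (𝓜.app f (k + 1))| < eps (k + 1)) (n : 𝓜.Num) :
    hatIndex f n = n := by
  refine num_induction (cHatIdx.cl ⬝ v1 ⬝ v0 =ₙ v0) (cons f 𝓜.nil) (fun n => ?_)
    (hatIndex_zero f) (fun n ih => ?_) n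
  · simp only [sat_eqN, eval_app, eval_var_z, eval_var_s, eval_cl]; rfl
  · rw [hatIndex_add_one, ih, dist_self, zero_add, (qLt_eq_zero_iff _ _).2, cond_zero]
    rw [val_abs, val_add, val_neg, ← sub_eq_add_neg, val_qPow]
    exact hf n

theorem ratSeq_of_regular {f : 𝓜.Obj Ty.real}
    (hf : ∀ k, |val (𝓜.app f k) - val (𝓜.app f (k + 1))| < eps (k + 1)) (n : 𝓜.Num) :
    ratSeq f n = val (𝓜.app f n) := by
  rw [ratSeq, hatSeq_eq, hatIndex_of_regular hf]

instance : (comap (toQ : 𝓜.Num → 𝓜.Rtl) atTop).NeBot := by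
  refine comap_neBot fun s hs => ?_
  obtain ⟨b, hb⟩ := mem_atTop_sets.1 hs
  obtain ⟨n, hn⟩ := Frac.exists_lt_of b
  exact ⟨n, hb _ hn.le⟩

variable (𝓜) in
/-- An ultrafilter containing the final segments. -/
noncomputable def ultra : Ultrafilter 𝓜.Num := Ultrafilter.of (comap (toQ : 𝓜.Num → 𝓜.Rtl) atTop)

theorem eventually_ultra (n : 𝓜.Num) : ∀ᶠ m in (𝓜.ultra : Filter 𝓜.Num), toQ n ≤ toQ m :=
  Ultrafilter.of_le _ (preimage_mem_comap (Ici_mem_atTop (toQ n)))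

variable (𝓜) in
/-- An ordered field containing the limits of the rational sequences of a model. -/
def Lim : Type := LimitField 𝓜.Rtl 𝓜.ultra

noncomputable instance : Field 𝓜.Lim := inferInstanceAs (Field (LimitField 𝓜.Rtl 𝓜.ultra))

noncomputable instance : LinearOrder 𝓜.Lim :=
  inferInstanceAs (LinearOrder (LimitField 𝓜.Rtl 𝓜.ultra))

instance : IsStrictOrderedRing 𝓜.Lim :=
  inferInstanceAs (IsStrictOrderedRing (LimitField 𝓜.Rtl 𝓜.ultra))

/-- The embedding of the rational numbers. -/
noncomputable def emb : 𝓜.Rtl →+* 𝓜.Lim := LimitField.of 𝓜.Rtl 𝓜.ultra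

theorem emb_strictMono : StrictMono (emb (𝓜 := 𝓜)) := LimitField.of_strictMono

theorem emb_lt {a b : 𝓜.Rtl} : emb a < emb b ↔ a < b := emb_strictMono.lt_iff_lt

theorem emb_le {a b : 𝓜.Rtl} : emb a ≤ emb b ↔ a ≤ b := emb_strictMono.le_iff_le

theorem emb_abs (a : 𝓜.Rtl) : emb |a| = |emb a| := by
  rcases le_total 0 a with h | h
  · rw [abs_of_nonneg h, abs_of_nonneg (by rwa [← map_zero emb, emb_le])]
  · rw [abs_of_nonpos h, abs_of_nonpos (by rwa [← map_zero emb, emb_le]), map_neg]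

theorem emb_eps_pos (n : 𝓜.Num) : 0 < emb (eps n) := by
  rw [← map_zero emb, emb_lt]; exact eps_pos n

theorem exists_emb_eps_lt {x : 𝓜.Lim} (hx : 0 < x) : ∃ n : 𝓜.Num, emb (eps n) < x := by
  obtain ⟨k, hk, hkx⟩ := LimitField.exists_of_lt hx
  obtain ⟨n, hn⟩ := exists_eps_lt hk
  exact ⟨n, (emb_lt.2 hn).trans hkx⟩

theorem emb_eps_add_one (n : 𝓜.Num) : emb (eps (n + 1)) = emb (eps n) / 2 := by
  rw [eps_add_one, map_div₀, map_ofNat]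

theorem exists_abs_sub_lt (f : 𝓜.Obj Ty.real) :
    ∃ x : 𝓜.Lim, ∀ n, |x - emb (ratSeq f n)| < emb (eps n) := by
  obtain ⟨x, hx⟩ := LimitField.exists_limit (U := 𝓜.ultra) (0 : 𝓜.Num) (ratSeq f)
    -- This radius is strictly below 2^(-n), so a strict bound survives the limit, which otherwise
    -- preserves only ≤. Equality of reals is defined by a strict inequality and needs this.
    (fun n => eps (n + 1) + |ratSeq f n - ratSeq f (n + 1)|) (ratSeq f) (fun n => by
      filter_upwards [eventually_ultra (n + 1)] with m hm
      have h1 := abs_ratSeq_sub_le f hm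
      have h2 := abs_sub_le (ratSeq f n) (ratSeq f (n + 1)) (ratSeq f m)
      linarith)
  refine ⟨x, fun n => (hx n).trans_lt (emb_lt.2 ?_)⟩
  have h1 := abs_ratSeq_sub_add_one_lt f n
  rw [eps_add_one] at *
  linarith

/-- The value of a representative of a real number. -/
noncomputable def rv (f : 𝓜.Obj Ty.real) : 𝓜.Lim := (exists_abs_sub_lt f).choose

theorem abs_rv_sub_lt (f : 𝓜.Obj Ty.real) (n : 𝓜.Num) :
    |rv f - emb (ratSeq f n)| < emb (eps n) := (exists_abs_sub_lt f).choose_spec n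

theorem eq_zero_of_abs_le {x : 𝓜.Lim} (C : 𝓜.Lim) (h : ∀ n : 𝓜.Num, |x| ≤ C * emb (eps n)) :
    x = 0 := by
  by_contra hx
  have hx' := abs_pos.2 hx
  have hC : 0 < |C| + 1 := by positivity
  obtain ⟨n, hn⟩ := exists_emb_eps_lt (div_pos hx' hC)
  have h1 := h n
  rw [lt_div_iff₀ hC] at hn
  have h2 := emb_eps_pos n
  have h3 : C * emb (eps n) ≤ |C| * emb (eps n) :=
    mul_le_mul_of_nonneg_right (le_abs_self C) h2.le
  linarith

theorem rv_eq_of_abs_le {f : 𝓜.Obj Ty.real} {x : 𝓜.Lim} (C : 𝓜.Lim)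
    (h : ∀ n, |x - emb (ratSeq f n)| ≤ C * emb (eps n)) : rv f = x := by
  refine sub_eq_zero.1 (eq_zero_of_abs_le (1 + C) fun n => ?_)
  have h1 := abs_rv_sub_lt f n
  have h2 := h n
  have h3 := abs_sub_le (rv f) (emb (ratSeq f n)) x
  rw [abs_sub_comm (emb _) x] at h3
  linarith

theorem rv_eq_of_regular {f : 𝓜.Obj Ty.real} {x : 𝓜.Lim} (C : 𝓜.Lim)
    (hf : ∀ k, |val (𝓜.app f k) - val (𝓜.app f (k + 1))| < eps (k + 1))
    (h : ∀ n, |x - emb (val (𝓜.app f n))| ≤ C * emb (eps n)) : rv f = x :=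
  rv_eq_of_abs_le C fun n => by rw [ratSeq_of_regular hf]; exact h n

/-! ### Equality and order -/

theorem sat_eqR (s t : Tm E Γ Ty.real) (θ : 𝓜.Env Γ) :
    𝓜.sat (s =ᵣ t) θ ↔ rv (𝓜.eval s θ) = rv (𝓜.eval t θ) := by
  set f := 𝓜.eval s θ with hf
  set g := 𝓜.eval t θ with hg
  have key : 𝓜.sat (s =ᵣ t) θ ↔ ∀ n, |ratSeq f (n + 1) - ratSeq g (n + 1)| < eps n := by
    simp only [eqR, sat_all, sat_eqN, eval_qLt, eval_qAbs, eval_qSub, eval_hat, eval_qPow,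
      eval_succ_app, eval_wk, eval_var_z, eval_zero, qLt_eq_zero_iff, val_abs, val_add, val_neg,
      val_qPow, ← sub_eq_add_neg, ratSeq, hf, hg]
  rw [key]
  constructor
  · intro h
    -- Two approximation errors of 2^(-n-1) and the gap of 2^(-n) between approximations add up to 2
    -- · 2^(-n).
    refine sub_eq_zero.1 (eq_zero_of_abs_le 2 fun n => ?_)
    have h1 := abs_lt.1 (abs_rv_sub_lt f (n + 1))
    have h2 := abs_lt.1 (abs_rv_sub_lt g (n + 1))
    have h3 := emb_lt.2 (h n)
    rw [emb_abs, map_sub, abs_lt] at h3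
    rw [emb_eps_add_one] at h1 h2
    rw [abs_le]
    constructor <;> linarith
  · intro h n
    have h1 := abs_lt.1 (abs_rv_sub_lt f (n + 1))
    have h2 := abs_lt.1 (abs_rv_sub_lt g (n + 1))
    rw [← emb_lt, emb_abs, map_sub, abs_lt]
    rw [emb_eps_add_one] at h1 h2
    rw [h] at h1
    constructor <;> linarith

theorem sat_ltR (s t : Tm E Γ Ty.real) (θ : 𝓜.Env Γ) :
    𝓜.sat (s <ᵣ t) θ ↔ rv (𝓜.eval s θ) < rv (𝓜.eval t θ) := by
  set f := 𝓜.eval s θ with hf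
  set g := 𝓜.eval t θ with hg
  have key : 𝓜.sat (s <ᵣ t) θ ↔ ∃ n, eps n ≤ ratSeq g (n + 1) - ratSeq f (n + 1) := by
    simp only [ltR, sat_ex, sat_eqN, eval_qLe, eval_qSub, eval_hat, eval_qPow,
      eval_succ_app, eval_wk, eval_var_z, eval_zero, qLe_eq_zero_iff, val_add, val_neg,
      val_qPow, ← sub_eq_add_neg, ratSeq, hf, hg]
  rw [key]
  constructor
  · rintro ⟨n, h⟩
    have h1 := abs_lt.1 (abs_rv_sub_lt f (n + 1))
    have h2 := abs_lt.1 (abs_rv_sub_lt g (n + 1))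
    have h3 := emb_le.2 h
    rw [map_sub] at h3
    rw [emb_eps_add_one] at h1 h2
    linarith
  · intro h
    -- The two approximation errors cost at most 2^(-n) together, and a gap of 2^(-n) has to remain.
    obtain ⟨n, hn⟩ := exists_emb_eps_lt (half_pos (sub_pos.2 h))
    refine ⟨n, ?_⟩
    have h1 := abs_lt.1 (abs_rv_sub_lt f (n + 1))
    have h2 := abs_lt.1 (abs_rv_sub_lt g (n + 1))
    rw [← emb_le, map_sub]
    rw [emb_eps_add_one] at h1 h2
    linarith

theorem sat_neg (A : Fm E Γ) (θ : 𝓜.Env Γ) : 𝓜.sat A.neg θ ↔ ¬ 𝓜.sat A θ := by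
  simp [Fm.neg, Fm.falsum]

theorem sat_leR (s t : Tm E Γ Ty.real) (θ : 𝓜.Env Γ) :
    𝓜.sat (s ≤ᵣ t) θ ↔ rv (𝓜.eval s θ) ≤ rv (𝓜.eval t θ) := by
  rw [leR, sat_neg, sat_ltR, not_lt]

/-! ### Operations -/

theorem rv_ofRat (q : Tm E Γ Ty.nat) (θ : 𝓜.Env Γ) :
    rv (𝓜.eval (ofRat q) θ) = emb (val (𝓜.eval q θ)) := by
  have h : ∀ n, 𝓜.app (𝓜.eval (ofRat q) θ) n = 𝓜.eval q θ := fun n => by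
    simp only [ofRat, cOfRat, eval_app, eval_cl, app_eval_lam, eval_var_s, eval_var_z]
  refine rv_eq_of_regular 0 (fun k => ?_) fun n => ?_
  · rw [h, h, sub_self, abs_zero]; exact eps_pos _
  · rw [h, sub_self, abs_zero, zero_mul]

theorem rv_rconst (a m : ℕ) (θ : 𝓜.Env Γ) :
    rv (𝓜.eval (rconst a m) θ) = (a : 𝓜.Lim) / ((m : 𝓜.Lim) + 1) := by
  rw [rconst, rv_ofRat, val_rat, map_div₀, map_add, map_natCast, map_natCast, map_one]

theorem rv_zero (θ : 𝓜.Env Γ) : rv (𝓜.eval (0 : Tm E Γ Ty.real) θ) = 0 := by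
  change rv (𝓜.eval (rconst 0 0) θ) = 0
  rw [rv_rconst]; simp

theorem rv_one (θ : 𝓜.Env Γ) : rv (𝓜.eval (1 : Tm E Γ Ty.real) θ) = 1 := by
  change rv (𝓜.eval (rconst 1 0) θ) = 1
  rw [rv_rconst]; simp

theorem rv_rpow (l : Tm E Γ Ty.nat) (θ : 𝓜.Env Γ) :
    rv (𝓜.eval (rpow l) θ) = emb (eps (𝓜.eval l θ)) := by
  rw [rpow, rv_ofRat, eval_qPow, val_qPow]

theorem rv_add (s t : Tm E Γ Ty.real) (θ : 𝓜.Env Γ) :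
    rv (𝓜.eval (s + t) θ) = rv (𝓜.eval s θ) + rv (𝓜.eval t θ) := by
  set f := 𝓜.eval s θ with hf
  set g := 𝓜.eval t θ with hg
  have h : ∀ n, val (𝓜.app (𝓜.eval (s + t) θ) n) = ratSeq f (n + 1) + ratSeq g (n + 1) :=
    fun n => by
      change val (𝓜.app (𝓜.eval (cRAdd.cl ⬝ s ⬝ t) θ) n) = _
      simp only [cRAdd, eval_app, eval_cl, app_eval_lam, eval_qAdd, eval_hat, app_eval_succ,
        eval_var_s, eval_var_z, val_add, ratSeq, hf, hg]
  refine rv_eq_of_regular 1 (fun k => ?_) fun n => ?_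
  · have h1 := abs_lt.1 (abs_ratSeq_sub_add_one_lt f (k + 1))
    have h2 := abs_lt.1 (abs_ratSeq_sub_add_one_lt g (k + 1))
    rw [h, h, abs_lt]
    rw [eps_add_one (k + 1)] at h1 h2
    constructor <;> linarith
  · have h1 := abs_lt.1 (abs_rv_sub_lt f (n + 1))
    have h2 := abs_lt.1 (abs_rv_sub_lt g (n + 1))
    rw [h, map_add, abs_le]
    rw [emb_eps_add_one] at h1 h2
    constructor <;> linarith

theorem rv_neg (t : Tm E Γ Ty.real) (θ : 𝓜.Env Γ) :
    rv (𝓜.eval (-t) θ) = -rv (𝓜.eval t θ) := by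
  set g := 𝓜.eval t θ with hg
  have h : ∀ n, val (𝓜.app (𝓜.eval (-t) θ) n) = -ratSeq g n := fun n => by
    change val (𝓜.app (𝓜.eval (cRNeg.cl ⬝ t) θ) n) = _
    simp only [cRNeg, eval_app, eval_cl, app_eval_lam, eval_qNeg, eval_hat, eval_var_s,
      eval_var_z, val_neg, ratSeq, hg]
  refine rv_eq_of_regular 1 (fun k => ?_) fun n => ?_
  · rw [h, h, neg_sub_neg, abs_sub_comm]
    exact abs_ratSeq_sub_add_one_lt g k
  · rw [h, map_neg, neg_sub_neg, abs_sub_comm, one_mul]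
    exact (abs_rv_sub_lt g n).le

theorem rv_sub (s t : Tm E Γ Ty.real) (θ : 𝓜.Env Γ) :
    rv (𝓜.eval (s - t) θ) = rv (𝓜.eval s θ) - rv (𝓜.eval t θ) := by
  change rv (𝓜.eval (s + -t) θ) = _
  rw [rv_add, rv_neg, sub_eq_add_neg]

theorem rv_rabs (t : Tm E Γ Ty.real) (θ : 𝓜.Env Γ) :
    rv (𝓜.eval (rabs t) θ) = |rv (𝓜.eval t θ)| := by
  set g := 𝓜.eval t θ with hg
  have h : ∀ n, val (𝓜.app (𝓜.eval (rabs t) θ) n) = |ratSeq g n| := fun n => by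
    simp only [rabs, cRAbs, eval_app, eval_cl, app_eval_lam, eval_qAbs, eval_hat, eval_var_s,
      eval_var_z, val_abs, ratSeq, hg]
  refine rv_eq_of_regular 1 (fun k => ?_) fun n => ?_
  · rw [h, h]
    exact (abs_abs_sub_abs_le_abs_sub _ _).trans_lt (abs_ratSeq_sub_add_one_lt g k)
  · rw [h, emb_abs, one_mul]
    exact (abs_abs_sub_abs_le_abs_sub _ _).trans (abs_rv_sub_lt g n).le

theorem abs_val_le (q : 𝓜.Num) : |val q| ≤ toQ (fn₁ cPos q + fn₁ cNeg q) := by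
  have h1 := Frac.of_nonneg (fn₁ cPos q)
  have h2 := Frac.of_nonneg (fn₁ cNeg q)
  rw [val, abs_div, abs_of_pos (toQ_add_one_pos _)]
  refine div_le_of_le_mul₀ (toQ_add_one_pos _).le (Frac.of_nonneg _) ?_
  refine le_trans ?_ (le_mul_of_one_le_right (Frac.of_nonneg _) (one_le_toQ (add_one_ne_zero _)))
  rw [map_add, abs_le]
  constructor <;> linarith

theorem abs_ratSeq_le (f : 𝓜.Obj Ty.real) (n : 𝓜.Num) :
    |ratSeq f n| ≤ toQ (fn₁ cPos (𝓜.app f 0) + fn₁ cNeg (𝓜.app f 0)) + 1 := by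
  have h1 := abs_ratSeq_sub_le f (show toQ 0 ≤ toQ n by simp [Frac.of_nonneg])
  rw [eps_zero, abs_sub_comm] at h1
  have h2 := abs_val_le (𝓜.app f 0)
  have h3 : ratSeq f 0 = val (𝓜.app f 0) := by rw [ratSeq, hatSeq_eq, hatIndex_zero]
  rw [← h3] at h2
  have h4 := abs_sub_abs_le_abs_sub (ratSeq f n) (ratSeq f 0)
  linarith

theorem abs_mul_sub_mul_le {K : Type*} [Field K] [LinearOrder K] [IsStrictOrderedRing K]
    {a b a' b' c e : K} (ha : |a| ≤ c) (hb : |b'| ≤ c) (h1 : |a - a'| ≤ e) (h2 : |b - b'| ≤ e) :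
    |a * b - a' * b'| ≤ c * e + c * e := by
  have hc := (abs_nonneg a).trans ha
  calc |a * b - a' * b'| = |a * (b - b') + b' * (a - a')| := by ring_nf
    _ ≤ |a| * |b - b'| + |b'| * |a - a'| := by
      rw [← abs_mul, ← abs_mul]; exact abs_add_le _ _
    _ ≤ c * e + c * e := add_le_add (mul_le_mul ha h2 (abs_nonneg _) hc)
      (mul_le_mul hb h1 (abs_nonneg _) hc)

end PreModel
namespace PreModel

variable {E : Ty → Type} {𝓜 : PreModel E} [ArithModel 𝓜] {Γ : Ctx} {σ τ : Ty}

/-! ### Multiplication and reciprocals -/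

theorem toQ_pow_mul_eps (k : 𝓜.Num) : toQ (fn₁ cPow2 k) * eps k = 1 :=
  mul_inv_cancel₀ (toQ_pos (pow_ne_zero k)).ne'

theorem rv_mul (s t : Tm E Γ Ty.real) (θ : 𝓜.Env Γ) :
    rv (𝓜.eval (s * t) θ) = rv (𝓜.eval s θ) * rv (𝓜.eval t θ) := by
  set f := 𝓜.eval s θ with hf
  set g := 𝓜.eval t θ with hg
  set kf := fn₁ cPos (𝓜.app f 0) + fn₁ cNeg (𝓜.app f 0) with hkf
  set kg := fn₁ cPos (𝓜.app g 0) + fn₁ cNeg (𝓜.app g 0) with hkg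
  set P := toQ (fn₁ cPow2 (kf + kg)) with hP
  have h : ∀ n, val (𝓜.app (𝓜.eval (s * t) θ) n) =
      ratSeq f (n + (kf + kg) + 1) * ratSeq g (n + (kf + kg) + 1) := fun n => by
    change val (𝓜.app (𝓜.eval (cRMul.cl ⬝ s ⬝ t) θ) n) = _
    simp only [cRMul, eval_app, eval_cl, app_eval_lam, eval_qMul, eval_hat, app_eval_succ,
      eval_var_s, eval_var_z, val_mul, ratSeq, hf, hg, eval_nAdd, eval_qPos, eval_qNegPart,
      eval_zero, hkf, hkg]
  -- The approximations are bounded by the numerator sum at 0 plus 1; k < 2^k turns this into the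
  -- common bound P = 2^(kf + kg).
  have hkP : toQ kf + toQ kg + 1 ≤ P := by
    have := toQ_lt_iff.1 (toQ_lt_pow (kf + kg))
    rwa [map_add] at this
  have hf0 := Frac.of_nonneg kf
  have hg0 := Frac.of_nonneg kg
  have hfP : ∀ n, |ratSeq f n| ≤ P := fun n => by
    have := abs_ratSeq_le f n
    linarith
  have hgP : ∀ n, |ratSeq g n| ≤ P := fun n => by
    have := abs_ratSeq_le g n
    linarith
  have hP0 : 0 < P := toQ_pos (pow_ne_zero _)
  refine rv_eq_of_regular (2 * max |rv f| (emb P)) (fun n => ?_) fun n => ?_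
  · rw [h, h, show n + 1 + (kf + kg) + 1 = n + (kf + kg) + 1 + 1 by ring]
    set m := n + (kf + kg) + 1 with hm
    have h1 := abs_ratSeq_sub_add_one_lt f m
    have h2 := abs_ratSeq_sub_add_one_lt g m
    have h3 := abs_mul_sub_mul_le (hfP m) (hgP (m + 1))
      (le_max_left |ratSeq f m - ratSeq f (m + 1)| |ratSeq g m - ratSeq g (m + 1)|)
      (le_max_right |ratSeq f m - ratSeq f (m + 1)| |ratSeq g m - ratSeq g (m + 1)|)
    refine h3.trans_lt ?_
    have h4 := mul_lt_mul_of_pos_left (max_lt h1 h2) hP0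
    -- The shift of the sampling index by kf + kg cancels the bound P, and the two extra halvings
    -- leave 2^(-n) / 4 for each of the two product terms.
    have h5 : P * eps (m + 1) = eps n / 4 := by
      rw [hm, eps_add_one, eps_add_one, eps_add]
      have := toQ_pow_mul_eps (kf + kg)
      linear_combination (eps n / 4) * this
    rw [h5] at h4
    rw [eps_add_one]
    linarith
  · rw [h, map_mul]
    set m := n + (kf + kg) + 1 with hm
    have h0 : emb (eps m) ≤ emb (eps n) := emb_le.2 (eps_anti (by
      have := Frac.of_nonneg (kf + kg)
      simp only [hm, toQ, map_add, map_one] at *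
      linarith))
    have h1 := (abs_rv_sub_lt f m).le.trans h0
    have h2 := (abs_rv_sub_lt g m).le.trans h0
    have h3 := abs_mul_sub_mul_le (le_max_left |rv f| (emb P))
      ((emb_abs (ratSeq g m) ▸ emb_le.2 (hgP m) : |emb (ratSeq g m)| ≤ emb P).trans
        (le_max_right |rv f| (emb P))) h1 h2
    linarith

theorem rv_rsq (t : Tm E Γ Ty.real) (θ : 𝓜.Env Γ) :
    rv (𝓜.eval (rsq t) θ) = rv (𝓜.eval t θ) ^ 2 := by
  rw [rsq, rv_mul, sq]

/-- Truncation at e makes the reciprocal Lipschitz with constant e⁻². For e = 2^(-l) this is exactly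
absorbed by sampling at n + 2l. -/
theorem abs_inv_max_sub_inv_max_le {K : Type*} [Field K] [LinearOrder K] [IsStrictOrderedRing K]
    (a b : K) {e : K} (he : 0 < e) :
    |(max a e)⁻¹ - (max b e)⁻¹| ≤ |a - b| * (e⁻¹ * e⁻¹) := by
  have ha : 0 < max a e := lt_max_of_lt_right he
  have hb : 0 < max b e := lt_max_of_lt_right he
  rw [inv_sub_inv ha.ne' hb.ne', abs_div, abs_of_pos (mul_pos ha hb), div_eq_mul_inv, mul_inv,
    abs_sub_comm]
  have h1 := inv_anti₀ he (le_max_right a e)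
  have h2 := inv_anti₀ he (le_max_right b e)
  exact mul_le_mul (abs_max_sub_max_le_abs a b e)
    (mul_le_mul h1 h2 (inv_pos.2 hb).le (inv_pos.2 he).le)
    (mul_pos (inv_pos.2 ha) (inv_pos.2 hb)).le (abs_nonneg _)

theorem eval_rat (a m : ℕ) (θ : 𝓜.Env Γ) :
    𝓜.eval (rat a m) θ = fn₂ cPair ((2 * a : ℕ) : 𝓜.Num) (m : 𝓜.Num) := by
  simp only [rat, eval_nPair, eval_numeral]

theorem app_rinv (l : Tm E Γ Ty.nat) (t : Tm E Γ Ty.real) (θ : 𝓜.Env Γ) (n : 𝓜.Num) :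
    𝓜.app (𝓜.eval (rinv l t) θ) n =
      let q := hatSeq (𝓜.eval t θ) (n + 2 * 𝓜.eval l θ)
      let e := fn₁ cQPow (𝓜.eval l θ)
      fn₁ cQInv (fn₃ cCond (fn₂ cQLt (𝓜.eval (rat 0 0 : Tm E [] Ty.nat) 𝓜.nil) q) (fn₃ cCond (fn₂ cQLe e q) q e)
        (fn₃ cCond (fn₂ cQLe q (fn₁ cQNeg e)) q (fn₁ cQNeg e))) := by
  simp only [rinv, cRInv, eval_app, eval_cl, app_eval_lam, eval_qInv, eval_nCond, eval_qLt,
    eval_hat, eval_nAdd, eval_nMul, eval_numeral, eval_qLe, eval_qNeg, eval_qPow, eval_var_s,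
    eval_var_z, Nat.cast_ofNat, eval_rat]

theorem eps_add_two_mul (n l : 𝓜.Num) :
    eps (n + 2 * l) * ((eps l)⁻¹ * (eps l)⁻¹) = eps n := by
  have h := (eps_pos l).ne'
  rw [two_mul, ← add_assoc, eps_add, eps_add]
  field_simp

theorem rv_rinv {l : Tm E Γ Ty.nat} {t : Tm E Γ Ty.real} {θ : 𝓜.Env Γ}
    (hl : emb (eps (𝓜.eval l θ)) < |rv (𝓜.eval t θ)|) :
    rv (𝓜.eval (rinv l t) θ) = (rv (𝓜.eval t θ))⁻¹ := by
  set f := 𝓜.eval t θ with hf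
  set a := 𝓜.eval l θ with ha
  have h0 : val (𝓜.eval (rat 0 0) 𝓜.nil) = 0 := by rw [val_rat]; simp
  -- Sampling errors are at most 2^(-l), while the number exceeds 2^(-l) in absolute value; so every
  -- sampled approximation has its sign.
  have heps : ∀ n, emb (eps (n + 2 * a)) ≤ emb (eps a) := fun n => emb_le.2 (eps_anti (by
    have h1 := Frac.of_nonneg n
    have h2 := Frac.of_nonneg a
    simp only [toQ, map_add, map_mul, map_ofNat]
    linarith))
  have he := eps_pos a
  have he' := emb_eps_pos a
  have hn : ∀ n, emb (eps (n + 2 * a)) * ((emb (eps a))⁻¹ * (emb (eps a))⁻¹) = emb (eps n) :=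
    fun n => by rw [← map_inv₀, ← map_mul, ← map_mul, eps_add_two_mul]
  have hmax : ∀ x : 𝓜.Rtl, emb (max x (eps a))⁻¹ = (max (emb x) (emb (eps a)))⁻¹ := fun x => by
    rw [map_inv₀, emb_strictMono.monotone.map_max]
  rcases lt_abs.1 hl with hpos | hneg
  · have h : ∀ n, val (𝓜.app (𝓜.eval (rinv l t) θ) n) =
        (max (ratSeq f (n + 2 * a)) (eps a))⁻¹ := fun n => by
      have h1 := abs_lt.1 (abs_rv_sub_lt f (n + 2 * a))
      have h2 : 0 < ratSeq f (n + 2 * a) := by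
        rw [← emb_lt, map_zero]; linarith [heps n]
      rw [app_rinv]
      simp only
      rw [(qLt_eq_zero_iff _ _).2 (by rw [h0]; exact h2), cond_zero, val_inv]
      congr 1
      by_cases h3 : eps a ≤ ratSeq f (n + 2 * a)
      · rw [(qLe_eq_zero_iff _ _).2 (by rw [val_qPow]; exact h3), cond_zero, max_eq_left h3]; rfl
      · rw [cond_of_ne_zero, val_qPow, max_eq_right (not_le.1 h3).le]
        rw [Ne, qLe_eq_zero_iff, val_qPow]; exact h3
    refine rv_eq_of_regular 1 (fun n => ?_) fun n => ?_
    · rw [h, h, show n + 1 + 2 * a = n + 2 * a + 1 by ring]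
      refine (abs_inv_max_sub_inv_max_le _ _ he).trans_lt ?_
      rw [← eps_add_two_mul (n + 1) a, show n + 1 + 2 * a = n + 2 * a + 1 by ring]
      exact mul_lt_mul_of_pos_right (abs_ratSeq_sub_add_one_lt _ _) (by positivity)
    · rw [h, hmax]
      -- Truncation changes approximations but not the limit, which lies above the threshold.
      have h1 : rv f = max (rv f) (emb (eps a)) := (max_eq_left hpos.le).symm
      rw [h1, one_mul, ← hn n]
      refine (abs_inv_max_sub_inv_max_le _ _ he').trans ?_
      exact mul_le_mul_of_nonneg_right (abs_rv_sub_lt _ _).le (by positivity)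
  · have h : ∀ n, val (𝓜.app (𝓜.eval (rinv l t) θ) n) =
        -(max (-ratSeq f (n + 2 * a)) (eps a))⁻¹ := fun n => by
      have h1 := abs_lt.1 (abs_rv_sub_lt f (n + 2 * a))
      have h2 : ratSeq f (n + 2 * a) < 0 := by
        rw [← emb_lt, map_zero]; linarith [heps n]
      rw [app_rinv]
      simp only
      rw [cond_of_ne_zero (by rw [Ne, qLt_eq_zero_iff, h0]; exact h2.le.not_gt), val_inv, ← inv_neg]
      congr 1
      by_cases h3 : ratSeq f (n + 2 * a) ≤ -eps a
      · rw [(qLe_eq_zero_iff _ _).2 (by rw [val_neg, val_qPow]; exact h3), cond_zero,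
          max_eq_left (by linarith), neg_neg]; rfl
      · rw [cond_of_ne_zero, val_neg, val_qPow, max_eq_right (by linarith [not_le.1 h3])]
        rw [Ne, qLe_eq_zero_iff, val_neg, val_qPow]; exact h3
    refine rv_eq_of_regular 1 (fun n => ?_) fun n => ?_
    · rw [h, h, show n + 1 + 2 * a = n + 2 * a + 1 by ring, neg_sub_neg, abs_sub_comm]
      refine (abs_inv_max_sub_inv_max_le _ _ he).trans_lt ?_
      rw [← eps_add_two_mul (n + 1) a, show n + 1 + 2 * a = n + 2 * a + 1 by ring, neg_sub_neg,
        abs_sub_comm]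
      exact mul_lt_mul_of_pos_right (abs_ratSeq_sub_add_one_lt _ _) (by positivity)
    · rw [h, map_neg, hmax, map_neg]
      have h1 : (rv f)⁻¹ = -(max (-rv f) (emb (eps a)))⁻¹ := by
        rw [max_eq_left hneg.le, inv_neg, neg_neg]
      rw [h1, one_mul, ← hn n, neg_sub_neg, abs_sub_comm]
      refine (abs_inv_max_sub_inv_max_le _ _ he').trans ?_
      rw [neg_sub_neg, abs_sub_comm]
      exact mul_le_mul_of_nonneg_right (abs_rv_sub_lt _ _).le (by positivity)

end PreModel
/-! ## The inner product space of a model -/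

/-! ### Polarization from the parallelogram law -/

section Polarization

variable {V K : Type*} [AddCommGroup V] [Field K] [CharZero K] {q : V → K}

theorem quadratic_zero (hq : ∀ x y, q (x + y) + q (x - y) = 2 * (q x + q y)) : q 0 = 0 := by
  have := hq 0 0
  rw [add_zero, sub_zero] at this
  linear_combination (-1 / 2 : K) * this

theorem quadratic_neg (hq : ∀ x y, q (x + y) + q (x - y) = 2 * (q x + q y)) (x : V) : q (-x) = q x := by
  have := hq 0 x
  rw [zero_add, zero_sub, quadratic_zero hq] at this
  linear_combination this

theorem polar_neg_left (hq : ∀ x y, q (x + y) + q (x - y) = 2 * (q x + q y))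
    (x y : V) :
    (q (-x + y) - q (-x - y)) / 4 = -((q (x + y) - q (x - y)) / 4) := by
  have h1 := quadratic_neg hq (x - y)
  have h2 := quadratic_neg hq (x + y)
  rw [neg_sub, sub_eq_neg_add] at h1
  rw [neg_add'] at h2
  rw [h1, h2]
  ring

/-- With P the polar form, subtracting the parallelogram laws for (x + z, y) and (x - z, y) gives
P(x + y, z) + P(x - y, z) = 2P(x, z). Exchange x and y, add, and cancel the difference terms by
oddness; no vector has to be halved. -/
theorem polar_add_left (hq : ∀ x y, q (x + y) + q (x - y) = 2 * (q x + q y))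
    (x y z : V) :
    (q (x + y + z) - q (x + y - z)) / 4 =
      (q (x + z) - q (x - z)) / 4 + (q (y + z) - q (y - z)) / 4 := by
  have key : ∀ x y : V, (q (x + y + z) - q (x + y - z)) + (q (x - y + z) - q (x - y - z)) =
      2 * (q (x + z) - q (x - z)) := fun x y => by
    have h1 := hq (x + z) y
    have h2 := hq (x - z) y
    rw [add_right_comm, add_sub_right_comm] at h1
    rw [sub_add_eq_add_sub, sub_right_comm] at h2
    linear_combination h1 - h2
  have h1 := key x y
  have h2 := key y x
  have h3 := polar_neg_left hq (x - y) z
  rw [neg_sub] at h3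
  rw [add_comm y x] at h2
  linear_combination (1 / 8 : K) * h1 + (1 / 8 : K) * h2 - (1 / 2 : K) * h3

end Polarization

/-- The axioms of inner product spaces hold in a model. -/
class InnerModel {E : Ty → Type} (𝓜 : PreModel E) : Prop extends ArithModel 𝓜 where
  sat_axioms : ∀ A ∈ innerAxioms, 𝓜.sat A 𝓜.nil

/-! ### Vectors, norm and inner product of a model -/

namespace PreModel

variable {E : Ty → Type} {𝓜 : PreModel E} {Γ : Ctx} {σ τ : Ty}

/-- Addition of representatives. -/
def addX (x y : 𝓜.Obj Ty.X) : 𝓜.Obj Ty.X := 𝓜.app (𝓜.app (𝓜.con .addX) x) y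

/-- Negation of representatives. -/
def negX (x : 𝓜.Obj Ty.X) : 𝓜.Obj Ty.X := 𝓜.app (𝓜.con .negX) x

/-- Multiplication of representatives by scalars. -/
def smulX (a : 𝓜.Obj Ty.real) (x : 𝓜.Obj Ty.X) : 𝓜.Obj Ty.X := 𝓜.app (𝓜.app (𝓜.con .smulX) a) x

theorem eval_addX (s t : Tm E Γ Ty.X) (θ : 𝓜.Env Γ) :
    𝓜.eval (s + t) θ = addX (𝓜.eval s θ) (𝓜.eval t θ) := rfl

theorem eval_subX (s t : Tm E Γ Ty.X) (θ : 𝓜.Env Γ) :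
    𝓜.eval (s - t) θ = addX (𝓜.eval s θ) (negX (𝓜.eval t θ)) := rfl

theorem eval_smulX (s : Tm E Γ Ty.real) (t : Tm E Γ Ty.X) (θ : 𝓜.Env Γ) :
    𝓜.eval (s • t) θ = smulX (𝓜.eval s θ) (𝓜.eval t θ) := rfl

section

variable [ArithModel 𝓜]

/-- The norm of a representative. -/
noncomputable def nmX (x : 𝓜.Obj Ty.X) : 𝓜.Lim := rv (𝓜.app (𝓜.con .normX) x)

theorem rv_nrm (t : Tm E Γ Ty.X) (θ : 𝓜.Env Γ) : rv (𝓜.eval (nrm t) θ) = nmX (𝓜.eval t θ) := rfl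

theorem sat_eqX_iff_nmX (s t : Tm E Γ Ty.X) (θ : 𝓜.Env Γ) :
    𝓜.sat (s =ₓ t) θ ↔ nmX (addX (𝓜.eval s θ) (negX (𝓜.eval t θ))) = 0 := by
  rw [eqX, sat_eqR, rv_zero, rv_nrm, eval_subX]

end

variable [InnerModel 𝓜]

theorem sat_of_mem_vectorSpaceAxioms {A : Fm E []} (h : A ∈ vectorSpaceAxioms) :
    𝓜.sat A 𝓜.nil := InnerModel.sat_axioms A (Or.inl (Or.inl h))

theorem sat_of_mem_normAxioms {A : Fm E []} (h : A ∈ normAxioms) :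
    𝓜.sat A 𝓜.nil := InnerModel.sat_axioms A (Or.inl (Or.inr h))

theorem nmX_sub_self (x : 𝓜.Obj Ty.X) : nmX (addX x (negX x)) = 0 := by
  have h := sat_of_mem_normAxioms (𝓜 := 𝓜)
    (A := all₁ Ty.X fun x => nrm (x - x) =ᵣ 0) (by simp [normAxioms]) x
  rwa [sat_eqR, rv_zero] at h

theorem nmX_sub_comm (x y : 𝓜.Obj Ty.X) : nmX (addX x (negX y)) = nmX (addX y (negX x)) := by
  have h := sat_of_mem_normAxioms (𝓜 := 𝓜)
    (A := all₂ Ty.X Ty.X fun x y => nrm (x - y) =ᵣ nrm (y - x)) (by simp [normAxioms]) x y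
  rwa [sat_eqR] at h

theorem nmX_triangle (x y z : 𝓜.Obj Ty.X) :
    nmX (addX x (negX z)) ≤ nmX (addX x (negX y)) + nmX (addX y (negX z)) := by
  have h := sat_of_mem_normAxioms (𝓜 := 𝓜)
    (A := all₃ Ty.X Ty.X Ty.X fun x y z => nrm (x - z) ≤ᵣ nrm (x - y) + nrm (y - z))
    (by simp [normAxioms]) x y z
  rwa [sat_leR, rv_add] at h

theorem nmX_smul_sub_smul (a : 𝓜.Obj Ty.real) (x y : 𝓜.Obj Ty.X) :
    nmX (addX (smulX a x) (negX (smulX a y))) = |rv a| * nmX (addX x (negX y)) := by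
  have h := sat_of_mem_normAxioms (𝓜 := 𝓜)
    (A := all₃ Ty.real Ty.X Ty.X fun α x y => nrm (α • x - α • y) =ᵣ rabs α * nrm (x - y))
    (by simp [normAxioms]) a x y
  rwa [sat_eqR, rv_mul, rv_rabs] at h

theorem nmX_smul_sub_smul_right (a b : 𝓜.Obj Ty.real) (x : 𝓜.Obj Ty.X) :
    nmX (addX (smulX a x) (negX (smulX b x))) = |rv a - rv b| * nmX x := by
  have h := sat_of_mem_normAxioms (𝓜 := 𝓜)
    (A := all₃ Ty.real Ty.real Ty.X fun α β x => nrm (α • x - β • x) =ᵣ rabs (α - β) * nrm x)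
    (by simp [normAxioms]) a b x
  rwa [sat_eqR, rv_mul, rv_rabs, rv_sub] at h

theorem nmX_add_sub_add_le (x y u v : 𝓜.Obj Ty.X) :
    nmX (addX (addX x y) (negX (addX u v))) ≤ nmX (addX x (negX u)) + nmX (addX y (negX v)) := by
  have h := sat_of_mem_normAxioms (𝓜 := 𝓜)
    (A := all₄ Ty.X Ty.X Ty.X Ty.X fun x y u v =>
      nrm ((x + y) - (u + v)) ≤ᵣ nrm (x - u) + nrm (y - v))
    (by simp [normAxioms]) x y u v
  rwa [sat_leR, rv_add] at h

theorem nmX_neg_sub_neg (x y : 𝓜.Obj Ty.X) :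
    nmX (addX (negX x) (negX (negX y))) = nmX (addX x (negX y)) := by
  have h := sat_of_mem_normAxioms (𝓜 := 𝓜)
    (A := all₂ Ty.X Ty.X fun x y => nrm (-x - -y) =ᵣ nrm (x - y)) (by simp [normAxioms]) x y
  rwa [sat_eqR] at h

theorem abs_nmX_sub_nmX_le (x y : 𝓜.Obj Ty.X) : |nmX x - nmX y| ≤ nmX (addX x (negX y)) := by
  have h := sat_of_mem_normAxioms (𝓜 := 𝓜)
    (A := all₂ Ty.X Ty.X fun x y => rabs (nrm x - nrm y) ≤ᵣ nrm (x - y))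
    (by simp [normAxioms]) x y
  rwa [sat_leR, rv_rabs, rv_sub] at h

theorem nmX_sub_nonneg (x y : 𝓜.Obj Ty.X) : 0 ≤ nmX (addX x (negX y)) := by
  have h1 := nmX_triangle x y x
  rw [nmX_sub_self, nmX_sub_comm y x] at h1
  linarith

variable (𝓜) in
/-- Equality of elements of the space. -/
def setoidX : Setoid (𝓜.Obj Ty.X) where
  r x y := nmX (addX x (negX y)) = 0
  iseqv :=
    { refl := nmX_sub_self
      symm := fun h => by rwa [nmX_sub_comm]
      trans := fun {x y z} h h' => by
        have := nmX_triangle x y z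
        rw [h, h', add_zero] at this
        exact le_antisymm this (nmX_sub_nonneg _ _) }

variable (𝓜) in
/-- The elements of the space. -/
def Vec : Type := Quotient 𝓜.setoidX

/-- The element of the space given by a representative. -/
def cls (x : 𝓜.Obj Ty.X) : 𝓜.Vec := Quotient.mk 𝓜.setoidX x

theorem cls_eq_iff {x y : 𝓜.Obj Ty.X} : cls x = cls y ↔ nmX (addX x (negX y)) = 0 :=
  Quotient.eq (r := 𝓜.setoidX)

theorem exists_cls (v : 𝓜.Vec) : ∃ x, cls x = v := Quotient.exists_rep v

theorem sat_eqX (s t : Tm E Γ Ty.X) (θ : 𝓜.Env Γ) :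
    𝓜.sat (s =ₓ t) θ ↔ cls (𝓜.eval s θ) = cls (𝓜.eval t θ) := by
  rw [sat_eqX_iff_nmX, cls_eq_iff]

instance : Zero 𝓜.Vec := ⟨cls (𝓜.con .zeroX)⟩

instance : Add 𝓜.Vec := ⟨Quotient.map₂ addX fun x x' h y y' h' => by
  have := nmX_add_sub_add_le x y x' y'
  rw [show nmX (addX x (negX x')) = 0 from h, show nmX (addX y (negX y')) = 0 from h',
    add_zero] at this
  exact le_antisymm this (nmX_sub_nonneg _ _)⟩

instance : Neg 𝓜.Vec := ⟨Quotient.map negX fun x y h => (nmX_neg_sub_neg x y).trans h⟩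

/-- Multiplication by scalars. -/
def act (a : 𝓜.Obj Ty.real) : 𝓜.Vec → 𝓜.Vec := Quotient.map (smulX a) fun x y h => by
  have := nmX_smul_sub_smul a x y
  rw [show nmX (addX x (negX y)) = 0 from h, mul_zero] at this
  exact this

theorem cls_addX (x y : 𝓜.Obj Ty.X) : cls (addX x y) = cls x + cls y := rfl

theorem cls_negX (x : 𝓜.Obj Ty.X) : cls (negX x) = -cls x := rfl

theorem cls_smulX (a : 𝓜.Obj Ty.real) (x : 𝓜.Obj Ty.X) : cls (smulX a x) = act a (cls x) := rfl

theorem vec_add_zero (v : 𝓜.Vec) : v + 0 = v := by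
  obtain ⟨x, rfl⟩ := exists_cls v
  have h := sat_of_mem_vectorSpaceAxioms (𝓜 := 𝓜)
    (A := all₁ Ty.X fun x => x + 0 =ₓ x) (by simp [vectorSpaceAxioms]) x
  rwa [sat_eqX] at h

theorem vec_add_comm (v w : 𝓜.Vec) : v + w = w + v := by
  obtain ⟨x, rfl⟩ := exists_cls v
  obtain ⟨y, rfl⟩ := exists_cls w
  have h := sat_of_mem_vectorSpaceAxioms (𝓜 := 𝓜)
    (A := all₂ Ty.X Ty.X fun x y => x + y =ₓ y + x) (by simp [vectorSpaceAxioms]) x y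
  rwa [sat_eqX] at h

theorem vec_add_neg (v : 𝓜.Vec) : v + -v = 0 := by
  obtain ⟨x, rfl⟩ := exists_cls v
  have h := sat_of_mem_vectorSpaceAxioms (𝓜 := 𝓜)
    (A := all₁ Ty.X fun x => x + -x =ₓ 0) (by simp [vectorSpaceAxioms]) x
  rwa [sat_eqX] at h

theorem vec_add_assoc (u v w : 𝓜.Vec) : u + v + w = u + (v + w) := by
  obtain ⟨x, rfl⟩ := exists_cls u
  obtain ⟨y, rfl⟩ := exists_cls v
  obtain ⟨z, rfl⟩ := exists_cls w
  have h := sat_of_mem_vectorSpaceAxioms (𝓜 := 𝓜)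
    (A := all₃ Ty.X Ty.X Ty.X fun x y z => (x + y) + z =ₓ x + (y + z))
    (by simp [vectorSpaceAxioms]) x y z
  rwa [sat_eqX] at h

noncomputable instance : AddCommGroup 𝓜.Vec where
  add_assoc := vec_add_assoc
  zero_add v := (vec_add_comm _ _).trans (vec_add_zero v)
  add_zero := vec_add_zero
  add_comm := vec_add_comm
  neg_add_cancel v := (vec_add_comm _ _).trans (vec_add_neg v)
  nsmul := nsmulRec
  zsmul := zsmulRec

theorem cls_subX (x y : 𝓜.Obj Ty.X) : cls (addX x (negX y)) = cls x - cls y := by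
  rw [cls_addX, cls_negX, sub_eq_add_neg]

theorem act_add (a : 𝓜.Obj Ty.real) (v w : 𝓜.Vec) : act a (v + w) = act a v + act a w := by
  obtain ⟨x, rfl⟩ := exists_cls v
  obtain ⟨y, rfl⟩ := exists_cls w
  have h := sat_of_mem_vectorSpaceAxioms (𝓜 := 𝓜)
    (A := all₃ Ty.real Ty.X Ty.X fun α x y => α • (x + y) =ₓ α • x + α • y)
    (by simp [vectorSpaceAxioms]) a x y
  rwa [sat_eqX] at h

/-- The norm. -/
noncomputable def nm (v : 𝓜.Vec) : 𝓜.Lim :=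
  Quotient.lift (s := 𝓜.setoidX) nmX (fun x y h => by
    have := abs_nmX_sub_nmX_le x y
    rw [show nmX (addX x (negX y)) = 0 from h] at this
    exact sub_eq_zero.1 (abs_eq_zero.1 (le_antisymm this (abs_nonneg _)))) v

theorem nm_cls (x : 𝓜.Obj Ty.X) : nm (cls x) = nmX x := rfl

theorem nm_nonneg (v : 𝓜.Vec) : 0 ≤ nm v := by
  obtain ⟨x, rfl⟩ := exists_cls v
  obtain ⟨z, hz⟩ := exists_cls (0 : 𝓜.Vec)
  rw [← _root_.sub_zero (cls x), ← hz, ← cls_subX]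
  exact nmX_sub_nonneg x z

theorem nm_eq_zero {v : 𝓜.Vec} : nm v = 0 ↔ v = 0 := by
  obtain ⟨x, rfl⟩ := exists_cls v
  obtain ⟨z, hz⟩ := exists_cls (0 : 𝓜.Vec)
  rw [← hz, cls_eq_iff, ← nm_cls, cls_subX, hz, _root_.sub_zero]

theorem nm_sub_le (u v w : 𝓜.Vec) : nm (u - w) ≤ nm (u - v) + nm (v - w) := by
  obtain ⟨x, rfl⟩ := exists_cls u
  obtain ⟨y, rfl⟩ := exists_cls v
  obtain ⟨z, rfl⟩ := exists_cls w
  exact nmX_triangle x y z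

theorem nm_act_sub_act (a b : 𝓜.Obj Ty.real) (v : 𝓜.Vec) :
    nm (act a v - act b v) = |rv a - rv b| * nm v := by
  obtain ⟨x, rfl⟩ := exists_cls v
  exact nmX_smul_sub_smul_right a b x

theorem act_congr {a b : 𝓜.Obj Ty.real} (h : rv a = rv b) (v : 𝓜.Vec) : act a v = act b v := by
  have := nm_act_sub_act a b v
  rw [h, sub_self, abs_zero, zero_mul, nm_eq_zero, sub_eq_zero] at this
  exact this

/-- Stated through values, so that it applies to any representative of the sum; this is possible
because the action depends only on values (`act_congr`). -/
theorem add_act {a b c : 𝓜.Obj Ty.real} (h : rv c = rv a + rv b) (v : 𝓜.Vec) :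
    act c v = act a v + act b v := by
  obtain ⟨x, rfl⟩ := exists_cls v
  have h' := sat_of_mem_vectorSpaceAxioms (𝓜 := 𝓜)
    (A := all₃ Ty.real Ty.real Ty.X fun α β x => (α + β) • x =ₓ α • x + β • x)
    (by simp [vectorSpaceAxioms]) a b x
  rw [sat_eqX, eval_addX, eval_smulX, eval_smulX, eval_smulX, cls_addX, cls_smulX, cls_smulX,
    cls_smulX] at h'
  refine (act_congr ?_ _).trans h'
  rw [rv_add]
  exact h

theorem mul_act {a b c : 𝓜.Obj Ty.real} (h : rv c = rv a * rv b) (v : 𝓜.Vec) :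
    act c v = act a (act b v) := by
  obtain ⟨x, rfl⟩ := exists_cls v
  have h' := sat_of_mem_vectorSpaceAxioms (𝓜 := 𝓜)
    (A := all₃ Ty.real Ty.real Ty.X fun α β x => (α * β) • x =ₓ α • (β • x))
    (by simp [vectorSpaceAxioms]) a b x
  rw [sat_eqX, eval_smulX, eval_smulX, eval_smulX, cls_smulX, cls_smulX, cls_smulX] at h'
  refine (act_congr ?_ _).trans h'
  rw [rv_mul]
  exact h

theorem one_act {a : 𝓜.Obj Ty.real} (h : rv a = 1) (v : 𝓜.Vec) : act a v = v := by
  obtain ⟨x, rfl⟩ := exists_cls v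
  have h' := sat_of_mem_vectorSpaceAxioms (𝓜 := 𝓜)
    (A := all₁ Ty.X fun x => (1 : Tm E [Ty.X] Ty.real) • x =ₓ x)
    (by simp [vectorSpaceAxioms]) x
  rw [sat_eqX, eval_smulX, cls_smulX] at h'
  refine (act_congr ?_ _).trans h'
  rw [rv_one]
  exact h

theorem nm_parallelogram (v w : 𝓜.Vec) :
    nm (v + w) ^ 2 + nm (v - w) ^ 2 = 2 * (nm v ^ 2 + nm w ^ 2) := by
  obtain ⟨x, rfl⟩ := exists_cls v
  obtain ⟨y, rfl⟩ := exists_cls w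
  have h := InnerModel.sat_axioms (𝓜 := 𝓜) _ (Or.inr rfl) x y
  rw [sat_eqR, rv_mul, rv_add, rv_add] at h
  simp only [rv_rsq, rv_rconst, Nat.cast_zero, zero_add, div_one] at h
  exact h

/-- The inner product. -/
noncomputable def inn (v w : 𝓜.Vec) : 𝓜.Lim := (nm (v + w) ^ 2 - nm (v - w) ^ 2) / 4

theorem inn_add_left (u v w : 𝓜.Vec) : inn (u + v) w = inn u w + inn v w :=
  polar_add_left (q := fun v => nm v ^ 2) nm_parallelogram u v w

theorem inn_neg_left (v w : 𝓜.Vec) : inn (-v) w = -inn v w :=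
  polar_neg_left (q := fun v => nm v ^ 2) nm_parallelogram v w

theorem nm_neg_sq (v : 𝓜.Vec) : nm (-v) ^ 2 = nm v ^ 2 :=
  quadratic_neg (q := fun v => nm v ^ 2) nm_parallelogram v

theorem inn_comm (v w : 𝓜.Vec) : inn v w = inn w v := by
  rw [inn, inn, add_comm, ← nm_neg_sq (v - w), neg_sub]

theorem inn_self (v : 𝓜.Vec) : inn v v = nm v ^ 2 := by
  have h := nm_parallelogram v v
  have h0 : nm (0 : 𝓜.Vec) = 0 := nm_eq_zero.2 rfl
  rw [sub_self, h0] at h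
  rw [inn, sub_self, h0]
  linear_combination h / 4

theorem inn_sub_left (u v w : 𝓜.Vec) : inn (u - v) w = inn u w - inn v w := by
  rw [sub_eq_add_neg, inn_add_left, inn_neg_left, sub_eq_add_neg]

theorem inn_add_right (u v w : 𝓜.Vec) : inn u (v + w) = inn u v + inn u w := by
  rw [inn_comm, inn_add_left, inn_comm v, inn_comm w]

theorem inn_sub_right (u v w : 𝓜.Vec) : inn u (v - w) = inn u v - inn u w := by
  rw [inn_comm, inn_sub_left, inn_comm v, inn_comm w]

theorem nm_neg (v : 𝓜.Vec) : nm (-v) = nm v :=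
  (sq_eq_sq₀ (nm_nonneg _) (nm_nonneg _)).1 (nm_neg_sq v)

theorem nm_add_le (v w : 𝓜.Vec) : nm (v + w) ≤ nm v + nm w := by
  have := nm_sub_le v 0 (-w)
  rwa [sub_neg_eq_add, _root_.sub_zero, zero_sub, neg_neg] at this

/-- Cauchy–Schwarz without homogeneity, which is proved from it later: the triangle inequality
bounds 4⟨v, w⟩ by (‖v‖ + ‖w‖)² - (‖v‖ - ‖w‖)². -/
theorem inn_le (v w : 𝓜.Vec) : inn v w ≤ nm v * nm w := by
  have h1 := nm_add_le v w
  have h2 := nm_add_le (v - w) w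
  have h3 := nm_add_le (w - v) v
  rw [sub_add_cancel] at h2 h3
  rw [← nm_neg (w - v), neg_sub] at h3
  have h4 : |nm v - nm w| ≤ nm (v - w) := by
    rw [abs_le]; constructor <;> linarith
  have h5 : (nm v - nm w) ^ 2 ≤ nm (v - w) ^ 2 := by
    rw [← sq_abs (nm v - nm w)]
    exact pow_le_pow_left₀ (abs_nonneg _) h4 2
  have h6 : nm (v + w) ^ 2 ≤ (nm v + nm w) ^ 2 := pow_le_pow_left₀ (nm_nonneg _) h1 2
  rw [inn]
  linarith

theorem abs_inn_le (v w : 𝓜.Vec) : |inn v w| ≤ nm v * nm w := by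
  refine abs_le'.2 ⟨inn_le v w, ?_⟩
  rw [← inn_neg_left, ← nm_neg v]
  exact inn_le _ _

theorem rv_ip (s t : Tm E Γ Ty.X) (θ : 𝓜.Env Γ) :
    rv (𝓜.eval (ip s t) θ) = inn (cls (𝓜.eval s θ)) (cls (𝓜.eval t θ)) := by
  rw [ip, rv_mul, rv_rconst, rv_sub, rv_rsq, rv_rsq, rv_nrm, rv_nrm, ← nm_cls, ← nm_cls, eval_addX,
    eval_subX, cls_addX, cls_subX, inn]
  push_cast
  ring

theorem exists_rv_val (q : 𝓜.Num) : ∃ a : 𝓜.Obj Ty.real, rv a = emb (val q) :=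
  ⟨_, rv_ofRat v0 (cons q 𝓜.nil)⟩

theorem rv_numeral (n : Tm E Γ Ty.nat) (θ : 𝓜.Env Γ) :
    rv (𝓜.eval (ofRat (nPair (nMul (numeral 2) n) tZero)) θ) = emb (toQ (𝓜.eval n θ)) := by
  rw [rv_ofRat]
  simp only [eval_nPair, eval_nMul, eval_numeral, eval_zero, Nat.cast_ofNat]
  rw [val_pair_two_mul, zero_add, map_one, div_one]

theorem exists_rv_toQ (n : 𝓜.Num) : ∃ a : 𝓜.Obj Ty.real, rv a = emb (toQ n) :=
  ⟨_, rv_numeral v0 (cons n 𝓜.nil)⟩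

theorem exists_rv_mul (a b : 𝓜.Obj Ty.real) : ∃ c, rv c = rv a * rv b :=
  ⟨_, rv_mul v1 v0 (cons b (cons a 𝓜.nil))⟩

/-- Homogeneity for internal natural numbers. These may be nonstandard, so the statement is phrased
as a formula and proved by internal induction, with parameters of type X in place of vectors. -/
theorem inn_act_of_toQ {n : 𝓜.Num} :
    ∀ {a : 𝓜.Obj Ty.real} (v w : 𝓜.Vec), rv a = emb (toQ n) → inn (act a v) w = rv a * inn v w := by
  suffices h : ∀ (x y : 𝓜.Obj Ty.X) (a : 𝓜.Obj Ty.real), rv a = emb (toQ n) →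
      inn (act a (cls x)) (cls y) = rv a * inn (cls x) (cls y) by
    intro a v w ha
    obtain ⟨x, rfl⟩ := exists_cls v
    obtain ⟨y, rfl⟩ := exists_cls w
    exact h x y a ha
  intro x y
  refine num_induction (ip ((ofRat (nPair (nMul (numeral 2) v0) tZero) :
      Tm E [Ty.nat, Ty.X, Ty.X] Ty.real) • (v2 : Tm E [Ty.nat, Ty.X, Ty.X] Ty.X)) v1 =ᵣ
    ofRat (nPair (nMul (numeral 2) v0) tZero) * ip v2 v1) (cons y (cons x 𝓜.nil)) (fun n => ?_) ?_
    (fun n ih a ha => ?_) n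
  · rw [sat_eqR, rv_mul, rv_ip, rv_ip, eval_smulX, cls_smulX]
    refine ⟨fun h a ha => ?_, fun h => h _ (rv_numeral _ _)⟩
    have h0 := rv_numeral v0 (cons n (cons y (cons x 𝓜.nil)))
    rw [act_congr (ha.trans h0.symm), ha.trans h0.symm]
    exact h
  · intro a ha
    rw [map_zero, map_zero] at ha
    -- For a scalar of value 0 the product is its own double, so its inner product with y vanishes
    -- by additivity.
    have h0 := add_act (a := a) (b := a) (c := a) (by rw [ha, add_zero]) (cls x)
    have h1 : inn (act a (cls x) + act a (cls x)) (cls y) = inn (act a (cls x)) (cls y) := by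
      rw [← h0]
    rw [inn_add_left] at h1
    rw [ha]
    linear_combination h1
  · obtain ⟨b, hb⟩ := exists_rv_toQ n
    obtain ⟨c, hc⟩ := exists_rv_toQ (1 : 𝓜.Num)
    rw [map_add, map_add, ← hb, ← hc] at ha
    rw [map_one, map_one] at hc
    rw [add_act ha, inn_add_left, ih b hb, one_act hc, ha, hc]
    ring

/-- Clear the denominator: d · a = p - m with d, p, m internal natural numbers, then cancel the
nonzero value of d. -/
theorem inn_act_of_val {q : 𝓜.Num} {a : 𝓜.Obj Ty.real} (v w : 𝓜.Vec) (ha : rv a = emb (val q)) :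
    inn (act a v) w = rv a * inn v w := by
  obtain ⟨p, hp⟩ := exists_rv_toQ (fn₁ cPos q)
  obtain ⟨m, hm⟩ := exists_rv_toQ (fn₁ cNeg q)
  obtain ⟨d, hd⟩ := exists_rv_toQ (fn₁ cSnd q + 1)
  obtain ⟨c, hc⟩ := exists_rv_mul d a
  have hd0 : rv d ≠ 0 := by
    rw [hd, Ne, map_eq_zero]
    exact (toQ_add_one_pos _).ne'
  have h1 : rv d * rv a = rv p - rv m := by
    rw [hd, ha, hp, hm, ← map_mul, ← map_sub, val,
      mul_div_cancel₀ _ (toQ_add_one_pos (fn₁ cSnd q)).ne']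
  have h2 : rv p = rv c + rv m := by rw [hc]; linear_combination -h1
  have h3 := inn_act_of_toQ v w hp
  rw [add_act h2, mul_act hc, inn_add_left, inn_act_of_toQ _ _ hd, inn_act_of_toQ _ _ hm] at h3
  have h4 : rv d * (inn (act a v) w - rv a * inn v w) = 0 := by
    linear_combination h3 - inn v w * h1
  exact sub_eq_zero.1 ((mul_eq_zero.1 h4).resolve_left hd0)

/-- Replace a by its rational approximations. The error in the action is controlled by the norm
axiom for scalar differences together with Cauchy–Schwarz, so it is a fixed multiple of 2^(-n). -/
theorem inn_act_left (a : 𝓜.Obj Ty.real) (v w : 𝓜.Vec) : inn (act a v) w = rv a * inn v w := by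
  refine sub_eq_zero.1 (eq_zero_of_abs_le (nm v * nm w + nm v * nm w) fun n => ?_)
  obtain ⟨b, hb⟩ := exists_rv_val (hatSeq a n)
  have hab : |rv a - rv b| ≤ emb (eps n) := by rw [hb]; exact (abs_rv_sub_lt a n).le
  have h1 := abs_inn_le (act a v - act b v) w
  rw [nm_act_sub_act, inn_sub_left, inn_act_of_val v w hb] at h1
  have h2 := abs_inn_le v w
  have hvw := mul_nonneg (nm_nonneg v) (nm_nonneg w)
  calc |inn (act a v) w - rv a * inn v w|
      = |(inn (act a v) w - rv b * inn v w) - (rv a - rv b) * inn v w| := by ring_nf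
    _ ≤ |inn (act a v) w - rv b * inn v w| + |(rv a - rv b) * inn v w| := abs_sub _ _
    _ ≤ |rv a - rv b| * nm v * nm w + |rv a - rv b| * (nm v * nm w) := by
      rw [abs_mul]
      exact add_le_add h1 (mul_le_mul_of_nonneg_left h2 (abs_nonneg _))
    _ = (nm v * nm w + nm v * nm w) * |rv a - rv b| := by ring
    _ ≤ (nm v * nm w + nm v * nm w) * emb (eps n) :=
      mul_le_mul_of_nonneg_left hab (by linarith)

theorem inn_act_right (a : 𝓜.Obj Ty.real) (v w : 𝓜.Vec) : inn v (act a w) = rv a * inn v w := by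
  rw [inn_comm, inn_act_left, inn_comm]

end PreModel
/-! ## Validity of the sentences -/

namespace PreModel

section Inner

variable {E : Ty → Type} {𝓜 : PreModel E} [InnerModel 𝓜] {Γ : Ctx}

theorem rv_nrm_cls (t : Tm E Γ Ty.X) (θ : 𝓜.Env Γ) :
    rv (𝓜.eval (nrm t) θ) = nm (cls (𝓜.eval t θ)) := rfl

theorem cls_eval_add (s t : Tm E Γ Ty.X) (θ : 𝓜.Env Γ) :
    cls (𝓜.eval (s + t) θ) = cls (𝓜.eval s θ) + cls (𝓜.eval t θ) := rfl

theorem cls_eval_sub (s t : Tm E Γ Ty.X) (θ : 𝓜.Env Γ) :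
    cls (𝓜.eval (s - t) θ) = cls (𝓜.eval s θ) - cls (𝓜.eval t θ) := by
  rw [eval_subX, cls_subX]

theorem cls_eval_smul (s : Tm E Γ Ty.real) (t : Tm E Γ Ty.X) (θ : 𝓜.Env Γ) :
    cls (𝓜.eval (s • t) θ) = act (𝓜.eval s θ) (cls (𝓜.eval t θ)) := rfl

theorem rv_two (θ : 𝓜.Env Γ) : rv (𝓜.eval (rconst 2 0 : Tm E Γ Ty.real) θ) = 2 := by
  rw [rv_rconst]; norm_num

theorem rv_half (θ : 𝓜.Env Γ) : rv (𝓜.eval (rconst 1 1 : Tm E Γ Ty.real) θ) = 1 / 2 := by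
  rw [rv_rconst]; norm_num

theorem sat_invertible (l : Tm E Γ Ty.nat) (t : Tm E Γ Ty.real) (θ : 𝓜.Env Γ) :
    𝓜.sat (invertible l t) θ ↔ emb (eps (𝓜.eval l θ)) < |rv (𝓜.eval t θ)| := by
  rw [invertible, sat_ltR, rv_rpow, rv_rabs]

theorem rv_ne_zero_of_invertible {l : 𝓜.Num} {x : 𝓜.Lim} (h : emb (eps l) < |x|) : x ≠ 0 :=
  abs_pos.1 ((emb_eps_pos l).trans h)

theorem act_sub (a : 𝓜.Obj Ty.real) (v w : 𝓜.Vec) : act a (v - w) = act a v - act a w := by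
  rw [eq_sub_iff_add_eq, ← act_add, sub_add_cancel]

theorem nm_act_add_act_sq (a b : 𝓜.Obj Ty.real) (v w : 𝓜.Vec) :
    nm (act a v + act b w) ^ 2 =
      rv a ^ 2 * nm v ^ 2 + 2 * (rv a * rv b * inn v w) + rv b ^ 2 * nm w ^ 2 := by
  rw [← inn_self, ← inn_self v, ← inn_self w]
  simp only [inn_add_left, inn_add_right, inn_act_left, inn_act_right, inn_comm w v]
  ring

theorem nm_sub_sq (v w : 𝓜.Vec) : nm (v - w) ^ 2 = nm v ^ 2 - 2 * inn v w + nm w ^ 2 := by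
  rw [← inn_self, ← inn_self v, ← inn_self w]
  simp only [inn_sub_left, inn_sub_right, inn_comm w v]
  ring

theorem sat_averagedIdentity {𝓜 : PreModel NoConst} [InnerModel 𝓜] :
    𝓜.sat sentenceAveragedIdentity 𝓜.nil := by
  intro α x y l
  simp only [sat_imp, sat_and, sat_invertible]
  rintro ⟨-, -, hl⟩
  simp only [sat_eqR, rv_mul, rv_sub, rv_one, rv_rsq, rv_nrm_cls, cls_eval_add, cls_eval_smul,
    cls_eval_sub, nm_act_add_act_sq, rv_rinv hl, nm_sub_sq]
  have h := rv_ne_zero_of_invertible hl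
  field_simp
  ring

theorem sat_conicalIdentity {𝓜 : PreModel NoConst} [InnerModel 𝓜] :
    𝓜.sat sentenceConicalIdentity 𝓜.nil := by
  intro α x y
  simp only [sat_eqR, rv_mul, rv_sub, rv_one, rv_rsq, rv_nrm_cls, cls_eval_add, cls_eval_smul,
    cls_eval_sub, rv_two, rv_ip, nm_sub_sq, inn_sub_left]
  simp only [← inn_self, inn_add_left, inn_add_right, inn_act_left, inn_act_right, rv_sub, rv_one]
  rw [inn_comm (cls (𝓜.eval v0 _))]
  ring

end Inner

end PreModel

/-- The axioms for comonotone operators hold in a model. -/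
class OpModel (𝓜 : PreModel OpConst) : Prop extends InnerModel 𝓜 where
  sat_operatorAxioms : ∀ A ∈ operatorAxioms, 𝓜.sat A 𝓜.nil

/-! ### Resolvents of comonotone operators -/

namespace PreModel

variable {𝓜 : PreModel OpConst} {Γ : Ctx}

/-- Membership in the graph of the operator: `y ∈ A x`. -/
def Mem (y x : 𝓜.Obj Ty.X) : Prop :=
  𝓜.app (𝓜.app (𝓜.con (.extra .chi)) x) y = (0 : 𝓜.Num)

/-- The resolvent. -/
def resolvent (a : 𝓜.Obj Ty.real) (x : 𝓜.Obj Ty.X) : 𝓜.Obj Ty.X :=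
  𝓜.app (𝓜.app (𝓜.con (.extra .res)) a) x

theorem sat_memA (x y : Tm OpConst Γ Ty.X) (θ : 𝓜.Env Γ) :
    𝓜.sat (memA x y) θ ↔ Mem (𝓜.eval x θ) (𝓜.eval y θ) := Iff.rfl

theorem eval_res (γ : Tm OpConst Γ Ty.real) (x : Tm OpConst Γ Ty.X) (θ : 𝓜.Env Γ) :
    𝓜.eval (res γ x) θ = resolvent (𝓜.eval γ θ) (𝓜.eval x θ) := rfl

section

variable [ArithModel 𝓜]

variable (𝓜) in
/-- The value of the constant `ρ̃`. -/
noncomputable def rhoVal : 𝓜.Lim := rv (𝓜.con (.extra .rho))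

theorem rv_rho (θ : 𝓜.Env Γ) : rv (𝓜.eval rho θ) = 𝓜.rhoVal := rfl

end

variable [OpModel 𝓜]

/-- Choosing l with 2^(-l) < γ discharges the side condition of the resolvent axiom and makes
(γ)⁻¹_l a true reciprocal. -/
theorem exists_mem_resolvent (γ : 𝓜.Obj Ty.real) (hγ : 0 < rv γ) : ∃ a : 𝓜.Obj Ty.real,
    rv a = (rv γ)⁻¹ ∧
      ∀ x, Mem (smulX a (addX x (negX (resolvent γ x)))) (resolvent γ x) := by
  obtain ⟨l, hl⟩ := exists_emb_eps_lt hγ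
  refine ⟨𝓜.eval (rinv v0 v1) (cons l (cons γ 𝓜.nil)), ?_, fun x => ?_⟩
  · exact rv_rinv (l := v0) (t := v1) (hl.trans_le (le_abs_self _))
  · have h := OpModel.sat_operatorAxioms (𝓜 := 𝓜)
      (all₃ Ty.real Ty.X Ty.nat fun γ x l =>
        rpow l <ᵣ γ ⇨' memA (rinv l γ • (x - res γ x)) (res γ x)) (by simp [operatorAxioms]) γ x l
    rw [sat_imp, sat_ltR, rv_rpow, sat_memA, eval_smulX, eval_subX, eval_res] at h
    have h1 := h hl
    simpa only [rinv, eval_app, eval_cl, eval_var_z, eval_var_s] using h1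

theorem comonotone {x y u v : 𝓜.Obj Ty.X} (h : Mem u x) (h' : Mem v y) :
    𝓜.rhoVal * nm (cls u - cls v) ^ 2 ≤ inn (cls x - cls y) (cls u - cls v) := by
  have h0 := OpModel.sat_operatorAxioms (𝓜 := 𝓜)
    (all₄ Ty.X Ty.X Ty.X Ty.X fun x y u v =>
      memA u x ⋏ memA v y ⇨' rho * rsq (nrm (u - v)) ≤ᵣ ip (x - y) (u - v))
    (by simp [operatorAxioms])
  replace h0 := h0 x y u v ⟨h, h'⟩
  rw [sat_leR, rv_mul, rv_rsq, rv_nrm_cls, rv_ip, cls_eval_sub, cls_eval_sub] at h0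
  exact h0

/-- Comonotonicity for u = a(x - p) and v = b(y - q) reads ρ̃a²‖d‖² ≤ a⟨p - q, d⟩; divide by a > 0.
The scalars are kept as separate representatives because membership in the graph is not assumed to
respect equality of vectors or reals. -/
theorem comonotone_smul {a b : 𝓜.Obj Ty.real} {x y p q : 𝓜.Obj Ty.X} (hab : rv a = rv b)
    (ha : 0 < rv a) (h : Mem (smulX a (addX x (negX p))) p)
    (h' : Mem (smulX b (addX y (negX q))) q) :
    𝓜.rhoVal * rv a * nm ((cls x - cls p) - (cls y - cls q)) ^ 2 ≤
      inn (cls p - cls q) ((cls x - cls p) - (cls y - cls q)) := by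
  have h0 := comonotone h h'
  rw [cls_smulX, cls_smulX, cls_subX, cls_subX, ← act_congr hab, ← act_sub, inn_act_right,
    ← inn_self, inn_act_right, inn_act_left, inn_self] at h0
  refine le_of_mul_le_mul_left ?_ ha
  linarith

/-- For equal x and y one has d = -(p - q), so ρ̃a‖p - q‖² ≤ -‖p - q‖² with ρ̃a > -1. Allowing
different representatives lets this give both single-valuedness and extensionality. -/
theorem eq_of_mem {a b : 𝓜.Obj Ty.real} {x y p q : 𝓜.Obj Ty.X} (hab : rv a = rv b)
    (ha : 0 < rv a) (hρ : -(rv a)⁻¹ < 𝓜.rhoVal) (hxy : cls x = cls y)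
    (h : Mem (smulX a (addX x (negX p))) p) (h' : Mem (smulX b (addX y (negX q))) q) :
    cls p = cls q := by
  have h0 := comonotone_smul hab ha h h'
  rw [hxy, sub_sub_sub_cancel_left, ← neg_sub (cls p), nm_neg, inn_comm, inn_neg_left,
    inn_self] at h0
  have h1 : -1 < 𝓜.rhoVal * rv a := by
    have := mul_lt_mul_of_pos_right hρ ha
    rwa [neg_mul, inv_mul_cancel₀ ha.ne'] at this
  have h2 : nm (cls p - cls q) ^ 2 ≤ 0 := by
    by_contra! h3
    nlinarith
  have h3 : nm (cls p - cls q) = 0 := pow_eq_zero_iff two_ne_zero |>.1 (le_antisymm h2 (sq_nonneg _))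
  exact sub_eq_zero.1 (nm_eq_zero.1 h3)

theorem resolvent_comonotone {γ : 𝓜.Obj Ty.real} (hγ : 0 < rv γ) (x y : 𝓜.Obj Ty.X) :
    𝓜.rhoVal * (rv γ)⁻¹ * nm ((cls x - cls (resolvent γ x)) - (cls y - cls (resolvent γ y))) ^ 2 ≤
      inn (cls (resolvent γ x) - cls (resolvent γ y))
        ((cls x - cls (resolvent γ x)) - (cls y - cls (resolvent γ y))) := by
  obtain ⟨a, ha, h⟩ := exists_mem_resolvent γ hγ
  rw [← ha]
  exact comonotone_smul rfl (ha ▸ inv_pos.2 hγ) (h x) (h y)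

theorem sat_singleValued : 𝓜.sat sentenceSingleValued 𝓜.nil := by
  intro p x γ l
  simp only [sat_imp, sat_and, sat_invertible, sat_ltR, rv_zero, rv_neg, rv_rho, sat_memA, sat_eqX,
    eval_smulX, eval_subX, eval_res]
  rintro ⟨hγ, hρ, hl, hp⟩
  obtain ⟨a, ha, h⟩ := exists_mem_resolvent _ hγ
  have hr := rv_rinv hl
  exact eq_of_mem (hr.trans ha.symm) (hr ▸ inv_pos.2 hγ) (by rwa [hr, inv_inv]) rfl hp (h _)

theorem sat_extensional : 𝓜.sat sentenceExtensional 𝓜.nil := by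
  intro γ γ' x x'
  simp only [sat_imp, sat_and, sat_ltR, rv_zero, rv_neg, rv_rho, sat_eqX, sat_eqR, eval_res]
  rintro ⟨hγ, hγ', hρ, hx, hγγ⟩
  obtain ⟨a, ha, h⟩ := exists_mem_resolvent _ hγ
  obtain ⟨b, hb, h'⟩ := exists_mem_resolvent _ hγ'
  exact eq_of_mem (by rw [ha, hb, hγγ]) (ha ▸ inv_pos.2 hγ) (by rwa [ha, inv_inv]) hx (h _) (h' _)

theorem rv_alphaDenom {l : Tm OpConst Γ Ty.nat} {γ : Tm OpConst Γ Ty.real} {θ : 𝓜.Env Γ}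
    (hl : emb (eps (𝓜.eval l θ)) < |rv (𝓜.eval γ θ)|) :
    rv (𝓜.eval (alphaDenom l γ) θ) = 2 * (𝓜.rhoVal * (rv (𝓜.eval γ θ))⁻¹ + 1) := by
  rw [alphaDenom, rv_mul, rv_two, rv_add, rv_mul, rv_rho, rv_one, rv_rinv hl]

theorem neg_one_lt_mul_inv {K : Type*} [Field K] [LinearOrder K] [IsStrictOrderedRing K] {g r : K}
    (hg : 0 < g) (h : -g < r) : -1 < r * g⁻¹ := by
  rw [← div_eq_mul_inv, lt_div_iff₀ hg]; linarith

theorem cls_resDiff (γ : Tm OpConst Γ Ty.real) (x y : Tm OpConst Γ Ty.X) (θ : 𝓜.Env Γ) :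
    cls (𝓜.eval (resDiff γ x y) θ) =
      (cls (𝓜.eval x θ) - cls (𝓜.eval (res γ x) θ)) -
        (cls (𝓜.eval y θ) - cls (𝓜.eval (res γ y) θ)) := by
  rw [resDiff, cls_eval_sub, cls_eval_sub, cls_eval_sub]

theorem nm_sub_sq_eq (x y p q : 𝓜.Vec) : nm (x - y) ^ 2 =
    nm ((x - p) - (y - q)) ^ 2 + 2 * inn (p - q) ((x - p) - (y - q)) + nm (p - q) ^ 2 := by
  have : x - y = ((x - p) - (y - q)) + (p - q) := by abel
  rw [this, ← inn_self, inn_add_left, inn_add_right, inn_add_right, inn_self, inn_self,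
    inn_comm _ (p - q)]
  ring

theorem inn_sub_sub_eq (x y p q : 𝓜.Vec) : inn (x - y) (p - q) =
    inn (p - q) ((x - p) - (y - q)) + nm (p - q) ^ 2 := by
  have : x - y = ((x - p) - (y - q)) + (p - q) := by abel
  rw [this, inn_add_left, inn_self, inn_comm]

/-- Put d = (x - p) - (y - q) and e = p - q. As b + c has value 1, the relaxed difference is e - (2D
+ 1)d, and its squared norm falls short of ‖d + e‖² by 4(D + 1)(⟨e, d⟩ - D‖d‖²) ≥ 0. -/
theorem nm_relaxed_le {b c : 𝓜.Obj Ty.real} {x y p q : 𝓜.Vec} {D : 𝓜.Lim}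
    (hb : rv b = 1 - 2 * (D + 1)) (hc : rv c = 2 * (D + 1)) (hD : -1 < D)
    (h : D * nm ((x - p) - (y - q)) ^ 2 ≤ inn (p - q) ((x - p) - (y - q))) :
    nm ((act b x + act c p) - (act b y + act c q)) ≤ nm (x - y) := by
  have h0 : (act b x + act c p) - (act b y + act c q) = act b (x - y) + act c (p - q) := by
    rw [act_sub, act_sub]; abel
  refine (sq_le_sq₀ (nm_nonneg _) (nm_nonneg _)).1 ?_
  rw [h0, nm_act_add_act_sq, inn_sub_sub_eq, nm_sub_sq_eq x y p q, hb, hc]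
  have h1 := mul_le_mul_of_nonneg_left h (show 0 ≤ D + 1 by linarith)
  linear_combination 4 * h1

theorem two_mul_inv_two_mul {K : Type*} [Field K] [CharZero K] (D : K) :
    2 * (2 * (D + 1))⁻¹ = (D + 1)⁻¹ := by
  rw [mul_inv, mul_inv_cancel_left₀ two_ne_zero]

/-- With 2α = 1/(D + 1) one has 1 - 2α = D/(D + 1), so this is the hypothesis divided by D + 1. -/
theorem conicalAlt_aux {K : Type*} [Field K] [LinearOrder K] [IsStrictOrderedRing K] {D S T : K}
    (hD : -1 < D) (h : D * S ≤ T) : (1 - 2 * (2 * (D + 1))⁻¹) * S ≤ 2 * (2 * (D + 1))⁻¹ * T := by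
  have h1 : 0 < D + 1 := by linarith
  have h3 := mul_le_mul_of_nonneg_left h (inv_pos.2 h1).le
  have h4 := inv_mul_cancel₀ h1.ne'
  rw [two_mul_inv_two_mul]
  linear_combination h3 - S * h4

theorem sat_conicalAlt : 𝓜.sat sentenceConicalAlt 𝓜.nil := by
  intro γ x y l m
  simp only [sat_imp, sat_and, sat_invertible, sat_ltR, rv_zero, rv_neg, rv_rho]
  rintro ⟨hγ, hρ, hl, hm⟩
  rw [sat_leR]
  simp only [rv_mul, rv_sub, rv_one, rv_two, rv_rsq, alpha, rv_rinv hm, rv_nrm_cls, cls_resDiff,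
    rv_ip, cls_eval_sub]
  rw [rv_alphaDenom hl]
  exact conicalAlt_aux (neg_one_lt_mul_inv hγ hρ) (resolvent_comonotone hγ x y)

theorem sat_conical : 𝓜.sat sentenceConical 𝓜.nil := by
  intro γ x y l m k
  simp only [sat_imp, sat_and, sat_invertible, sat_ltR, rv_zero, rv_neg, rv_rho]
  rintro ⟨hγ, hρ, hl⟩
  have hD := neg_one_lt_mul_inv hγ hρ
  have hpos : 0 < 2 * (𝓜.rhoVal * (rv γ)⁻¹ + 1) := mul_pos two_pos (neg_lt_iff_pos_add.1 hD)
  refine ⟨(rv_alphaDenom hl).symm ▸ hpos, fun hm => ?_⟩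
  have hα := (rv_rinv hm).trans (congrArg (·⁻¹) (rv_alphaDenom hl))
  refine ⟨hα.symm ▸ inv_pos.2 hpos, fun hk => ?_⟩
  have hα' := ((rv_rinv hk).trans (congrArg (·⁻¹) hα)).trans (inv_inv _)
  rw [sat_leR]
  simp only [rv_nrm_cls, cls_eval_sub, relaxed, cls_eval_add, cls_eval_smul]
  exact nm_relaxed_le (by rw [rv_sub, rv_one]; exact congrArg _ hα') hα' hD
    (resolvent_comonotone hγ x y)

theorem neg_half_le_mul_inv {K : Type*} [Field K] [LinearOrder K] [IsStrictOrderedRing K]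
    {g r : K} (hg : 0 < g) (h : -(1 / 2 * g) ≤ r) : -(1 / 2) ≤ r * g⁻¹ := by
  rw [← div_eq_mul_inv, le_div_iff₀ hg]; linarith

theorem neg_half_lt_mul_inv {K : Type*} [Field K] [LinearOrder K] [IsStrictOrderedRing K]
    {g r : K} (hg : 0 < g) (h : -(1 / 2 * g) < r) : -(1 / 2) < r * g⁻¹ := by
  rw [← div_eq_mul_inv, lt_div_iff₀ hg]; linarith

theorem rv_negHalf (γ : Tm OpConst Γ Ty.real) (θ : 𝓜.Env Γ) :
    rv (𝓜.eval (negHalf γ) θ) = -(1 / 2 * rv (𝓜.eval γ θ)) := by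
  rw [negHalf, rv_neg, rv_mul, rv_half]

theorem sat_nonexpansive : 𝓜.sat sentenceNonexpansive 𝓜.nil := by
  intro γ x y
  simp only [sat_imp, sat_and, sat_ltR, sat_leR, rv_zero, rv_negHalf, rv_rho, rv_nrm_cls,
    cls_eval_sub, eval_res]
  rintro ⟨hγ, hρ⟩
  have hD := neg_half_le_mul_inv (g := rv γ) hγ hρ
  have h := resolvent_comonotone (γ := γ) hγ x y
  refine (sq_le_sq₀ (nm_nonneg _) (nm_nonneg _)).1 ?_
  change nm (cls (resolvent γ x) - cls (resolvent γ y)) ^ 2 ≤ nm (cls x - cls y) ^ 2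
  rw [nm_sub_sq_eq (cls x) (cls y) (cls (resolvent γ x)) (cls (resolvent γ y))]
  have h1 := mul_le_mul_of_nonneg_right hD
    (sq_nonneg (nm ((cls x - cls (resolvent γ x)) - (cls y - cls (resolvent γ y)))))
  -- D ≥ -1/2 gives ‖d‖² + 2⟨e, d⟩ ≥ 0, which is what separates ‖x - y‖² from ‖e‖².
  exact le_add_of_nonneg_left (by linarith [h1.trans h])

/-- Since ‖x - y‖² = S + 2T + F, moving αS to the left yields the inequality (1 - 2α)S ≤ 2αT. -/
theorem averagedAlt_aux {K : Type*} [Field K] [LinearOrder K] [IsStrictOrderedRing K]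
    {D S T F : K} (hD : -1 < D) (h : D * S ≤ T) :
    (1 - (2 * (D + 1))⁻¹) * S ≤ (2 * (D + 1))⁻¹ * (S + 2 * T + F - F) := by
  have := conicalAlt_aux hD h
  linear_combination this

theorem sat_averagedAlt : 𝓜.sat sentenceAveragedAlt 𝓜.nil := by
  intro γ x y l m
  simp only [sat_imp, sat_and, sat_invertible, sat_ltR, sat_leR, rv_zero, rv_negHalf, rv_rho]
  rintro ⟨hγ, hρ, hl, hm⟩
  simp only [rv_mul, rv_sub, rv_one, rv_rsq, alpha, rv_rinv hm, rv_nrm_cls, cls_resDiff,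
    cls_eval_sub]
  rw [rv_alphaDenom hl]
  have hD := neg_half_le_mul_inv hγ hρ
  have h := averagedAlt_aux (F := nm (cls (resolvent γ x) - cls (resolvent γ y)) ^ 2)
    (lt_of_lt_of_le (by norm_num) hD) (resolvent_comonotone (γ := γ) hγ x y)
  rw [← nm_sub_sq_eq] at h
  exact h

theorem sat_averaged : 𝓜.sat sentenceAveraged 𝓜.nil := by
  intro γ x y l m k
  simp only [sat_imp, sat_and, sat_invertible, sat_ltR, rv_zero, rv_negHalf, rv_rho, rv_one]
  rintro ⟨hγ, hρ, hl⟩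
  have hD := neg_half_lt_mul_inv hγ hρ
  have hone : 1 < 2 * (𝓜.rhoVal * (rv γ)⁻¹ + 1) := by
    change -(1 / 2) < 𝓜.rhoVal * (rv γ)⁻¹ at hD
    linarith
  have hpos := zero_lt_one.trans hone
  refine ⟨(rv_alphaDenom hl).symm ▸ hpos, fun hm => ?_⟩
  have hα := (rv_rinv hm).trans (congrArg (·⁻¹) (rv_alphaDenom hl))
  refine ⟨⟨hα.symm ▸ inv_pos.2 hpos, hα.symm ▸ inv_lt_one_of_one_lt₀ hone⟩, fun hk => ?_⟩
  have hα' := ((rv_rinv hk).trans (congrArg (·⁻¹) hα)).trans (inv_inv _)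
  rw [sat_leR]
  simp only [rv_nrm_cls, cls_eval_sub, relaxed, cls_eval_add, cls_eval_smul]
  exact nm_relaxed_le (by rw [rv_sub, rv_one]; exact congrArg _ hα') hα'
    (lt_trans (by norm_num) hD) (resolvent_comonotone hγ x y)

end PreModel

/-! ### From truth in models to provability -/

instance (τ : Ty) : Countable (NoConst τ) := inferInstanceAs (Countable Empty)

instance (τ : Ty) : Countable (OpConst τ) := by
  let f : OpConst τ → ℕ := fun c => match c with
    | .chi => 0
    | .res => 1
    | .rho => 2
    | .gam => 3
    | .mGam => 4
    | .nGam => 5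
    | .cX => 6
  refine Function.Injective.countable (f := f) fun a b h => ?_
  cases a <;> cases b <;> first | rfl | exact absurd h (by decide)

theorem proves_inner {E : Ty → Type} [∀ τ, Countable (E τ)] {S : Fm E []}
    (h : ∀ 𝓜 : PreModel E, InnerModel 𝓜 → 𝓜.sat S 𝓜.nil) : Proves innerAxioms S :=
  proves_of_models fun 𝓜 _ hax => h 𝓜 { sat_axioms := hax }

theorem proves_operator {S : Fm OpConst []}
    (h : ∀ 𝓜 : PreModel OpConst, OpModel 𝓜 → 𝓜.sat S 𝓜.nil) : Proves uAxioms S :=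
  proves_of_models fun 𝓜 _ hax => h 𝓜
    { sat_axioms := fun A hA => hax A (Or.inl hA)
      sat_operatorAxioms := fun A hA => hax A (Or.inr hA) }

end ProofMining

theorem mainTheorem8 :
    -- the theory of real inner product spaces
    Proves innerAxioms sentenceAveragedIdentity ∧
    Proves innerAxioms sentenceConicalIdentity ∧
    -- the theory of maximally comonotone operators
    Proves uAxioms sentenceSingleValued ∧
    Proves uAxioms sentenceExtensional ∧
    Proves uAxioms sentenceConicalAlt ∧
    Proves uAxioms sentenceConical ∧
    Proves uAxioms sentenceNonexpansive ∧
    Proves uAxioms sentenceAveragedAlt ∧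
    Proves uAxioms sentenceAveraged :=
  ⟨proves_inner fun _ _ => PreModel.sat_averagedIdentity,
    proves_inner fun _ _ => PreModel.sat_conicalIdentity,
    proves_operator fun _ _ => PreModel.sat_singleValued,
    proves_operator fun _ _ => PreModel.sat_extensional,
    proves_operator fun _ _ => PreModel.sat_conicalAlt,
    proves_operator fun _ _ => PreModel.sat_conical,
    proves_operator fun _ _ => PreModel.sat_nonexpansive,
    proves_operator fun _ _ => PreModel.sat_averagedAlt,
    proves_operator fun _ _ => PreModel.sat_averaged⟩
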